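/- Let $1\le p<\infty$ and $n\in\mathbb N$, and put $B_n=\ell^p(\{0,\dots,n\},\mathbb R)$, $H_n=\ell^2(\{0,\dots,n\},\mathbb R)$ and $\mathbb R_+=[0,\infty)$. For a finite-dimensional real Hilbert space $V$ let $\mathrm{Cl}(V)$ be the complex Clifford $C^*$-algebra generated by the operators $\hat v=C(v)+C(v)^*$, $v\in V$, on the antisymmetric Fock space $\Lambda^*V_{\mathbb C}$ (where $C(v)w=v\wedge w$), graded by $\hat v\mapsto-\hat v$; write $v$ for $\hat v$, and regard $\mathrm{Cl}(H_n)\subseteq\mathrm{Cl}(H_n\oplus\mathbb R)$. Let $\mathcal S=C_0(\mathbb R)$, graded by even and odd functions. For $f\in\mathcal S$ with even and odd parts $f_{ev},f_{odd}$ and for $v\in V$ put $f(v)=f_{ev}(\|v\|)\,1+f_{odd}(\|v\|)\frac{v}{\|v\|}\in\mathrm{Cl}(V)$, where the second summand is $0$ if $v=0$. Let $\psi(a_0,\dots,a_n)=(\mathrm{sgn}(a_i)|a_i|^{p/2})_i$ be the Mazur map from the unit sphere of $B_n$ to that of $H_n$, and let $\phi_n:B_n\to H_n$ be its extension $\phi_n(0)=0$,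 $\phi_n(x)=\|x\|_p^{p/2}\,\psi(x/\|x\|_p)$ for $x\neq0$. For $x_0\in B_n$ and $f\in\mathcal S$ define $$\beta^n_{x_0}(f):B_n\times\mathbb R_+\to\mathrm{Cl}(H_n\oplus\mathbb R),\qquad \beta^n_{x_0}(f)(x,t)=f\big((\phi_n(x-x_0),t)\big).$$ Let $\mathcal A(B_n)$ be the $C^*$-algebra generated by all $\beta^n_{x_0}(f)$ ($x_0\in B_n$, $f\in\mathcal S$) in the $C^*$-algebra $C_{b,0}(B_n\times\mathbb R_+,\mathrm{Cl}(H_n\oplus\mathbb R))$ of bounded continuous functions $F:B_n\times\mathbb R_+\to\mathrm{Cl}(H_n\oplus\mathbb R)$ with $F(x,0)\in\mathrm{Cl}(H_n)$ for all $x\in B_n$, with the pointwise grading. Let $\mathcal S\mathcal C(B_n)=\mathcal S\,\hat\otimes\,C_0(B_n,\mathrm{Cl}(H_n))$ be the graded tensor product of $C^*$-algebras, where $C_0(B_n,\mathrm{Cl}(H_n))$ carries the pointwise grading. ($\mathcal S$ is nuclear, so the $C^*$-norm on the algebraic graded tensor product is unique; take the maximal one.) Theorem. There is a grading-preserving $*$-isomorphism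 $\Phi:\mathcal S\mathcal C(B_n)\to\mathcal A(B_n)$. Moreover $\Phi$ can be chosen to be an isomorphism of $(B_n\times\mathbb R_+)$-$C^*$-algebras: for every even $f\in C_0(\mathbb R)$ and every $h\in C_0(B_n)$ it maps $f\,\hat\otimes\,(h\cdot1)$ to the scalar function $(x,t)\mapsto f(t)h(x)\,1$. -/

import Mathlib

open scoped ENNReal NNReal BoundedContinuousFunction ZeroAtInfty
open scoped CStarAlgebra

namespace LpBott

noncomputable section

universe u

/-! ### Graded C*-algebras -/

/-- A `ℤ/2`-grading of a C*-algebra, given by its grading automorphism: a `*`-homomorphism of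
square one.  An element `a` is even if `aut a = a` and odd if `aut a = -a`. -/
structure CStarGrading (A : Type*) [NonUnitalCStarAlgebra A] where
  aut : A →⋆ₙₐ[ℂ] A
  aut_aut : ∀ a, aut (aut a) = a

namespace CStarGrading

variable {A : Type*} [NonUnitalCStarAlgebra A]

/-- `a` is homogeneous of degree `i` (only the parity of `i` matters). -/
def IsHomogeneous (γ : CStarGrading A) (i : ℕ) (a : A) : Prop :=
  γ.aut a = (-1 : ℂ) ^ i • a

/-- The grading inherited by a closed `*`-subalgebra that is invariant under the grading. -/
def restrict (γ : CStarGrading A) (S : NonUnitalStarSubalgebra ℂ A) [IsClosed (S : Set A)]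
    (h : ∀ a ∈ S, γ.aut a ∈ S) : CStarGrading S where
  aut :=
    { toFun := fun a => ⟨γ.aut a, h a a.2⟩
      map_smul' := fun c a => Subtype.ext (map_smul γ.aut c (a : A))
      map_zero' := Subtype.ext (map_zero γ.aut)
      map_add' := fun a b => Subtype.ext (map_add γ.aut (a : A) b)
      map_mul' := fun a b => Subtype.ext (map_mul γ.aut (a : A) b)
      map_star' := fun a => Subtype.ext (map_star γ.aut (a : A)) }
  aut_aut := fun a => Subtype.ext (γ.aut_aut a)

/-- The pointwise grading on bounded continuous functions with values in a graded C*-algebra. -/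
def bcf (γ : CStarGrading A) (X : Type*) [TopologicalSpace X] : CStarGrading (X →ᵇ A) where
  aut :=
    { toFun := fun F => BoundedContinuousFunction.ofNormedAddCommGroup (fun x => γ.aut (F x))
        ((map_continuous γ.aut).comp F.continuous) ‖F‖
        (fun x => (NonUnitalStarAlgHom.norm_apply_le γ.aut (F x)).trans (F.norm_coe_le_norm x))
      map_smul' := fun c F => by ext x; exact map_smul γ.aut c (F x)
      map_zero' := by ext x; exact map_zero γ.aut
      map_add' := fun F G => by ext x; exact map_add γ.aut (F x) (G x)
      map_mul' := fun F G => by ext x; exact map_mul γ.aut (F x) (G x)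
      map_star' := fun F => by ext x; exact map_star γ.aut (F x) }
  aut_aut := fun F => by ext x; exact γ.aut_aut (F x)

/-- The pointwise grading on `C₀(X, A)` for a graded C*-algebra `A`. -/
def c0 (γ : CStarGrading A) (X : Type*) [TopologicalSpace X] : CStarGrading C₀(X, A) where
  aut :=
    { toFun := fun F =>
        { toFun := fun x => γ.aut (F x)
          continuous_toFun := (map_continuous γ.aut).comp (map_continuous F)
          zero_at_infty' := by
            have h := ((map_continuous γ.aut).tendsto 0).comp F.zero_at_infty'
            rwa [map_zero] at h }
      map_smul' := fun c F => by ext x; exact map_smul γ.aut c (F x)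
      map_zero' := by ext x; exact map_zero γ.aut
      map_add' := fun F G => by ext x; exact map_add γ.aut (F x) (G x)
      map_mul' := fun F G => by ext x; exact map_mul γ.aut (F x) (G x)
      map_star' := fun F => by ext x; exact map_star γ.aut (F x) }
  aut_aut := fun F => by ext x; exact γ.aut_aut (F x)

/-- A grading that maps a set of generators into itself preserves the generated C*-subalgebra. -/
theorem aut_mem_closure_adjoin (γ : CStarGrading A) {G : Set A} (hG : ∀ a ∈ G, γ.aut a ∈ G) :
    ∀ a ∈ (NonUnitalStarAlgebra.adjoin ℂ G).topologicalClosure,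
      γ.aut a ∈ (NonUnitalStarAlgebra.adjoin ℂ G).topologicalClosure := by
  intro a ha
  have hle : (NonUnitalStarAlgebra.adjoin ℂ G).topologicalClosure ≤
      (NonUnitalStarAlgebra.adjoin ℂ G).topologicalClosure.comap γ.aut := by
    apply NonUnitalStarSubalgebra.topologicalClosure_minimal
    · apply NonUnitalStarAlgebra.adjoin_le
      intro b hb
      exact NonUnitalStarSubalgebra.le_topologicalClosure _
        (NonUnitalStarAlgebra.subset_adjoin ℂ G (hG b hb))
    · exact (NonUnitalStarSubalgebra.isClosed_topologicalClosure _).preimage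
        (map_continuous γ.aut)
  exact hle ha

end CStarGrading

/-- The C*-algebra `𝓢 = C₀(ℝ)` is graded by even and odd functions: the grading automorphism
sends `f` to `t ↦ f (-t)`. -/
def lineGrading : CStarGrading C₀(ℝ, ℂ) where
  aut :=
    { toFun := fun f => f.comp ⟨⟨fun t : ℝ => -t, continuous_neg⟩,
        (Homeomorph.neg ℝ).isClosedEmbedding.tendsto_cocompact⟩
      map_smul' := fun _ _ => rfl
      map_zero' := rfl
      map_add' := fun _ _ => rfl
      map_mul' := fun _ _ => rfl
      map_star' := fun _ => rfl }
  aut_aut := fun f => by ext t; exact congrArg f (neg_neg t)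

/-! ### The (maximal) graded tensor product of graded C*-algebras -/

section GradedTensor

variable {A B : Type u} [NonUnitalCStarAlgebra A] [NonUnitalCStarAlgebra B]

/-- A graded-commuting pair of `*`-representations of `A` and `B` on a Hilbert space. -/
structure GradedCommPair (α : CStarGrading A) (β : CStarGrading B) : Type (u + 1) where
  H : Type u
  [instNorm : NormedAddCommGroup H]
  [instInner : InnerProductSpace ℂ H]
  [instComplete : CompleteSpace H]
  left : A →⋆ₙₐ[ℂ] (H →L[ℂ] H)
  right : B →⋆ₙₐ[ℂ] (H →L[ℂ] H)
  comm : ∀ (i j : ℕ) (a : A) (b : B), α.IsHomogeneous i a → β.IsHomogeneous j b →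
    left a * right b = (-1 : ℂ) ^ (i * j) • (right b * left a)

attribute [instance] GradedCommPair.instNorm GradedCommPair.instInner GradedCommPair.instComplete

variable (α : CStarGrading A) (β : CStarGrading B)

/-- The C*-algebra of all bounded families of operators, indexed by the graded-commuting pairs. -/
def PairAlg : Type (u + 1) :=
  lp (fun r : GradedCommPair α β => r.H →L[ℂ] r.H) ∞

instance : NonUnitalCStarAlgebra (PairAlg α β) :=
  inferInstanceAs (NonUnitalCStarAlgebra (lp (fun r : GradedCommPair α β => r.H →L[ℂ] r.H) ∞))

/-- The elementary tensor `a ⊗̂ b`, as the family of the operators `π_A(a) π_B(b)`, where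
`(π_A, π_B)` runs through all graded-commuting pairs. -/
def elemTensor (a : A) (b : B) : PairAlg α β :=
  ⟨fun r => r.left a * r.right b, memℓp_infty ⟨‖a‖ * ‖b‖, by
    rintro _ ⟨r, rfl⟩
    exact (norm_mul_le _ _).trans (mul_le_mul (NonUnitalStarAlgHom.norm_apply_le r.left a)
      (NonUnitalStarAlgHom.norm_apply_le r.right b) (norm_nonneg _) (norm_nonneg _))⟩⟩

/-- The graded tensor product `A ⊗̂ B`, as a C*-subalgebra: it is generated by the elementary
tensors.  The norm of `∑ aᵢ ⊗̂ bᵢ` is thus the supremum of `‖∑ π_A(aᵢ) π_B(bᵢ)‖` over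
all graded-commuting pairs of representations, that is, the largest C*-norm on the algebraic
graded tensor product.  (If `A` or `B` is nuclear, this is the only one.) -/
def gradedTensorSub : NonUnitalStarSubalgebra ℂ (PairAlg α β) :=
  (NonUnitalStarAlgebra.adjoin ℂ
    {x | ∃ (a : A) (b : B), x = elemTensor α β a b}).topologicalClosure

instance : IsClosed (gradedTensorSub α β : Set (PairAlg α β)) :=
  NonUnitalStarSubalgebra.isClosed_topologicalClosure _

/-- The graded tensor product `A ⊗̂ B`, as a C*-algebra. -/
def GradedTensor : Type (u + 1) := gradedTensorSub α β

instance : NonUnitalCStarAlgebra (GradedTensor α β) :=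
  inferInstanceAs (NonUnitalCStarAlgebra (gradedTensorSub α β))

/-- The elementary tensor `a ⊗̂ b` as an element of `A ⊗̂ B`. -/
def tmul (a : A) (b : B) : GradedTensor α β :=
  ⟨elemTensor α β a b, NonUnitalStarSubalgebra.le_topologicalClosure _
    (NonUnitalStarAlgebra.subset_adjoin ℂ _ ⟨a, b, rfl⟩)⟩

variable {α β} in
/-- The pair `(π_A ∘ α, π_B ∘ β)`. -/
def GradedCommPair.twist (r : GradedCommPair α β) : GradedCommPair α β where
  H := r.H
  left := r.left.comp α.aut
  right := r.right.comp β.aut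
  comm := fun i j a b ha hb => r.comm i j _ _
    (by
      change α.aut (α.aut a) = (-1 : ℂ) ^ i • α.aut a
      rw [CStarGrading.IsHomogeneous] at ha
      nth_rw 1 [ha]
      exact map_smul α.aut _ a)
    (by
      change β.aut (β.aut b) = (-1 : ℂ) ^ j • β.aut b
      rw [CStarGrading.IsHomogeneous] at hb
      nth_rw 1 [hb]
      exact map_smul β.aut _ b)

variable {α β} in
theorem GradedCommPair.twist_twist (r : GradedCommPair α β) : r.twist.twist = r := by
  have h1 : (r.left.comp α.aut).comp α.aut = r.left := by
    ext1 a; exact congrArg r.left (α.aut_aut a)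
  have h2 : (r.right.comp β.aut).comp β.aut = r.right := by
    ext1 b; exact congrArg r.right (β.aut_aut b)
  obtain ⟨H, l, rr, hc⟩ := r
  simp only [GradedCommPair.twist]
  congr

/-- The grading of the algebra of families that sends `x` to the family `r ↦ x r.twist`. -/
def pairGrading : CStarGrading (PairAlg α β) where
  aut :=
    { toFun := fun x => ⟨fun r => x.1 r.twist, memℓp_infty ⟨‖x‖, by
        rintro _ ⟨r, rfl⟩
        exact lp.norm_apply_le_norm ENNReal.top_ne_zero x r.twist⟩⟩
      map_smul' := fun _ _ => rfl
      map_zero' := rfl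
      map_add' := fun _ _ => rfl
      map_mul' := fun _ _ => rfl
      map_star' := fun _ => rfl }
  aut_aut := fun x => by
    refine Subtype.ext (funext fun r => ?_)
    have key : ∀ s : GradedCommPair α β, s = r → HEq (x.1 s) (x.1 r) := by
      rintro s rfl; rfl
    exact eq_of_heq (key r.twist.twist r.twist_twist)

theorem pairGrading_elemTensor (a : A) (b : B) :
    (pairGrading α β).aut (elemTensor α β a b) = elemTensor α β (α.aut a) (β.aut b) := rfl

/-- The grading of `A ⊗̂ B`; it sends `a ⊗̂ b` to `α(a) ⊗̂ β(b)`. -/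
def gradedTensorGrading : CStarGrading (GradedTensor α β) :=
  (pairGrading α β).restrict (gradedTensorSub α β)
    ((pairGrading α β).aut_mem_closure_adjoin (by
      rintro _ ⟨a, b, rfl⟩
      exact ⟨α.aut a, β.aut b, pairGrading_elemTensor α β a b⟩))

end GradedTensor

/-! ### The complex Clifford algebra of `ℝ^m`, acting on the antisymmetric Fock space -/

section Clifford

variable {m : ℕ}

/-- The antisymmetric Fock space `Λ*(ℂ^m)`; the basis vector with index `I = {i₁ < ⋯ < i_k}`
is `e_{i₁} ∧ ⋯ ∧ e_{i_k}`. -/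
abbrev Fock (m : ℕ) : Type := EuclideanSpace ℂ (Finset (Fin m))

/-- The matrix of `e_I ↦ e_i ∧ e_I`, which is `0` if `i ∈ I`, and otherwise `e_{I ∪ {i}}` with
the sign of the number of elements of `I` that `e_i` has to be moved past. -/
def createMatrix (i : Fin m) : Matrix (Finset (Fin m)) (Finset (Fin m)) ℂ :=
  Matrix.of fun J I => if i ∉ I ∧ J = insert i I then (-1) ^ (I.filter (· < i)).card else 0

/-- The creation operator `C(v) : w ↦ v ∧ w` of `v ∈ ℝ^m`. -/
def create (v : EuclideanSpace ℝ (Fin m)) : Fock m →L[ℂ] Fock m :=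
  ∑ i, (v i : ℂ) • Matrix.toEuclideanCLM (𝕜 := ℂ) (createMatrix i)

/-- The Clifford multiplication `v̂ = C(v) + C(v)*`. -/
def hat (v : EuclideanSpace ℝ (Fin m)) : Fock m →L[ℂ] Fock m :=
  create v + star (create v)

/-- For a linear subspace `V` of `ℝ^m`, the Clifford algebra `Cl(V)`, viewed as a subalgebra of
the operators on the Fock space of `ℝ^m`: the C*-algebra generated by `v̂` for `v ∈ V`. -/
def cliffordSub (V : Submodule ℝ (EuclideanSpace ℝ (Fin m))) :
    StarSubalgebra ℂ (Fock m →L[ℂ] Fock m) :=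
  (StarAlgebra.adjoin ℂ (hat '' (V : Set (EuclideanSpace ℝ (Fin m))))).topologicalClosure

instance (V : Submodule ℝ (EuclideanSpace ℝ (Fin m))) :
    IsClosed (cliffordSub V : Set (Fock m →L[ℂ] Fock m)) :=
  StarSubalgebra.isClosed_topologicalClosure _

theorem hat_mem {V : Submodule ℝ (EuclideanSpace ℝ (Fin m))} {v : EuclideanSpace ℝ (Fin m)}
    (hv : v ∈ V) : hat v ∈ cliffordSub V :=
  StarSubalgebra.le_topologicalClosure _ (StarAlgebra.subset_adjoin ℂ _ ⟨v, hv, rfl⟩)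

/-- The Clifford algebra `Cl(ℝ^m)`. -/
def Cl (m : ℕ) : Type := cliffordSub (⊤ : Submodule ℝ (EuclideanSpace ℝ (Fin m)))

instance (m : ℕ) : CStarAlgebra (Cl m) :=
  inferInstanceAs (CStarAlgebra (cliffordSub (⊤ : Submodule ℝ (EuclideanSpace ℝ (Fin m)))))

/-- The inclusion of `Cl(ℝ^m)` into the operators on the Fock space. -/
def Cl.op {m : ℕ} : Cl m →⋆ₐ[ℂ] (Fock m →L[ℂ] Fock m) :=
  (cliffordSub (⊤ : Submodule ℝ (EuclideanSpace ℝ (Fin m)))).subtype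

theorem Cl.ext {a b : Cl m} (h : Cl.op a = Cl.op b) : a = b := Subtype.ext h

theorem Cl.norm_eq (a : Cl m) : ‖a‖ = ‖Cl.op a‖ := rfl

/-- The inclusion `ℝ^m ⊆ Cl(ℝ^m)`. -/
def vec (v : EuclideanSpace ℝ (Fin m)) : Cl m := ⟨hat v, hat_mem trivial⟩

/-- The parity operator `e_I ↦ (-1)^{|I|} e_I` of the Fock space. -/
def parity (m : ℕ) : Fock m →L[ℂ] Fock m :=
  Matrix.toEuclideanCLM (𝕜 := ℂ) (Matrix.diagonal fun I : Finset (Fin m) => (-1) ^ I.card)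

theorem parity_mul_parity : parity m * parity m = 1 := by
  rw [parity, ← map_mul, Matrix.diagonal_mul_diagonal, ← map_one (Matrix.toEuclideanCLM (𝕜 := ℂ)),
    ← Matrix.diagonal_one]
  congr 2
  funext I
  rw [← mul_pow]
  norm_num

theorem star_parity : star (parity m) = parity m := by
  rw [parity, ← map_star, Matrix.star_eq_conjTranspose, Matrix.diagonal_conjTranspose]
  congr 2
  funext I
  simp

theorem parity_create (v : EuclideanSpace ℝ (Fin m)) :
    parity m * create v * parity m = -create v := by
  have h : ∀ i : Fin m, parity m * Matrix.toEuclideanCLM (𝕜 := ℂ) (createMatrix i) * parity m =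
      -Matrix.toEuclideanCLM (𝕜 := ℂ) (createMatrix i) := by
    intro i
    rw [parity, ← map_mul, ← map_mul, ← map_neg]
    congr 1
    ext J I
    rw [Matrix.mul_diagonal, Matrix.diagonal_mul, Matrix.neg_apply, createMatrix, Matrix.of_apply]
    split_ifs with hJ
    · obtain ⟨hi, rfl⟩ := hJ
      rw [Finset.card_insert_of_notMem hi, pow_succ]
      have h1 : ((-1 : ℂ) ^ I.card) * (-1) ^ I.card = 1 := by rw [← mul_pow]; norm_num
      linear_combination (-(-1 : ℂ) ^ (I.filter (· < i)).card) * h1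
    · simp
  simp only [create, Finset.mul_sum, Finset.sum_mul, mul_smul_comm, smul_mul_assoc, h,
    smul_neg, Finset.sum_neg_distrib]

theorem parity_hat (v : EuclideanSpace ℝ (Fin m)) :
    parity m * hat v * parity m = -hat v := by
  have h := congrArg star (parity_create v)
  have hn : star (-create v) = -star (create v) := star_neg (create v)
  rw [star_mul, star_mul, star_parity, hn, ← mul_assoc] at h
  rw [hat, mul_add, add_mul, parity_create, h, neg_add]

/-- The grading of the operators on the Fock space by even and odd operators. -/
def fockGrading (m : ℕ) : CStarGrading (Fock m →L[ℂ] Fock m) where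
  aut :=
    { toFun := fun T => parity m * T * parity m
      map_smul' := fun c T => by
        change parity m * (c • T) * parity m = c • (parity m * T * parity m)
        rw [mul_smul_comm, smul_mul_assoc]
      map_zero' := by rw [mul_zero, zero_mul]
      map_add' := fun S T => by rw [mul_add, add_mul]
      map_mul' := fun S T => by
        have h : parity m * S * parity m * (parity m * T * parity m) =
            parity m * S * (parity m * parity m) * T * parity m := by simp only [mul_assoc]
        rw [h, parity_mul_parity, mul_one, mul_assoc (parity m) S T]
      map_star' := fun T => by
        rw [star_mul, star_mul, star_parity, mul_assoc] }
  aut_aut := fun T => by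
    change parity m * (parity m * T * parity m) * parity m = T
    have h : parity m * (parity m * T * parity m) * parity m =
        parity m * parity m * T * (parity m * parity m) := by simp only [mul_assoc]
    rw [h, parity_mul_parity, one_mul, mul_one]

theorem fockGrading_mem : ∀ T ∈ cliffordSub (⊤ : Submodule ℝ (EuclideanSpace ℝ (Fin m))),
    (fockGrading m).aut T ∈ cliffordSub (⊤ : Submodule ℝ (EuclideanSpace ℝ (Fin m))) := by
  intro T hT
  have hc : Continuous ((fockGrading m).aut) := map_continuous _
  refine map_mem_closure hc hT ?_
  intro S hS
  induction hS using StarAlgebra.adjoin_induction with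
  | mem S hS =>
    obtain ⟨v, -, rfl⟩ := hS
    change parity m * hat v * parity m ∈ _
    rw [parity_hat]
    exact neg_mem (StarAlgebra.subset_adjoin ℂ _ ⟨v, trivial, rfl⟩)
  | algebraMap c =>
    have : (fockGrading m).aut (algebraMap ℂ _ c) = algebraMap ℂ _ c := by
      rw [Algebra.algebraMap_eq_smul_one, map_smul]
      congr 1
      change parity m * 1 * parity m = 1
      rw [mul_one, parity_mul_parity]
    rw [this]
    exact algebraMap_mem _ c
  | add x y _ _ hx hy => rw [map_add]; exact add_mem hx hy
  | mul x y _ _ hx hy => rw [map_mul]; exact mul_mem hx hy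
  | star x _ hx => rw [map_star]; exact star_mem hx

/-- The grading of `Cl(ℝ^m)`, which sends `v̂` to `-v̂`. -/
def cliffordGrading (m : ℕ) : CStarGrading (Cl m) where
  aut :=
    { toFun := fun a => ⟨(fockGrading m).aut (Cl.op a), fockGrading_mem _ a.2⟩
      map_smul' := fun c a => Cl.ext (map_smul (fockGrading m).aut c (Cl.op a))
      map_zero' := Cl.ext (map_zero (fockGrading m).aut)
      map_add' := fun a b => Cl.ext (map_add (fockGrading m).aut (Cl.op a) (Cl.op b))
      map_mul' := fun a b => Cl.ext (map_mul (fockGrading m).aut (Cl.op a) (Cl.op b))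
      map_star' := fun a => Cl.ext (map_star (fockGrading m).aut (Cl.op a)) }
  aut_aut := fun a => Cl.ext ((fockGrading m).aut_aut (Cl.op a))

theorem cliffordGrading_vec (v : EuclideanSpace ℝ (Fin m)) :
    (cliffordGrading m).aut (vec v) = -vec v :=
  Cl.ext (parity_hat v)

theorem cliffordGrading_one : (cliffordGrading m).aut 1 = 1 :=
  Cl.ext (by
    change parity m * 1 * parity m = 1
    rw [mul_one, parity_mul_parity])

theorem continuous_vec : Continuous (vec : EuclideanSpace ℝ (Fin m) → Cl m) := by
  refine Continuous.subtype_mk ?_ _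
  have h : Continuous (create : EuclideanSpace ℝ (Fin m) → (Fock m →L[ℂ] Fock m)) := by
    unfold create
    fun_prop
  exact h.add (ContinuousLinearMap.adjoint.continuous.comp h)

theorem exists_norm_vec_le (m : ℕ) :
    ∃ K : ℝ, 0 ≤ K ∧ ∀ v : EuclideanSpace ℝ (Fin m), ‖vec v‖ ≤ K * ‖v‖ := by
  refine ⟨2 * ∑ i : Fin m, ‖Matrix.toEuclideanCLM (𝕜 := ℂ) (createMatrix i)‖,
    by positivity, fun v => ?_⟩
  have h : ‖create v‖ ≤
      (∑ i : Fin m, ‖Matrix.toEuclideanCLM (𝕜 := ℂ) (createMatrix i)‖) * ‖v‖ := by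
    rw [Finset.sum_mul]
    refine (norm_sum_le _ _).trans (Finset.sum_le_sum fun i _ => ?_)
    rw [norm_smul, mul_comm, Complex.norm_real]
    exact mul_le_mul_of_nonneg_left (PiLp.norm_apply_le v i) (norm_nonneg _)
  calc ‖vec v‖ = ‖create v + star (create v)‖ := rfl
    _ ≤ ‖create v‖ + ‖star (create v)‖ := norm_add_le _ _
    _ = 2 * ‖create v‖ := by
        rw [show ‖star (create v)‖ = ‖create v‖ from norm_star (create v)]; ring
    _ ≤ _ := by rw [mul_assoc]; exact mul_le_mul_of_nonneg_left h (by norm_num)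

/-- The even part of a function on the line. -/
def evPart (f : C₀(ℝ, ℂ)) (t : ℝ) : ℂ := (f t + f (-t)) / 2

/-- The odd part of a function on the line. -/
def oddPart (f : C₀(ℝ, ℂ)) (t : ℝ) : ℂ := (f t - f (-t)) / 2

/-- The functional calculus `f(v) = f_ev(‖v‖) 1 + f_odd(‖v‖) v / ‖v‖ ∈ Cl(ℝ^m)`, in which the
second summand vanishes for `v = 0`. -/
def funcCalc (f : C₀(ℝ, ℂ)) (v : EuclideanSpace ℝ (Fin m)) : Cl m :=
  evPart f ‖v‖ • (1 : Cl m) +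
    if v = 0 then 0 else oddPart f ‖v‖ • ((‖v‖⁻¹ : ℝ) : ℂ) • vec v

theorem norm_oddPart_le (f : C₀(ℝ, ℂ)) (t : ℝ) : ‖oddPart f t‖ ≤ ‖f‖ := by
  have h : ∀ s, ‖f s‖ ≤ ‖f‖ := fun s => f.toBCF.norm_coe_le_norm s
  rw [oddPart, norm_div, Complex.norm_ofNat]
  have := norm_sub_le (f t) (f (-t))
  linarith [h t, h (-t)]

theorem norm_evPart_le (f : C₀(ℝ, ℂ)) (t : ℝ) : ‖evPart f t‖ ≤ ‖f‖ := by
  have h : ∀ s, ‖f s‖ ≤ ‖f‖ := fun s => f.toBCF.norm_coe_le_norm s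
  rw [evPart, norm_div, Complex.norm_ofNat]
  have := norm_add_le (f t) (f (-t))
  linarith [h t, h (-t)]

theorem continuous_oddPart (f : C₀(ℝ, ℂ)) : Continuous (oddPart f) := by
  have hf : Continuous f := map_continuous f
  unfold oddPart
  fun_prop

theorem continuous_evPart (f : C₀(ℝ, ℂ)) : Continuous (evPart f) := by
  have hf : Continuous f := map_continuous f
  unfold evPart
  fun_prop

theorem norm_oddTerm_le {K : ℝ} (hK : ∀ v : EuclideanSpace ℝ (Fin m), ‖vec v‖ ≤ K * ‖v‖)
    (hK0 : 0 ≤ K) (f : C₀(ℝ, ℂ)) (v : EuclideanSpace ℝ (Fin m)) :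
    ‖(if v = 0 then 0 else oddPart f ‖v‖ • ((‖v‖⁻¹ : ℝ) : ℂ) • vec v : Cl m)‖ ≤
      ‖oddPart f ‖v‖‖ * K := by
  split_ifs with hv
  · rw [norm_zero]; positivity
  · have hv' : ‖v‖ ≠ 0 := norm_ne_zero_iff.mpr hv
    rw [norm_smul, norm_smul, Complex.norm_real, norm_inv, norm_norm]
    refine mul_le_mul_of_nonneg_left ?_ (norm_nonneg _)
    calc ‖v‖⁻¹ * ‖vec v‖ ≤ ‖v‖⁻¹ * (K * ‖v‖) :=
          mul_le_mul_of_nonneg_left (hK v) (by positivity)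
      _ = K := by field_simp

theorem continuous_funcCalc (f : C₀(ℝ, ℂ)) :
    Continuous (funcCalc f : EuclideanSpace ℝ (Fin m) → Cl m) := by
  obtain ⟨K, hK0, hK⟩ := exists_norm_vec_le m
  refine Continuous.add (((continuous_evPart f).comp continuous_norm).smul continuous_const) ?_
  rw [continuous_iff_continuousAt]
  intro v
  by_cases hv : v = 0
  · subst hv
    rw [ContinuousAt, if_pos rfl]
    refine squeeze_zero_norm (norm_oddTerm_le hK hK0 f) ?_
    have hc : Continuous fun v : EuclideanSpace ℝ (Fin m) => ‖oddPart f ‖v‖‖ * K :=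
      (((continuous_oddPart f).comp continuous_norm).norm).mul continuous_const
    have := hc.tendsto 0
    simpa [oddPart] using this
  · have hev : (fun w : EuclideanSpace ℝ (Fin m) =>
        oddPart f ‖w‖ • ((‖w‖⁻¹ : ℝ) : ℂ) • vec w) =ᶠ[nhds v]
        fun w => if w = 0 then 0 else oddPart f ‖w‖ • ((‖w‖⁻¹ : ℝ) : ℂ) • vec w := by
      filter_upwards [isOpen_ne.mem_nhds hv] with w hw
      rw [if_neg hw]
    refine ContinuousAt.congr ?_ hev
    have h1 : ContinuousAt (fun w : EuclideanSpace ℝ (Fin m) => ((‖w‖⁻¹ : ℝ) : ℂ)) v :=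
      Complex.continuous_ofReal.continuousAt.comp
        (continuous_norm.continuousAt.inv₀ (norm_ne_zero_iff.mpr hv))
    exact ((continuous_oddPart f).comp continuous_norm).continuousAt.smul
      (h1.smul continuous_vec.continuousAt)

theorem exists_norm_funcCalc_le (f : C₀(ℝ, ℂ)) :
    ∃ M : ℝ, ∀ v : EuclideanSpace ℝ (Fin m), ‖funcCalc f v‖ ≤ M := by
  obtain ⟨K, hK0, hK⟩ := exists_norm_vec_le m
  refine ⟨‖f‖ * ‖(1 : Cl m)‖ + ‖f‖ * K, fun v => (norm_add_le _ _).trans (add_le_add ?_ ?_)⟩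
  · rw [norm_smul]
    exact mul_le_mul_of_nonneg_right (norm_evPart_le f _) (norm_nonneg _)
  · exact (norm_oddTerm_le hK hK0 f v).trans
      (mul_le_mul_of_nonneg_right (norm_oddPart_le f _) hK0)

theorem cliffordGrading_funcCalc (f : C₀(ℝ, ℂ)) (v : EuclideanSpace ℝ (Fin m)) :
    (cliffordGrading m).aut (funcCalc f v) = funcCalc (lineGrading.aut f) v := by
  have he : evPart (lineGrading.aut f) ‖v‖ = evPart f ‖v‖ := by
    change (f (-‖v‖) + f (- -‖v‖)) / 2 = (f ‖v‖ + f (-‖v‖)) / 2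
    rw [neg_neg, add_comm]
  have ho : oddPart (lineGrading.aut f) ‖v‖ = -oddPart f ‖v‖ := by
    change (f (-‖v‖) - f (- -‖v‖)) / 2 = -((f ‖v‖ - f (-‖v‖)) / 2)
    rw [neg_neg]; ring
  rw [funcCalc, funcCalc, map_add, map_smul, cliffordGrading_one, he, ho]
  congr 1
  split_ifs with hv
  · exact map_zero _
  · rw [map_smul, map_smul, cliffordGrading_vec, smul_neg, smul_neg, neg_smul]

end Clifford

/-! ### The extended Mazur map and the algebras of a finite-dimensional `ℓ^p`-space -/

/-- `B_n = ℓ^p({0, …, n}, ℝ)`. -/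
abbrev Bn (p : ℝ≥0∞) (n : ℕ) : Type := PiLp p fun _ : Fin (n + 1) => ℝ

/-- `H_n = ℓ²({0, …, n}, ℝ)`. -/
abbrev Hn (n : ℕ) : Type := EuclideanSpace ℝ (Fin (n + 1))

variable (p : ℝ≥0∞) [Fact (1 ≤ p)] {n : ℕ}

/-- The Mazur map `(aᵢ) ↦ (sgn(aᵢ) |aᵢ|^{p/2})`, to be used on the unit sphere. -/
def mazur (a : Bn p n) : Hn n :=
  WithLp.toLp 2 fun i => Real.sign (a i) * |a i| ^ (p.toReal / 2)

open Classical in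
/-- The `p/2`-Hölder extension `φ_n : B_n → H_n` of the Mazur map. -/
def mazurExt (x : Bn p n) : Hn n :=
  if x = 0 then 0 else ‖x‖ ^ (p.toReal / 2) • mazur p (‖x‖⁻¹ • x)

theorem mazurExt_apply (x : Bn p n) (i : Fin (n + 1)) :
    mazurExt p x i = Real.sign (x i) * |x i| ^ (p.toReal / 2) := by
  rw [mazurExt]
  split_ifs with hx
  · simp [hx]
  · have hpos : 0 < ‖x‖ := norm_pos_iff.mpr hx
    have hs : Real.sign (‖x‖⁻¹ * x i) = Real.sign (x i) := by
      rcases lt_trichotomy (x i) 0 with h | h | h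
      · rw [Real.sign_of_neg h, Real.sign_of_neg (mul_neg_of_pos_of_neg (inv_pos.mpr hpos) h)]
      · rw [h, mul_zero]
      · rw [Real.sign_of_pos h, Real.sign_of_pos (mul_pos (inv_pos.mpr hpos) h)]
    have ha : ‖x‖ ^ (p.toReal / 2) * |‖x‖⁻¹ * x i| ^ (p.toReal / 2) =
        |x i| ^ (p.toReal / 2) := by
      rw [← Real.mul_rpow hpos.le (abs_nonneg _), abs_mul, abs_of_pos (inv_pos.mpr hpos),
        mul_inv_cancel_left₀ hpos.ne']
    change ‖x‖ ^ (p.toReal / 2) * (Real.sign (‖x‖⁻¹ * x i) * |‖x‖⁻¹ * x i| ^ (p.toReal / 2)) = _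
    rw [hs, mul_left_comm, ha]

theorem continuous_signedPow {q : ℝ} (hq : 0 < q) :
    Continuous fun t : ℝ => Real.sign t * |t| ^ q := by
  have hc : Continuous fun t : ℝ => |t| ^ q :=
    continuous_abs.rpow_const fun _ => Or.inr hq.le
  rw [continuous_iff_continuousAt]
  intro t
  rcases lt_trichotomy t 0 with h | rfl | h
  · refine ContinuousAt.congr (f := fun t : ℝ => -|t| ^ q) hc.neg.continuousAt ?_
    filter_upwards [isOpen_Iio.mem_nhds h] with s hs
    rw [Real.sign_of_neg hs, neg_one_mul]
  · have h0 : Filter.Tendsto (fun t : ℝ => |t| ^ q) (nhds 0) (nhds 0) := by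
      have := hc.tendsto 0
      simpa [Real.zero_rpow hq.ne'] using this
    rw [ContinuousAt, Real.sign_zero, zero_mul]
    refine squeeze_zero_norm (fun s => ?_) h0
    rw [norm_mul, Real.norm_of_nonneg (Real.rpow_nonneg (abs_nonneg s) q)]
    refine mul_le_of_le_one_left (Real.rpow_nonneg (abs_nonneg s) q) ?_
    rcases Real.sign_apply_eq s with h | h | h <;> rw [h] <;> norm_num
  · refine ContinuousAt.congr (f := fun t : ℝ => |t| ^ q) hc.continuousAt ?_
    filter_upwards [isOpen_Ioi.mem_nhds h] with s hs
    rw [Real.sign_of_pos hs, one_mul]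

theorem continuous_mazurExt (hp : p ≠ ∞) : Continuous (mazurExt p : Bn p n → Hn n) := by
  have hq : 0 < p.toReal / 2 :=
    half_pos (ENNReal.toReal_pos (zero_lt_one.trans_le Fact.out).ne' hp)
  refine (PiLp.continuous_toLp 2 _).comp (g := WithLp.toLp 2)
    (f := fun x : Bn p n => WithLp.ofLp (mazurExt p x)) (continuous_pi fun i => ?_)
  have : (fun x : Bn p n => mazurExt p x i) =
      fun x : Bn p n => Real.sign (x i) * |x i| ^ (p.toReal / 2) :=
    funext fun x => mazurExt_apply p x i
  rw [this]
  exact (continuous_signedPow hq).comp (by fun_prop)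

/-- The element `(v, t)` of `H_n ⊕ ℝ = ℝ^{n+2}`; the last coordinate is the one of `ℝ`. -/
def pairVec (v : Hn n) (t : ℝ) : EuclideanSpace ℝ (Fin (n + 2)) :=
  WithLp.toLp 2 (Fin.snoc (α := fun _ => ℝ) v t)

/-- The subspace `H_n ⊕ 0` of `H_n ⊕ ℝ = ℝ^{n+2}`. -/
def HnSub (n : ℕ) : Submodule ℝ (EuclideanSpace ℝ (Fin (n + 2))) where
  carrier := {w | w (Fin.last (n + 1)) = 0}
  add_mem' := fun {v w} hv hw => by
    change v _ + w _ = 0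
    rw [hv, hw, add_zero]
  zero_mem' := rfl
  smul_mem' := fun c w hw => by
    change c * w _ = 0
    rw [hw, mul_zero]

/-- `C_{b,0}(B_n × ℝ₊, Cl(H_n ⊕ ℝ))`: the bounded continuous functions `F` with
`F(x, 0) ∈ Cl(H_n) ⊆ Cl(H_n ⊕ ℝ)` for all `x`. -/
def Cb0 (n : ℕ) : NonUnitalStarSubalgebra ℂ ((Bn p n × ℝ≥0) →ᵇ Cl (n + 2)) where
  carrier := {F | ∀ x, Cl.op (F (x, 0)) ∈ cliffordSub (HnSub n)}
  add_mem' := fun hF hG x => add_mem (hF x) (hG x)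
  zero_mem' := fun _ => zero_mem _
  mul_mem' := fun hF hG x => mul_mem (hF x) (hG x)
  smul_mem' := fun c _ hF x => SMulMemClass.smul_mem c (hF x)
  star_mem' := fun hF x => star_mem (hF x)

/-- The Clifford operator `C_{x₀}(x, t) = (φ_n(x - x₀), t)`, before the inclusion of `H_n ⊕ ℝ`
into `Cl(H_n ⊕ ℝ)`. -/
def cliffordOp (x₀ : Bn p n) (z : Bn p n × ℝ≥0) : EuclideanSpace ℝ (Fin (n + 2)) :=
  pairVec (mazurExt p (z.1 - x₀)) z.2

theorem continuous_cliffordOp (hp : p ≠ ∞) (x₀ : Bn p n) : Continuous (cliffordOp p x₀) := by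
  refine (PiLp.continuous_toLp 2 _).comp (continuous_pi fun i => ?_)
  refine Fin.lastCases ?_ (fun j => ?_) i
  · simp only [Fin.snoc_last]
    fun_prop
  · simp only [Fin.snoc_castSucc]
    have h : Continuous fun z : Bn p n × ℝ≥0 => mazurExt p (z.1 - x₀) :=
      (continuous_mazurExt p hp).comp (continuous_fst.sub continuous_const)
    fun_prop

/-- The Bott map `β_{x₀}(f)(x, t) = f(C_{x₀}(x, t))`. -/
def bott (hp : p ≠ ∞) (x₀ : Bn p n) (f : C₀(ℝ, ℂ)) : (Bn p n × ℝ≥0) →ᵇ Cl (n + 2) :=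
  BoundedContinuousFunction.ofNormedAddCommGroup (fun z => funcCalc f (cliffordOp p x₀ z))
    ((continuous_funcCalc f).comp (continuous_cliffordOp p hp x₀))
    (exists_norm_funcCalc_le f).choose
    (fun z => (exists_norm_funcCalc_le f).choose_spec (cliffordOp p x₀ z))

theorem bott_mem_Cb0 (hp : p ≠ ∞) (x₀ : Bn p n) (f : C₀(ℝ, ℂ)) :
    bott p hp x₀ f ∈ Cb0 p n := by
  intro x
  have hv : cliffordOp p x₀ (x, 0) ∈ HnSub n := by
    change Fin.snoc (α := fun _ => ℝ) _ _ (Fin.last (n + 1)) = 0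
    rw [Fin.snoc_last]
    rfl
  change Cl.op (funcCalc f (cliffordOp p x₀ (x, 0))) ∈ cliffordSub (HnSub n)
  rw [funcCalc]
  refine add_mem (SMulMemClass.smul_mem _ (one_mem _)) ?_
  split_ifs
  · exact zero_mem _
  · exact SMulMemClass.smul_mem _ (SMulMemClass.smul_mem _ (hat_mem hv))

/-- The algebra `𝒜(B_n)`, as a C*-subalgebra: the one generated by all `β_x(f)`, with `x ∈ B_n` and
`f ∈ C₀(ℝ)`. -/
def algASub (hp : p ≠ ∞) (n : ℕ) : NonUnitalStarSubalgebra ℂ ((Bn p n × ℝ≥0) →ᵇ Cl (n + 2)) :=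
  (NonUnitalStarAlgebra.adjoin ℂ
    {F | ∃ (x : Bn p n) (f : C₀(ℝ, ℂ)), F = bott p hp x f}).topologicalClosure

instance (hp : p ≠ ∞) (n : ℕ) :
    IsClosed (algASub p hp n : Set ((Bn p n × ℝ≥0) →ᵇ Cl (n + 2))) :=
  NonUnitalStarSubalgebra.isClosed_topologicalClosure _

/-- The algebra `𝒜(B_n)`, as a C*-algebra. -/
def AlgA (hp : p ≠ ∞) (n : ℕ) : Type := algASub p hp n

instance (hp : p ≠ ∞) (n : ℕ) : NonUnitalCStarAlgebra (AlgA p hp n) :=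
  inferInstanceAs (NonUnitalCStarAlgebra (algASub p hp n))

/-- The value of an element of `𝒜(B_n)` at a point of `B_n × ℝ₊`. -/
def AlgA.eval {p : ℝ≥0∞} [Fact (1 ≤ p)] {hp : p ≠ ∞} {n : ℕ} (F : AlgA p hp n)
    (z : Bn p n × ℝ≥0) : Cl (n + 2) :=
  (F.1 : (Bn p n × ℝ≥0) →ᵇ Cl (n + 2)) z

theorem algASub_le_Cb0 (hp : p ≠ ∞) (n : ℕ) : algASub p hp n ≤ Cb0 p n := by
  refine NonUnitalStarSubalgebra.topologicalClosure_minimal _ (NonUnitalStarAlgebra.adjoin_le ?_) ?_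
  · rintro _ ⟨x, f, rfl⟩
    exact bott_mem_Cb0 p hp x f
  · have : ((Cb0 p n : NonUnitalStarSubalgebra ℂ ((Bn p n × ℝ≥0) →ᵇ Cl (n + 2))) :
        Set ((Bn p n × ℝ≥0) →ᵇ Cl (n + 2))) =
        ⋂ x, (fun F : (Bn p n × ℝ≥0) →ᵇ Cl (n + 2) =>
          Cl.op (F (x, 0))) ⁻¹' (cliffordSub (HnSub n)) := by
      ext F
      rw [Set.mem_iInter]
      rfl
    rw [this]
    refine isClosed_iInter fun x =>
      (StarSubalgebra.isClosed_topologicalClosure _).preimage ?_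
    exact (map_continuous Cl.op).comp 
      (continuous_eval_const (F := (Bn p n × ℝ≥0) →ᵇ Cl (n + 2)) (x, (0 : ℝ≥0)))

/-- The grading of `𝒜(B_n)`, induced pointwise by the one of `Cl(H_n ⊕ ℝ)`. -/
def algAGrading (hp : p ≠ ∞) (n : ℕ) : CStarGrading (AlgA p hp n) :=
  ((cliffordGrading (n + 2)).bcf (Bn p n × ℝ≥0)).restrict (algASub p hp n)
    (((cliffordGrading (n + 2)).bcf (Bn p n × ℝ≥0)).aut_mem_closure_adjoin (by
      rintro _ ⟨x, f, rfl⟩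
      refine ⟨x, lineGrading.aut f, ?_⟩
      ext1 z
      exact cliffordGrading_funcCalc f _))

/-- The grading of `𝒞(B_n) = C₀(B_n, Cl(H_n))`. -/
def algCGrading (n : ℕ) : CStarGrading C₀(Bn p n, Cl (n + 1)) :=
  (cliffordGrading (n + 1)).c0 (Bn p n)

/-- The graded tensor product `𝓢𝒞(B_n) = 𝓢 ⊗̂ 𝒞(B_n) = C₀(ℝ) ⊗̂ C₀(B_n, Cl(H_n))`. -/
abbrev AlgSC (n : ℕ) : Type 1 :=
  GradedTensor lineGrading (algCGrading p n)

/-- The grading of `𝓢𝒞(B_n)`. -/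
abbrev algSCGrading (n : ℕ) : CStarGrading (AlgSC p n) :=
  gradedTensorGrading lineGrading (algCGrading p n)

end

end LpBott

/-! Both algebras are evaluated at the points `(x, t)` of `B_n × ℝ₊`. Such a point gives a
graded-commuting pair of representations on the Fock space of `H_n ⊕ ℝ`: a function `f` on the line
acts as `f_ev(t) + f_odd(t) e`, where `e` is the last basis vector, and `C₀(B_n, Cl(H_n))` acts
through its value at `x` (`pointPair`). So `𝓢𝒞(B_n)` maps to the bounded families of operators
indexed by `B_n × ℝ₊` (`familySC`), and `𝒜(B_n)` sits in the same algebra (`familyA`). If both maps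
are injective and have the same range, comparing them gives `Φ`, and the grading and the scalar
formula are read off point by point.

Injectivity on the tensor product means that the point pairs control all graded-commuting pairs
(`exists_norm_le_restrictPoints`). A bound up to a constant is enough, because only the kernel
matters. Expand `Cl(H_n)` in a basis of unitaries. The norm of `∑ ρ(aᵢ) σ(bᵢ u)`, with scalar
functions `bᵢ`, is the same for every unitary `u`, which reduces everything to commuting
representations of two commutative algebras; Gelfand theory bounds these by the supremum norm on `ℝ
× B_n` (`norm_sum_mul_le`). That supremum is recovered from the points with `t ≥ 0` by splitting
into even and odd parts.

For the ranges, `exp(-t²)` and `t exp(-t²)` generate `C₀(ℝ)`, and their Bott images factor into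
Gaussians in `x` and in `t`, so they are finite sums of elementary tensors. Conversely, `𝒜(B_n)`
contains the scalar functions by Stone-Weierstrass (`scalar_mem`). Moving the centre from `0` to the
`i`-th unit vector changes only the `i`-th coordinate of the Mazur map, so a combination of Bott
elements isolates the `i`-th basis vector with a nowhere vanishing coefficient (`basisVec_mem`).
This gives all coefficients times `Cl(H_n)` (`clIncl_mem`). What remains of a Bott element is a
Gaussian times `t e`, and it yields the multiples of `e` whose coefficient vanishes at `t = 0`
(`lastVec_mul_mem`). Odd functions vanish at `0`, so nothing more is needed for the elementary
tensors. -/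

namespace LpBott

noncomputable section

universe u

set_option linter.unusedSectionVars false

/-! ### Stone-Weierstrass, ideals and characters for `C₀(X)`. -/

section ZeroAtInfinity

open Filter Topology

variable {X : Type*} [TopologicalSpace X]

/-- A function vanishing at infinity is uniformly small off a compact set. -/
theorem isCompact_le_norm [T2Space X] (f : C₀(X, ℂ)) {δ : ℝ} (hδ : 0 < δ) :
    IsCompact {x | δ ≤ ‖f x‖} := by
  have h1 : ∀ᶠ x in cocompact X, ‖f x‖ < δ := by
    have := f.zero_at_infty'.norm
    rw [norm_zero] at this
    exact this.eventually_lt_const hδ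
  obtain ⟨K, hK, hKs⟩ := mem_cocompact.mp h1
  refine hK.of_isClosed_subset (isClosed_le continuous_const (map_continuous f).norm) ?_
  intro x hx
  by_contra hxK
  have h2 : ‖f x‖ < δ := hKs hxK
  exact absurd hx (not_le.mpr h2)

/-- The extension by zero of a function vanishing at infinity to the one-point
compactification. -/
def onePointExtend [T2Space X] (f : C₀(X, ℂ)) : C(OnePoint X, ℂ) :=
  OnePoint.continuousMapMk f.toContinuousMap 0 (by
    rw [coclosedCompact_eq_cocompact]
    exact f.zero_at_infty')

theorem norm_le_norm_of_forall {f : C₀(X, ℂ)} {M : ℝ} (hM : 0 ≤ M) (h : ∀ x, ‖f x‖ ≤ M) :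
    ‖f‖ ≤ M :=
  (BoundedContinuousFunction.norm_le (f := f.toBCF) hM).mpr h

theorem norm_apply_le_norm (f : C₀(X, ℂ)) (x : X) : ‖f x‖ ≤ ‖f‖ :=
  f.toBCF.norm_coe_le_norm x

/-- Stone-Weierstrass for functions vanishing at infinity. -/
theorem mem_of_separatesPoints [T2Space X] [LocallyCompactSpace X]
    (A : NonUnitalStarSubalgebra ℂ C₀(X, ℂ)) (hA : IsClosed (A : Set C₀(X, ℂ)))
    (h0 : ∀ x, ∃ f ∈ A, f x ≠ 0) (hs : ∀ x y, x ≠ y → ∃ f ∈ A, f x ≠ f y) (f : C₀(X, ℂ)) :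
    f ∈ A := by
  -- Adding the constants to `A` on the one-point compactification makes the compact, unital theorem
  -- applicable.
  let B : StarSubalgebra ℂ C(OnePoint X, ℂ) :=
    { carrier := {g | ∃ a ∈ A, ∃ c : ℂ, ∀ z, g z = onePointExtend a z + c}
      mul_mem' := by
        rintro g g' ⟨a, ha, c, hg⟩ ⟨a', ha', c', hg'⟩
        refine ⟨a * a' + c' • a + c • a', add_mem (add_mem (mul_mem ha ha')
          (SMulMemClass.smul_mem _ ha)) (SMulMemClass.smul_mem _ ha'), c * c', fun z => ?_⟩
        rw [ContinuousMap.mul_apply, hg, hg']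
        induction z using OnePoint.rec with
        | infty => change (0 + c) * (0 + c') = 0 + c * c'; ring
        | coe x =>
          change (a x + c) * (a' x + c') = a x * a' x + c' * a x + c * a' x + c * c'
          ring
      add_mem' := by
        rintro g g' ⟨a, ha, c, hg⟩ ⟨a', ha', c', hg'⟩
        refine ⟨a + a', add_mem ha ha', c + c', fun z => ?_⟩
        rw [ContinuousMap.add_apply, hg, hg']
        induction z using OnePoint.rec with
        | infty => change (0 + c) + (0 + c') = 0 + (c + c'); ring
        | coe x =>
          change (a x + c) + (a' x + c') = a x + a' x + (c + c')
          ring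
      algebraMap_mem' := by
        intro c
        refine ⟨0, zero_mem _, c, fun z => ?_⟩
        induction z using OnePoint.rec with
        | infty => change c = 0 + c; ring
        | coe x => change c = 0 + c; ring
      star_mem' := by
        rintro g ⟨a, ha, c, hg⟩
        refine ⟨star a, star_mem ha, star c, fun z => ?_⟩
        rw [ContinuousMap.star_apply, hg]
        induction z using OnePoint.rec with
        | infty => change star (0 + c) = 0 + star c; simp
        | coe x => change star (a x + c) = star (a x) + star c; simp }
  have hBa : ∀ a ∈ A, onePointExtend a ∈ B := fun a ha => ⟨a, ha, 0, fun z => (add_zero _).symm⟩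
  have hsep : B.SeparatesPoints := by
    intro z w hzw
    induction z using OnePoint.rec with
    | infty =>
      induction w using OnePoint.rec with
      | infty => exact absurd rfl hzw
      | coe y =>
        obtain ⟨a, ha, hay⟩ := h0 y
        exact ⟨_, ⟨_, hBa a ha, rfl⟩, fun h => hay (h.symm.trans rfl)⟩
    | coe x =>
      induction w using OnePoint.rec with
      | infty =>
        obtain ⟨a, ha, hay⟩ := h0 x
        exact ⟨_, ⟨_, hBa a ha, rfl⟩, fun h => hay (h.trans rfl)⟩
      | coe y =>
        obtain ⟨a, ha, hay⟩ := hs x y (fun h => hzw (congrArg _ h))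
        exact ⟨_, ⟨_, hBa a ha, rfl⟩, fun h => hay h⟩
  have htop := ContinuousMap.starSubalgebra_topologicalClosure_eq_top_of_separatesPoints B hsep
  have hf : onePointExtend f ∈ closure (B : Set C(OnePoint X, ℂ)) := by
    rw [← StarSubalgebra.topologicalClosure_coe, htop]
    exact Set.mem_univ _
  rw [← SetLike.mem_coe, ← hA.closure_eq, Metric.mem_closure_iff]
  intro ε hε
  obtain ⟨g, ⟨a, ha, c, hg⟩, hfg⟩ := Metric.mem_closure_iff.mp hf (ε / 3) (by positivity)
  refine ⟨a, ha, ?_⟩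
  have hpt : ∀ z, ‖onePointExtend f z - (onePointExtend a z + c)‖ ≤ ε / 3 := fun z => by
    rw [← hg, ← dist_eq_norm]
    exact (ContinuousMap.dist_apply_le_dist z).trans hfg.le
  -- The approximant is `a + c` with `a` in `A`. At infinity both `f` and `a` vanish, so `c` is
  -- small and can be dropped.
  have hc : ‖c‖ ≤ ε / 3 := by
    have := hpt OnePoint.infty
    change ‖(0 : ℂ) - (0 + c)‖ ≤ _ at this
    simpa using this
  rw [dist_eq_norm]
  refine (norm_le_norm_of_forall (M := 2 * (ε / 3)) (by positivity) fun x => ?_).trans_lt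
    (by linarith)
  have h1 : ‖f x - (a x + c)‖ ≤ ε / 3 := hpt x
  calc ‖f x - a x‖ = ‖(f x - (a x + c)) + c‖ := by congr 1; ring
    _ ≤ _ := (norm_add_le _ _).trans (by linarith)

/-- A function vanishing at infinity that vanishes wherever `g` does lies in each closed set that
contains all multiples of `g`. -/
theorem mem_of_forall_mul_mem [T2Space X] (I : Set C₀(X, ℂ)) (hI : IsClosed I) (g : C₀(X, ℂ))
    (hg : ∀ k : C₀(X, ℂ), k * g ∈ I) (f : C₀(X, ℂ)) (hf : ∀ x, g x = 0 → f x = 0) : f ∈ I := by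
  rw [← hI.closure_eq, Metric.mem_closure_iff]
  intro δ hδ
  have hK := isCompact_le_norm f (half_pos hδ)
  obtain ⟨η, hη, hgK⟩ : ∃ η : ℝ, 0 < η ∧ ∀ x ∈ {x | δ / 2 ≤ ‖f x‖}, η ≤ ‖g x‖ ^ 2 := by
    rcases Set.eq_empty_or_nonempty {x | δ / 2 ≤ ‖f x‖} with h | h
    · exact ⟨1, one_pos, by simp [h]⟩
    · obtain ⟨x, hx, hmin⟩ := hK.exists_isMinOn h
        (f := fun x => ‖g x‖ ^ 2) (((map_continuous g).norm.pow 2).continuousOn)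
      refine ⟨‖g x‖ ^ 2, ?_, fun y hy => hmin hy⟩
      have : g x ≠ 0 := fun h => by
        have hx' : δ / 2 ≤ ‖f x‖ := hx
        rw [hf x h, norm_zero] at hx'
        linarith
      positivity
  -- With this `ε` the error `ε |f| / (|g|² + ε)` is at most `δ / 2` where `|g|² ≥ η`. Elsewhere
  -- `|f| < δ / 2` suffices.
  set ε : ℝ := η * (δ / 2) / (‖f‖ + 1) with hε
  have hεpos : 0 < ε := by positivity
  have hpos : ∀ x, 0 < ‖g x‖ ^ 2 + ε := fun x => by positivity
  have hcont : Continuous fun x => ((‖g x‖ ^ 2 + ε)⁻¹ : ℝ) :=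
    (((map_continuous g).norm.pow 2).add continuous_const).inv₀ fun x => (hpos x).ne'
  -- A regularisation of `f / g`: the product `k g` equals `f |g|² / (|g|² + ε)`.
  let k : C₀(X, ℂ) :=
    { toFun := fun x => (((‖g x‖ ^ 2 + ε)⁻¹ : ℝ) : ℂ) * star (g x) * f x
      continuous_toFun := ((Complex.continuous_ofReal.comp hcont).mul
        (map_continuous g).star).mul (map_continuous f)
      zero_at_infty' := by
        have h2 : Tendsto (fun x => ε⁻¹ * ‖g‖ * ‖f x‖) (cocompact X) (𝓝 0) := by
          simpa using f.zero_at_infty'.norm.const_mul (ε⁻¹ * ‖g‖)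
        refine squeeze_zero_norm (fun x => ?_) h2
        rw [norm_mul, norm_mul, Complex.norm_real, norm_star, Real.norm_of_nonneg
          (inv_nonneg.mpr (hpos x).le)]
        have h3 : (‖g x‖ ^ 2 + ε)⁻¹ ≤ ε⁻¹ :=
          inv_anti₀ hεpos (by linarith [sq_nonneg ‖g x‖])
        have h4 := norm_apply_le_norm g x
        gcongr }
  refine ⟨k * g, hg k, ?_⟩
  rw [dist_eq_norm]
  refine (norm_le_norm_of_forall (M := δ / 2) (by positivity) fun x => ?_).trans_lt (by linarith)
  have hx : (f - k * g) x = ((ε * (‖g x‖ ^ 2 + ε)⁻¹ : ℝ) : ℂ) * f x := by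
    change f x - (((‖g x‖ ^ 2 + ε)⁻¹ : ℝ) : ℂ) * star (g x) * f x * g x = _
    have h5 : star (g x) * g x = ((‖g x‖ ^ 2 : ℝ) : ℂ) := by
      rw [Complex.star_def, Complex.conj_mul']; push_cast; rfl
    have h6 : (((‖g x‖ ^ 2 + ε : ℝ) : ℂ)) ≠ 0 := Complex.ofReal_ne_zero.mpr (hpos x).ne'
    have h7 : (((‖g x‖ ^ 2 + ε)⁻¹ : ℝ) : ℂ) * star (g x) * f x * g x =
        (((‖g x‖ ^ 2 + ε)⁻¹ : ℝ) : ℂ) * (star (g x) * g x) * f x := by ring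
    rw [h7, h5]
    push_cast at h6 ⊢
    field_simp
    ring
  rw [hx, norm_mul, Complex.norm_real, Real.norm_of_nonneg
    (mul_nonneg hεpos.le (inv_nonneg.mpr (hpos x).le))]
  by_cases hxK : δ / 2 ≤ ‖f x‖
  · have h8 : (‖g x‖ ^ 2 + ε)⁻¹ ≤ η⁻¹ := inv_anti₀ hη (by linarith [hgK x hxK])
    calc ε * (‖g x‖ ^ 2 + ε)⁻¹ * ‖f x‖ ≤ ε * η⁻¹ * (‖f‖ + 1) := by
          have := norm_apply_le_norm f x
          have h9 := (hpos x).le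
          gcongr
          linarith
      _ = δ / 2 := by rw [hε]; field_simp
  · have h8 : ε * (‖g x‖ ^ 2 + ε)⁻¹ ≤ 1 := by
      rw [← div_eq_mul_inv, div_le_one (hpos x)]
      linarith [sq_nonneg ‖g x‖]
    calc _ ≤ 1 * ‖f x‖ := mul_le_mul_of_nonneg_right h8 (norm_nonneg _)
      _ ≤ δ / 2 := by linarith [not_le.mp hxK]

/-- For each point there is a function vanishing at infinity that does not vanish there, and that
vanishes at a prescribed other point. -/
theorem exists_separating [T2Space X] [LocallyCompactSpace X] {x y : X} (h : x ≠ y) :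
    ∃ f : C₀(X, ℂ), f x = 1 ∧ f y = 0 := by
  obtain ⟨f, hf1, hf0, hfc, -⟩ := exists_continuous_one_zero_of_isCompact
    (isCompact_singleton (x := x)) (isClosed_singleton (x := y)) (by simpa using h)
  refine ⟨⟨⟨fun z => (f z : ℂ), by fun_prop⟩, ?_⟩, ?_, ?_⟩
  · have : HasCompactSupport fun z => (f z : ℂ) := hfc.comp_left (g := fun r : ℝ => (r : ℂ)) rfl
    exact this.is_zero_at_infty
  · change ((f x : ℝ) : ℂ) = 1
    rw [hf1 rfl]; simp
  · change ((f y : ℝ) : ℂ) = 0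
    rw [hf0 rfl]; simp

/-- The characters of `C₀(X)` are the evaluations. -/
theorem eq_zero_or_eq_eval [T2Space X] [LocallyCompactSpace X] (χ : C₀(X, ℂ) →⋆ₙₐ[ℂ] ℂ) :
    (∀ f, χ f = 0) ∨ ∃ x, ∀ f, χ f = f x := by
  by_cases hz : ∃ x, ∀ f, χ f = 0 → f x = 0
  · obtain ⟨x, hx⟩ := hz
    by_cases hall : ∀ f, χ f = 0
    · exact Or.inl hall
    · right
      push Not at hall
      obtain ⟨g, hg⟩ := hall
      -- The combination `χ(f) g - χ(g) f` lies in the kernel of `χ`, hence vanishes at `x`: so `χ`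
      -- and evaluation at `x` are proportional.
      have key : ∀ f, χ f * g x = χ g * f x := fun f => by
        have := hx (χ f • g - χ g • f) (by
          rw [map_sub, map_smul, map_smul, smul_eq_mul, smul_eq_mul, mul_comm, sub_self])
        change χ f * g x - χ g * f x = 0 at this
        exact sub_eq_zero.mp this
      -- Proportionality applied to `g²` leaves `g(x) = χ(g)` or `g(x) = 0`. The latter would make
      -- every function vanish at `x`.
      have hgx : g x = χ g := by
        have h1 := key (g * g)
        rw [map_mul] at h1
        change χ g * χ g * g x = χ g * (g x * g x) at h1
        have h3 : g x * (χ g - g x) = 0 := by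
          have : χ g * (g x * (χ g - g x)) = 0 := by linear_combination h1
          exact (mul_eq_zero.mp this).resolve_left hg
        rcases mul_eq_zero.mp h3 with h4 | h4
        · exfalso
          have h5 : ∀ f : C₀(X, ℂ), f x = 0 := fun f => by
            have h6 := key f
            rw [h4, mul_zero] at h6
            exact (mul_eq_zero.mp h6.symm).resolve_left hg
          obtain ⟨y, hy⟩ : ∃ y, g y ≠ 0 := by
            by_contra hn
            push Not at hn
            exact hg (by rw [show g = 0 from ZeroAtInftyContinuousMap.ext hn, map_zero])
          have hxy : x ≠ y := fun h => hy (h ▸ h4)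
          obtain ⟨f, hf, -⟩ := exists_separating hxy
          exact one_ne_zero (hf.symm.trans (h5 f))
        · exact (sub_eq_zero.mp h4).symm
      refine ⟨x, fun f => ?_⟩
      have := key f
      rw [hgx, mul_comm] at this
      exact mul_left_cancel₀ hg this
  · push Not at hz
    left
    -- The kernel of `χ` has no common zero here. Being an ideal, it then separates points as well,
    -- so it is everything.
    let A : NonUnitalStarSubalgebra ℂ C₀(X, ℂ) :=
      { carrier := {f | χ f = 0}
        mul_mem' := fun {a b} ha _ => by
          change χ (a * b) = 0
          rw [map_mul, show χ a = 0 from ha, zero_mul]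
        add_mem' := fun {a b} ha hb => by
          change χ (a + b) = 0
          rw [map_add, show χ a = 0 from ha, show χ b = 0 from hb, add_zero]
        zero_mem' := map_zero χ
        smul_mem' := fun c a ha => by
          change χ (c • a) = 0
          rw [map_smul, show χ a = 0 from ha, smul_zero]
        star_mem' := fun {a} ha => by
          change χ (star a) = 0
          rw [map_star, show χ a = 0 from ha, star_zero] }
    refine fun f => mem_of_separatesPoints A
      (isClosed_singleton.preimage (map_continuous χ)) hz ?_ f
    intro x y hxy
    obtain ⟨f, hf1, hf0⟩ := exists_separating hxy
    obtain ⟨g, hg, hgx⟩ := hz x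
    refine ⟨f * g, ?_, ?_⟩
    · change χ (f * g) = 0
      rw [map_mul, hg, mul_zero]
    · change f x * g x ≠ f y * g y
      rw [hf1, hf0, one_mul, zero_mul]
      exact hgx

end ZeroAtInfinity

/-! ### Gelfand theory for two commuting representations. -/

section CommutingRepresentations

variable {D : Type*} [CStarAlgebra D]

/-- In a C*-algebra, a commutative C*-subalgebra has enough characters to detect the norm. -/
theorem exists_character [Nontrivial D] (E : StarSubalgebra ℂ D) [IsClosed (E : Set D)]
    (hE : ∀ x y : E, x * y = y * x) (a : E) : ∃ χ : E →⋆ₐ[ℂ] ℂ, ‖a‖ ≤ ‖χ a‖ := by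
  let _ : CommCStarAlgebra E := { (inferInstance : CStarAlgebra E) with mul_comm := hE }
  have h1 : ‖WeakDual.gelfandTransform ℂ E a‖ = ‖a‖ :=
    (AddMonoidHomClass.isometry_iff_norm _).mp (gelfandTransform_isometry E) a
  have hne : Nonempty (WeakDual.characterSpace ℂ E) := inferInstance
  obtain ⟨χ, -, hχ⟩ := isCompact_univ.exists_isMaxOn
    (Set.univ_nonempty (α := WeakDual.characterSpace ℂ E))
    (map_continuous (WeakDual.gelfandTransform ℂ E a)).norm.continuousOn
  refine ⟨(χ : E →⋆ₐ[ℂ] ℂ), ?_⟩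
  rw [← h1]
  exact (ContinuousMap.norm_le _ (norm_nonneg _)).mpr fun ψ => hχ (Set.mem_univ ψ)

/-- The restriction of the codomain of a `*`-homomorphism to a unital `*`-subalgebra. -/
def codRestrictStar {A : Type*} [NonUnitalCStarAlgebra A] (ρ : A →⋆ₙₐ[ℂ] D)
    (E : StarSubalgebra ℂ D) (h : ∀ a, ρ a ∈ E) : A →⋆ₙₐ[ℂ] E where
  toFun a := ⟨ρ a, h a⟩
  map_smul' c a := Subtype.ext (map_smul ρ c a)
  map_zero' := Subtype.ext (map_zero ρ)
  map_add' a b := Subtype.ext (map_add ρ a b)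
  map_mul' a b := Subtype.ext (map_mul ρ a b)
  map_star' a := Subtype.ext (map_star ρ a)

variable {X Y : Type*} [TopologicalSpace X] [TopologicalSpace Y] [T2Space X] [T2Space Y]
  [LocallyCompactSpace X] [LocallyCompactSpace Y]

/-- Commuting representations of `C₀(X)` and `C₀(Y)` are bounded by the supremum norm on the
algebraic tensor product. -/
theorem norm_sum_mul_le (ρ : C₀(X, ℂ) →⋆ₙₐ[ℂ] D) (σ : C₀(Y, ℂ) →⋆ₙₐ[ℂ] D)
    (hc : ∀ f g, ρ f * σ g = σ g * ρ f) {ι : Type*} (s : Finset ι) (a : ι → C₀(X, ℂ))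
    (b : ι → C₀(Y, ℂ)) {M : ℝ} (hM : 0 ≤ M)
    (h : ∀ x y, ‖∑ i ∈ s, a i x * b i y‖ ≤ M) : ‖∑ i ∈ s, ρ (a i) * σ (b i)‖ ≤ M := by
  rcases subsingleton_or_nontrivial D with hD | hD
  · rwa [Subsingleton.elim (∑ i ∈ s, ρ (a i) * σ (b i)) 0, norm_zero]
  set S : Set D := Set.range ρ ∪ Set.range σ with hS
  have hstar : S ∪ star S = S := by
    rw [Set.union_eq_left]
    rintro x (⟨f, hf⟩ | ⟨f, hf⟩)
    · exact Or.inl ⟨star f, by rw [map_star, hf, star_star]⟩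
    · exact Or.inr ⟨star f, by rw [map_star, hf, star_star]⟩
  have hcomm : ∀ x ∈ S, ∀ y ∈ S, x * y = y * x := by
    rintro _ (⟨f, rfl⟩ | ⟨f, rfl⟩) _ (⟨g, rfl⟩ | ⟨g, rfl⟩)
    · rw [← map_mul, mul_comm, map_mul]
    · exact hc f g
    · exact (hc g f).symm
    · rw [← map_mul, mul_comm, map_mul]
  -- The double centralizer of a self-adjoint commuting set is a closed commutative subalgebra
  -- containing it. Its characters restrict to zero or to a point evaluation on each of the two
  -- factors.
  let E : StarSubalgebra ℂ D := StarSubalgebra.centralizer ℂ (StarSubalgebra.centralizer ℂ S : Set D)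
  have hEc : (E : Set D) = S.centralizer.centralizer := by
    rw [StarSubalgebra.coe_centralizer_centralizer, hstar]
  have hcl : IsClosed (E : Set D) := by
    rw [hEc]
    exact Set.isClosed_centralizer _
  have hEcomm : ∀ x y : E, x * y = y * x := fun x y => Subtype.ext
    (Set.centralizer_centralizer_comm_of_comm hcomm _ (hEc ▸ x.2) _ (hEc ▸ y.2))
  have hSE : S ⊆ E := by
    rw [hEc]
    exact Set.subset_centralizer_centralizer
  let ρ' : C₀(X, ℂ) →⋆ₙₐ[ℂ] E := codRestrictStar ρ E
    (fun f => hSE (Or.inl ⟨f, rfl⟩))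
  let σ' : C₀(Y, ℂ) →⋆ₙₐ[ℂ] E := codRestrictStar σ E
    (fun f => hSE (Or.inr ⟨f, rfl⟩))
  have hsum : ∑ i ∈ s, ρ (a i) * σ (b i) =
      ((∑ i ∈ s, ρ' (a i) * σ' (b i) : E) : D) := by
    rw [AddSubmonoidClass.coe_finsetSum]
    rfl
  obtain ⟨χ, hχ⟩ := exists_character E hEcomm (∑ i ∈ s, ρ' (a i) * σ' (b i))
  rw [hsum]
  refine hχ.trans ?_
  rw [map_sum]
  simp only [map_mul]
  rcases eq_zero_or_eq_eval ((χ : E →⋆ₙₐ[ℂ] ℂ).comp ρ') with h1 | ⟨x, hx⟩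
  · have h1' : ∀ f, χ (ρ' f) = 0 := h1
    simpa [h1'] using hM
  rcases eq_zero_or_eq_eval ((χ : E →⋆ₙₐ[ℂ] ℂ).comp σ') with h2 | ⟨y, hy⟩
  · have h2' : ∀ f, χ (σ' f) = 0 := h2
    simpa [h2'] using hM
  have hx' : ∀ f, χ (ρ' f) = f x := hx
  have hy' : ∀ f, χ (σ' f) = f y := hy
  simp only [hx', hy']
  exact h x y

end CommutingRepresentations

/-! ### Passage to coefficients in a finite-dimensional C*-algebra. -/

section MatrixCoefficients

open Filter Topology

variable {X Y : Type*} [TopologicalSpace X] [TopologicalSpace Y]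
variable {N : Type*} [CStarAlgebra N]

/-- The function `y ↦ g(y) c`, linear in `c`. -/
def constSMul (g : C₀(Y, ℂ)) (c : N) : C₀(Y, N) where
  toFun y := g y • c
  continuous_toFun := (map_continuous g).smul continuous_const
  zero_at_infty' := by
    have := g.zero_at_infty'.smul_const c
    rwa [zero_smul] at this

theorem constSMul_mul (g g' : C₀(Y, ℂ)) (c c' : N) :
    constSMul g c * constSMul g' c' = constSMul (g * g') (c * c') := by
  ext y
  exact smul_mul_smul_comm _ _ _ _

theorem star_constSMul (g : C₀(Y, ℂ)) (c : N) :
    star (constSMul g c) = constSMul (star g) (star c) := by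
  ext y
  exact star_smul _ _

/-- The inclusion of the scalar functions into `C₀(Y, N)`. -/
def scalarHom (Y N : Type*) [TopologicalSpace Y] [CStarAlgebra N] : C₀(Y, ℂ) →⋆ₙₐ[ℂ] C₀(Y, N) where
  toFun g := constSMul g 1
  map_smul' c g := by ext y; exact smul_assoc c (g y) (1 : N)
  map_zero' := by ext y; exact zero_smul ℂ (1 : N)
  map_add' g g' := by ext y; exact add_smul (g y) (g' y) (1 : N)
  map_mul' g g' := by rw [constSMul_mul, mul_one]
  map_star' g := by rw [star_constSMul, star_one]

/-- The composition of a function vanishing at infinity with a linear functional. -/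
def compFunctional (φ : N →L[ℂ] ℂ) (b : C₀(Y, N)) : C₀(Y, ℂ) where
  toFun y := φ (b y)
  continuous_toFun := φ.continuous.comp (map_continuous b)
  zero_at_infty' := by
    have := (φ.continuous.tendsto 0).comp b.zero_at_infty'
    rwa [map_zero] at this

variable (N) in
/-- A finite-dimensional C*-algebra has a basis of unitaries. -/
theorem exists_unitary_basis [FiniteDimensional ℂ N] :
    ∃ (K : ℕ) (u : Module.Basis (Fin K) ℂ N), ∀ k, u k ∈ unitary N := by
  have hs : ⊤ ≤ Submodule.span ℂ (unitary N : Set N) := (CStarAlgebra.span_unitary N).ge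
  let u := Module.Basis.ofSpan hs
  have hfin := Module.Finite.finite_basis u
  obtain ⟨K, ⟨e⟩⟩ := hfin.exists_equiv_fin
  exact ⟨K, u.reindex e, fun k => by
    rw [Module.Basis.reindex_apply]
    exact Module.Basis.ofSpan_subset hs ⟨_, rfl⟩⟩

theorem sum_constSMul_coord {K : ℕ} [FiniteDimensional ℂ N] (u : Module.Basis (Fin K) ℂ N)
    (b : C₀(Y, N)) :
    b = ∑ k, constSMul (compFunctional (LinearMap.toContinuousLinearMap (u.coord k)) b) (u k) := by
  ext y
  let ev : C₀(Y, N) →+ N :=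
    { toFun := fun f => f y, map_zero' := rfl, map_add' := fun _ _ => rfl }
  change b y = ev _
  rw [map_sum]
  exact (u.sum_repr (b y)).symm

variable [T2Space X] [T2Space Y] [LocallyCompactSpace X] [LocallyCompactSpace Y]

/-- For `T_v = ∑ ρ(aᵢ) σ(bᵢ v)` with `v` unitary, the factor `v v* = 1` cancels inside `T_v T_v*`,
so `‖T_v‖` does not depend on `v`. At `v = 1` the two representations commute. No commutation of `ρ`
with `σ(bᵢ u)` is needed, which is why graded commutation causes no trouble. -/
theorem norm_sum_mul_constSMul_le {D : Type*} [CStarAlgebra D] (ρ : C₀(X, ℂ) →⋆ₙₐ[ℂ] D)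
    (σ : C₀(Y, N) →⋆ₙₐ[ℂ] D)
    (hc : ∀ f g, ρ f * σ (constSMul g 1) = σ (constSMul g 1) * ρ f) {u : N} (hu : u ∈ unitary N)
    {ι : Type*} (s : Finset ι) (a : ι → C₀(X, ℂ)) (b : ι → C₀(Y, ℂ)) {M : ℝ} (hM : 0 ≤ M)
    (h : ∀ x y, ‖∑ i ∈ s, a i x * b i y‖ ≤ M) :
    ‖∑ i ∈ s, ρ (a i) * σ (constSMul (b i) u)‖ ≤ M := by
  have h1 := norm_sum_mul_le ρ (σ.comp (scalarHom Y N)) hc s a b hM h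
  have h2 : ∀ v ∈ unitary N, (∑ i ∈ s, ρ (a i) * σ (constSMul (b i) v)) *
      star (∑ i ∈ s, ρ (a i) * σ (constSMul (b i) v)) =
      ∑ i ∈ s, ∑ j ∈ s, ρ (a i) * σ (constSMul (b i * star (b j)) 1) * star (ρ (a j)) := by
    intro v hv
    rw [star_sum, Finset.sum_mul_sum]
    refine Finset.sum_congr rfl fun i _ => Finset.sum_congr rfl fun j _ => ?_
    rw [star_mul, ← mul_assoc, mul_assoc (ρ (a i)), ← map_star σ, star_constSMul, ← map_mul,
      constSMul_mul, Unitary.mul_star_self_of_mem hv]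
  have h3 := (h2 u hu).trans (h2 1 (one_mem _)).symm
  have h4 := congrArg norm h3
  rw [CStarRing.norm_self_mul_star, CStarRing.norm_self_mul_star] at h4
  rw [(mul_self_inj (norm_nonneg _) (norm_nonneg _)).mp h4]
  exact h1

/-- Representations of `C₀(X)` and `C₀(Y, N)`, for a finite-dimensional `N`, that commute on the
scalar functions are bounded, up to a constant, by the supremum norm on the algebraic tensor
product. -/
theorem exists_norm_sum_mul_le (X Y N : Type*) [TopologicalSpace X] [TopologicalSpace Y]
    [T2Space X] [T2Space Y] [LocallyCompactSpace X] [LocallyCompactSpace Y] [CStarAlgebra N]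
    [FiniteDimensional ℂ N] :
    ∃ C : ℝ, 0 ≤ C ∧ ∀ (D : Type) [CStarAlgebra D] (ρ : C₀(X, ℂ) →⋆ₙₐ[ℂ] D)
      (σ : C₀(Y, N) →⋆ₙₐ[ℂ] D),
      (∀ f g, ρ f * σ (constSMul g 1) = σ (constSMul g 1) * ρ f) →
      ∀ (ι : Type) (s : Finset ι) (a : ι → C₀(X, ℂ)) (b : ι → C₀(Y, N)) (M : ℝ), 0 ≤ M →
        (∀ x y, ‖∑ i ∈ s, a i x • b i y‖ ≤ M) → ‖∑ i ∈ s, ρ (a i) * σ (b i)‖ ≤ C * M := by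
  obtain ⟨K, u, hu⟩ := exists_unitary_basis N
  let c : Fin K → N →L[ℂ] ℂ := fun k => LinearMap.toContinuousLinearMap (u.coord k)
  -- Each coordinate functional of the unitary basis contributes its norm. The constant is chosen
  -- before `D`, so one bound serves all pairs of representations.
  refine ⟨∑ k, ‖c k‖, by positivity, fun D _ ρ σ hc ι s a b M hM h => ?_⟩
  have h1 : ∑ i ∈ s, ρ (a i) * σ (b i) =
      ∑ k, ∑ i ∈ s, ρ (a i) * σ (constSMul (compFunctional (c k) (b i)) (u k)) := by
    rw [Finset.sum_comm]
    refine Finset.sum_congr rfl fun i _ => ?_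
    rw [← Finset.mul_sum, ← map_sum]
    congr 2
    exact sum_constSMul_coord u (b i)
  rw [h1, Finset.sum_mul]
  refine (norm_sum_le _ _).trans (Finset.sum_le_sum fun k _ => ?_)
  refine norm_sum_mul_constSMul_le ρ σ hc (hu k) s a _ (by positivity) fun x y => ?_
  have h2 : ∑ i ∈ s, a i x * compFunctional (c k) (b i) y = c k (∑ i ∈ s, a i x • b i y) := by
    rw [map_sum]
    refine Finset.sum_congr rfl fun i _ => ?_
    rw [map_smul]
    rfl
  rw [h2]
  exact ((c k).le_opNorm _).trans (mul_le_mul_of_nonneg_left (h x y) (norm_nonneg _))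

end MatrixCoefficients

/-! ### The Fock space of `ℝ^{m+1}` as two copies of that of `ℝ^m`, and the Clifford relation. -/

section FockDoubling

open Matrix

variable {m : ℕ}

/-- The index sets of the Fock space of `ℝ^{m+1}` without and with the last index. -/
def finsetSnoc (m : ℕ) : Finset (Fin m) ⊕ Finset (Fin m) ≃ Finset (Fin (m + 1)) where
  toFun := Sum.elim (fun I => I.map Fin.castSuccEmb)
    (fun I => insert (Fin.last m) (I.map Fin.castSuccEmb))
  invFun J := if Fin.last m ∈ J then Sum.inr (Finset.univ.filter fun i => Fin.castSucc i ∈ J)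
    else Sum.inl (Finset.univ.filter fun i => Fin.castSucc i ∈ J)
  left_inv := by
    rintro (I | I)
    · simp [Fin.castSucc_ne_last]
    · simp [Fin.castSucc_ne_last]
  right_inv J := by
    by_cases h : Fin.last m ∈ J
    · ext i
      refine Fin.lastCases ?_ (fun j => ?_) i
      · simp [h]
      · simp [h, Fin.castSucc_ne_last]
    · ext i
      refine Fin.lastCases ?_ (fun j => ?_) i
      · simp [h, Fin.castSucc_ne_last]
      · simp [h]

theorem finsetSnoc_inl (I : Finset (Fin m)) :
    finsetSnoc m (Sum.inl I) = I.map Fin.castSuccEmb := rfl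

theorem finsetSnoc_inr (I : Finset (Fin m)) :
    finsetSnoc m (Sum.inr I) = insert (Fin.last m) (I.map Fin.castSuccEmb) := rfl

theorem last_notMem_map (I : Finset (Fin m)) : Fin.last m ∉ I.map Fin.castSuccEmb := by
  simp [Fin.castSucc_ne_last]

/-- The block matrices with respect to the decomposition of the Fock space of `ℝ^{m+1}` into two
copies of the Fock space of `ℝ^m`. -/
def fockBlocks (A B C D : Matrix (Finset (Fin m)) (Finset (Fin m)) ℂ) :
    Matrix (Finset (Fin (m + 1))) (Finset (Fin (m + 1))) ℂ :=
  reindex (finsetSnoc m) (finsetSnoc m) (fromBlocks A B C D)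

variable (A B C D A' B' C' D' : Matrix (Finset (Fin m)) (Finset (Fin m)) ℂ)

theorem fockBlocks_mul : fockBlocks A B C D * fockBlocks A' B' C' D' =
    fockBlocks (A * A' + B * C') (A * B' + B * D') (C * A' + D * C') (C * B' + D * D') := by
  rw [fockBlocks, fockBlocks, fockBlocks, ← fromBlocks_multiply]
  simp only [reindex_apply, submatrix_mul_equiv]

theorem fockBlocks_add : fockBlocks A B C D + fockBlocks A' B' C' D' =
    fockBlocks (A + A') (B + B') (C + C') (D + D') := by
  rw [fockBlocks, fockBlocks, fockBlocks, ← fromBlocks_add]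
  rfl

theorem fockBlocks_smul (c : ℂ) :
    c • fockBlocks A B C D = fockBlocks (c • A) (c • B) (c • C) (c • D) := by
  rw [fockBlocks, fockBlocks, ← fromBlocks_smul]
  rfl

theorem fockBlocks_star : star (fockBlocks A B C D) =
    fockBlocks (star A) (star C) (star B) (star D) := by
  simp only [fockBlocks, star_eq_conjTranspose, conjTranspose_reindex, fromBlocks_conjTranspose]

theorem fockBlocks_one : fockBlocks (1 : Matrix (Finset (Fin m)) (Finset (Fin m)) ℂ) 0 0 1 = 1 := by
  simp [fockBlocks, fromBlocks_one]

variable {A B C D} in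
theorem eq_fockBlocks {M : Matrix (Finset (Fin (m + 1))) (Finset (Fin (m + 1))) ℂ}
    (h : ∀ J I, M (finsetSnoc m J) (finsetSnoc m I) = fromBlocks A B C D J I) :
    M = fockBlocks A B C D := by
  ext J I
  rw [← (finsetSnoc m).apply_symm_apply J, ← (finsetSnoc m).apply_symm_apply I, h]
  simp [fockBlocks]

/-- The matrix of the parity operator. -/
def parityMatrix (m : ℕ) : Matrix (Finset (Fin m)) (Finset (Fin m)) ℂ :=
  diagonal fun I => (-1) ^ I.card

theorem parityMatrix_succ :
    parityMatrix (m + 1) = fockBlocks (parityMatrix m) 0 0 (-parityMatrix m) := by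
  refine eq_fockBlocks ?_
  rintro (J | J) (I | I)
  · by_cases h : J = I
    · subst h; simp [parityMatrix, finsetSnoc_inl]
    · simp [parityMatrix, h]
  · simp [parityMatrix]
  · simp [parityMatrix]
  · by_cases h : J = I
    · subst h
      simp [parityMatrix, finsetSnoc_inr, Finset.card_insert_of_notMem, pow_succ]
    · simp [parityMatrix, h]

theorem card_filter_lt_castSucc (I : Finset (Fin m)) (i : Fin m) :
    ((I.map Fin.castSuccEmb).filter (· < Fin.castSucc i)).card = (I.filter (· < i)).card := by
  rw [Finset.filter_map, Finset.card_map]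
  rfl

theorem createMatrix_apply (i : Fin m) (J I : Finset (Fin m)) : createMatrix i J I =
    if i ∉ I ∧ J = insert i I then (-1) ^ (I.filter (· < i)).card else 0 := rfl

/-- The last index comes after every other one, so it is never moved past and does not affect the
sign. Both blocks therefore carry the same operator. -/
theorem createMatrix_castSucc (i : Fin m) : createMatrix (Fin.castSucc i) =
    fockBlocks (createMatrix i) 0 0 (createMatrix i) := by
  have hl : ¬ Fin.last m < Fin.castSucc i := not_lt.mpr (Fin.le_last _)
  have hins : ∀ I : Finset (Fin m), insert (Fin.castSucc i) (finsetSnoc m (Sum.inl I)) =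
      finsetSnoc m (Sum.inl (insert i I)) := fun I => by
    rw [finsetSnoc_inl, finsetSnoc_inl, Finset.map_insert]; rfl
  have hins' : ∀ I : Finset (Fin m), insert (Fin.castSucc i) (finsetSnoc m (Sum.inr I)) =
      finsetSnoc m (Sum.inr (insert i I)) := fun I => by
    rw [finsetSnoc_inr, finsetSnoc_inr, Finset.map_insert, Finset.insert_comm]; rfl
  have hmem : ∀ I : Finset (Fin m), Fin.castSucc i ∈ finsetSnoc m (Sum.inl I) ↔ i ∈ I := fun I => by
    simp [finsetSnoc_inl]
  have hmem' : ∀ I : Finset (Fin m), Fin.castSucc i ∈ finsetSnoc m (Sum.inr I) ↔ i ∈ I :=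
    fun I => by simp [finsetSnoc_inr, Fin.castSucc_ne_last]
  have hcard : ∀ I : Finset (Fin m), ((finsetSnoc m (Sum.inl I)).filter (· < Fin.castSucc i)).card =
      (I.filter (· < i)).card := card_filter_lt_castSucc (i := i)
  have hcard' : ∀ I : Finset (Fin m),
      ((finsetSnoc m (Sum.inr I)).filter (· < Fin.castSucc i)).card =
      (I.filter (· < i)).card := fun I => by
    rw [finsetSnoc_inr, Finset.filter_insert, if_neg hl, card_filter_lt_castSucc]
  refine eq_fockBlocks ?_
  rintro (J | J) (I | I)
  · simp only [createMatrix_apply, fromBlocks_apply₁₁, hins, hmem, hcard,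
      (finsetSnoc m).apply_eq_iff_eq, Sum.inl.injEq]
  · simp [createMatrix_apply, hins', (finsetSnoc m).apply_eq_iff_eq]
  · simp [createMatrix_apply, hins, (finsetSnoc m).apply_eq_iff_eq]
  · simp only [createMatrix_apply, fromBlocks_apply₂₂, hins', hmem', hcard',
      (finsetSnoc m).apply_eq_iff_eq, Sum.inr.injEq]

/-- The last basis vector moves past all of `I`, and the resulting sign `(-1)^|I|` is the parity. -/
theorem createMatrix_last : createMatrix (Fin.last m) = fockBlocks 0 0 (parityMatrix m) 0 := by
  have hins : ∀ I : Finset (Fin m), insert (Fin.last m) (finsetSnoc m (Sum.inl I)) =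
      finsetSnoc m (Sum.inr I) := fun I => rfl
  have hmem : ∀ I : Finset (Fin m), Fin.last m ∉ finsetSnoc m (Sum.inl I) := last_notMem_map
  have hmem' : ∀ I : Finset (Fin m), Fin.last m ∈ finsetSnoc m (Sum.inr I) :=
    fun I => Finset.mem_insert_self _ _
  have hcard : ∀ I : Finset (Fin m), ((finsetSnoc m (Sum.inl I)).filter (· < Fin.last m)).card =
      I.card := fun I => by
    rw [finsetSnoc_inl, Finset.filter_true_of_mem, Finset.card_map]
    simp [Fin.castSucc_lt_last]
  refine eq_fockBlocks ?_
  rintro (J | J) (I | I)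
  · simp [createMatrix_apply, hins, (finsetSnoc m).apply_eq_iff_eq]
  · simp [createMatrix_apply, hmem']
  · simp only [createMatrix_apply, fromBlocks_apply₂₁, hins, hmem, hcard,
      (finsetSnoc m).apply_eq_iff_eq, Sum.inr.injEq, parityMatrix]
    by_cases h : J = I
    · subst h; simp
    · simp [h]
  · simp [createMatrix_apply, hmem']

theorem star_parityMatrix : star (parityMatrix m) = parityMatrix m := by
  rw [parityMatrix, star_eq_conjTranspose, diagonal_conjTranspose]
  congr 1
  funext I
  simp

theorem parityMatrix_mul_self : parityMatrix m * parityMatrix m = 1 := by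
  rw [parityMatrix, diagonal_mul_diagonal, ← diagonal_one]
  congr 1
  funext I
  rw [← mul_pow]
  norm_num

/-- The matrix of the Clifford multiplication by `v`. -/
def hatMatrix (v : EuclideanSpace ℝ (Fin m)) : Matrix (Finset (Fin m)) (Finset (Fin m)) ℂ :=
  ∑ i, (v i : ℂ) • (createMatrix i + star (createMatrix i))

/-- The matrix of the Clifford multiplication by the last basis vector. -/
def lastMatrix (m : ℕ) : Matrix (Finset (Fin (m + 1))) (Finset (Fin (m + 1))) ℂ :=
  fockBlocks 0 (parityMatrix m) (parityMatrix m) 0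

/-- The operators on the Fock space of `ℝ^m`, as operators on the one of `ℝ^{m+1}`. -/
def blockIncl (m : ℕ) : Matrix (Finset (Fin m)) (Finset (Fin m)) ℂ →⋆ₐ[ℂ]
    Matrix (Finset (Fin (m + 1))) (Finset (Fin (m + 1))) ℂ where
  toFun A := fockBlocks A 0 0 A
  map_one' := fockBlocks_one
  map_mul' A B := by simp [fockBlocks_mul]
  map_zero' := by simp [fockBlocks]
  map_add' A B := by simp [fockBlocks_add]
  commutes' c := by
    simp only [Algebra.algebraMap_eq_smul_one]
    rw [← fockBlocks_one, fockBlocks_smul, smul_zero]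
  map_star' A := by simp [fockBlocks_star]

theorem blockIncl_apply : blockIncl m A = fockBlocks A 0 0 A := rfl

theorem blockIncl_injective : Function.Injective (blockIncl m) := by
  intro A B h
  ext J I
  have := congrFun (congrFun h (finsetSnoc m (Sum.inl J))) (finsetSnoc m (Sum.inl I))
  simpa [blockIncl_apply, fockBlocks] using this

theorem parityMatrix_mul_blockIncl : parityMatrix (m + 1) * blockIncl m A * parityMatrix (m + 1) =
    blockIncl m (parityMatrix m * A * parityMatrix m) := by
  simp [blockIncl_apply, parityMatrix_succ, fockBlocks_mul]

theorem lastMatrix_mul_self : lastMatrix m * lastMatrix m = 1 := by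
  simp [lastMatrix, fockBlocks_mul, parityMatrix_mul_self, fockBlocks_one]

/-- Conjugation by the last basis vector implements the grading on the smaller algebra. This is the
source of all the graded commutation below. -/
theorem lastMatrix_mul_blockIncl :
    lastMatrix m * blockIncl m A = blockIncl m (parityMatrix m * A * parityMatrix m) *
      lastMatrix m := by
  simp [lastMatrix, blockIncl_apply, fockBlocks_mul, mul_assoc, parityMatrix_mul_self]

theorem hatMatrix_snoc (v : EuclideanSpace ℝ (Fin m)) (t : ℝ) :
    hatMatrix (WithLp.toLp 2 (Fin.snoc (α := fun _ => ℝ) v t) : EuclideanSpace ℝ (Fin (m + 1))) =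
      blockIncl m (hatMatrix v) + (t : ℂ) • lastMatrix m := by
  rw [hatMatrix, Fin.sum_univ_castSucc, hatMatrix, map_sum]
  simp only [Fin.snoc_castSucc, Fin.snoc_last, map_smul, map_add, map_star, blockIncl_apply]
  simp only [createMatrix_castSucc, createMatrix_last, fockBlocks_star, star_parityMatrix,
    fockBlocks_add, lastMatrix]
  simp

theorem star_hatMatrix (v : EuclideanSpace ℝ (Fin m)) : star (hatMatrix v) = hatMatrix v := by
  rw [hatMatrix, star_sum]
  refine Finset.sum_congr rfl fun i _ => ?_
  rw [star_smul, star_add, star_star, add_comm, Complex.star_def, Complex.conj_ofReal]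

theorem parityMatrix_mul_createMatrix (i : Fin m) :
    parityMatrix m * createMatrix i * parityMatrix m = -createMatrix i := by
  ext J I
  rw [parityMatrix, mul_diagonal, diagonal_mul, neg_apply, createMatrix_apply]
  split_ifs with hJ
  · obtain ⟨hi, rfl⟩ := hJ
    rw [Finset.card_insert_of_notMem hi, pow_succ]
    have h1 : ((-1 : ℂ) ^ I.card) * (-1) ^ I.card = 1 := by rw [← mul_pow]; norm_num
    linear_combination (-(-1 : ℂ) ^ (I.filter (· < i)).card) * h1
  · simp

theorem parityMatrix_mul_hatMatrix (v : EuclideanSpace ℝ (Fin m)) :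
    parityMatrix m * hatMatrix v * parityMatrix m = -hatMatrix v := by
  have h : ∀ i : Fin m, parityMatrix m * star (createMatrix i) * parityMatrix m =
      -star (createMatrix i) := fun i => by
    have := congrArg star (parityMatrix_mul_createMatrix i)
    rwa [star_mul, star_mul, star_parityMatrix, star_neg, ← mul_assoc] at this
  simp only [hatMatrix, Finset.mul_sum, Finset.sum_mul, mul_smul_comm, smul_mul_assoc, mul_add,
    add_mul, h, parityMatrix_mul_createMatrix, ← Finset.sum_neg_distrib]
  refine Finset.sum_congr rfl fun i _ => ?_
  rw [← neg_add, smul_neg]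

/-- The Clifford relation, for matrices. -/
theorem hatMatrix_mul_self (v : EuclideanSpace ℝ (Fin m)) :
    hatMatrix v * hatMatrix v = ((‖v‖ ^ 2 : ℝ) : ℂ) • 1 := by
  induction m with
  | zero =>
    rw [hatMatrix, EuclideanSpace.real_norm_sq_eq]
    simp
  | succ m ih =>
    obtain ⟨w, t, rfl⟩ : ∃ (w : EuclideanSpace ℝ (Fin m)) (t : ℝ),
        v = WithLp.toLp 2 (Fin.snoc (α := fun _ => ℝ) w t) :=
      ⟨WithLp.toLp 2 (Fin.init v), v (Fin.last m), by
        ext i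
        simp⟩
    -- Vectors are odd, so the last basis vector anticommutes with `w` and the cross terms of the
    -- square cancel.
    have hcross : lastMatrix m * blockIncl m (hatMatrix w) =
        -(blockIncl m (hatMatrix w) * lastMatrix m) := by
      rw [lastMatrix_mul_blockIncl, parityMatrix_mul_hatMatrix, map_neg, neg_mul]
    rw [hatMatrix_snoc, add_mul, mul_add, mul_add, ← map_mul, ih, map_smul, map_one,
      smul_mul_smul_comm, lastMatrix_mul_self, mul_smul_comm, smul_mul_assoc, hcross,
      EuclideanSpace.real_norm_sq_eq, EuclideanSpace.real_norm_sq_eq, Fin.sum_univ_castSucc]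
    simp only [Fin.snoc_castSucc, Fin.snoc_last]
    push_cast
    module

/-- The operator of a matrix. -/
def matrixOp (m : ℕ) : Matrix (Finset (Fin m)) (Finset (Fin m)) ℂ →⋆ₐ[ℂ]
    (Fock m →L[ℂ] Fock m) :=
  ((toEuclideanCLM (n := Finset (Fin m)) (𝕜 := ℂ) : Matrix (Finset (Fin m)) (Finset (Fin m)) ℂ ≃⋆ₐ[ℂ]
    (Fock m →L[ℂ] Fock m)) : Matrix (Finset (Fin m)) (Finset (Fin m)) ℂ →⋆ₐ[ℂ]
    (Fock m →L[ℂ] Fock m))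

/-- The matrix of an operator. -/
def opMatrix (m : ℕ) : (Fock m →L[ℂ] Fock m) →⋆ₐ[ℂ]
    Matrix (Finset (Fin m)) (Finset (Fin m)) ℂ :=
  ((toEuclideanCLM (n := Finset (Fin m)) (𝕜 := ℂ)).symm : (Fock m →L[ℂ] Fock m) →⋆ₐ[ℂ]
    Matrix (Finset (Fin m)) (Finset (Fin m)) ℂ)

theorem matrixOp_opMatrix (T : Fock m →L[ℂ] Fock m) : matrixOp m (opMatrix m T) = T :=
  (toEuclideanCLM (n := Finset (Fin m)) (𝕜 := ℂ)).apply_symm_apply T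

theorem opMatrix_matrixOp (A : Matrix (Finset (Fin m)) (Finset (Fin m)) ℂ) :
    opMatrix m (matrixOp m A) = A :=
  (toEuclideanCLM (n := Finset (Fin m)) (𝕜 := ℂ)).symm_apply_apply A

theorem matrixOp_parityMatrix : matrixOp m (parityMatrix m) = parity m := rfl

theorem matrixOp_hatMatrix (v : EuclideanSpace ℝ (Fin m)) : matrixOp m (hatMatrix v) = hat v := by
  have h1 : create v = matrixOp m (∑ i, (v i : ℂ) • createMatrix i) := by
    rw [map_sum]
    simp only [map_smul]
    rfl
  rw [hat, h1, ← map_star, ← map_add, hatMatrix, star_sum, ← Finset.sum_add_distrib]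
  congr 1
  refine Finset.sum_congr rfl fun i _ => ?_
  rw [star_smul, smul_add, Complex.star_def, Complex.conj_ofReal]

end FockDoubling

/-! ### The inclusion `Cl(ℝ^m) ⊆ Cl(ℝ^{m+1})`, its complement, and functional calculus. -/

section CliffordInclusion

variable {m : ℕ}

/-- The operators on the Fock space of `ℝ^m`, as operators on the one of `ℝ^{m+1}`. -/
def fockIncl (m : ℕ) : (Fock m →L[ℂ] Fock m) →⋆ₐ[ℂ] (Fock (m + 1) →L[ℂ] Fock (m + 1)) :=
  (matrixOp (m + 1)).comp ((blockIncl m).comp (opMatrix m))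

theorem fockIncl_matrixOp (A : Matrix (Finset (Fin m)) (Finset (Fin m)) ℂ) :
    fockIncl m (matrixOp m A) = matrixOp (m + 1) (blockIncl m A) := by
  change matrixOp (m + 1) (blockIncl m (opMatrix m (matrixOp m A))) = _
  rw [opMatrix_matrixOp]

theorem fockIncl_injective : Function.Injective (fockIncl m) := by
  intro S T h
  have h1 := congrArg (opMatrix (m + 1)) h
  change opMatrix (m + 1) (matrixOp (m + 1) _) = opMatrix (m + 1) (matrixOp (m + 1) _) at h1
  rw [opMatrix_matrixOp, opMatrix_matrixOp] at h1
  have h2 : matrixOp m (opMatrix m S) = matrixOp m (opMatrix m T) :=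
    congrArg (matrixOp m) (blockIncl_injective h1)
  rwa [matrixOp_opMatrix, matrixOp_opMatrix] at h2

/-- The vector `(v, t) ∈ ℝ^{m+1}` of `v ∈ ℝ^m` and `t ∈ ℝ`. -/
def snocVec (v : EuclideanSpace ℝ (Fin m)) (t : ℝ) : EuclideanSpace ℝ (Fin (m + 1)) :=
  WithLp.toLp 2 (Fin.snoc (α := fun _ => ℝ) v t)

theorem norm_snocVec_sq (v : EuclideanSpace ℝ (Fin m)) (t : ℝ) :
    ‖snocVec v t‖ ^ 2 = ‖v‖ ^ 2 + t ^ 2 := by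
  rw [EuclideanSpace.real_norm_sq_eq, EuclideanSpace.real_norm_sq_eq, Fin.sum_univ_castSucc]
  simp [snocVec]

theorem hatMatrix_zero : hatMatrix (0 : EuclideanSpace ℝ (Fin m)) = 0 := by
  simp [hatMatrix]

theorem hat_snocVec (v : EuclideanSpace ℝ (Fin m)) (t : ℝ) :
    hat (snocVec v t) = fockIncl m (hat v) + (t : ℂ) • hat (snocVec (0 : EuclideanSpace ℝ (Fin m)) 1) := by
  rw [← matrixOp_hatMatrix, ← matrixOp_hatMatrix, ← matrixOp_hatMatrix, fockIncl_matrixOp,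
    ← map_smul, ← map_add, snocVec, snocVec, hatMatrix_snoc, hatMatrix_snoc, hatMatrix_zero]
  simp

theorem fockIncl_hat (v : EuclideanSpace ℝ (Fin m)) : fockIncl m (hat v) = hat (snocVec v 0) := by
  rw [← matrixOp_hatMatrix, ← matrixOp_hatMatrix, fockIncl_matrixOp, snocVec, hatMatrix_snoc]
  simp

theorem fockIncl_mem {T : Fock m →L[ℂ] Fock m}
    (hT : T ∈ cliffordSub (⊤ : Submodule ℝ (EuclideanSpace ℝ (Fin m)))) :
    fockIncl m T ∈ cliffordSub (⊤ : Submodule ℝ (EuclideanSpace ℝ (Fin (m + 1)))) := by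
  have hle : cliffordSub (⊤ : Submodule ℝ (EuclideanSpace ℝ (Fin m))) ≤
      (cliffordSub (⊤ : Submodule ℝ (EuclideanSpace ℝ (Fin (m + 1))))).comap (fockIncl m) := by
    refine StarSubalgebra.topologicalClosure_minimal (StarAlgebra.adjoin_le ?_)
      ((StarSubalgebra.isClosed_topologicalClosure _).preimage (map_continuous (fockIncl m)))
    rintro _ ⟨v, -, rfl⟩
    have h : fockIncl m (hat v) ∈ cliffordSub (⊤ : Submodule ℝ (EuclideanSpace ℝ (Fin (m + 1)))) := by
      rw [fockIncl_hat]
      exact hat_mem trivial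
    exact h
  exact hle hT

/-- The inclusion `Cl(ℝ^m) ⊆ Cl(ℝ^{m+1})`. -/
def clIncl (m : ℕ) : Cl m →⋆ₐ[ℂ] Cl (m + 1) where
  toFun a := ⟨fockIncl m (Cl.op a), fockIncl_mem a.2⟩
  map_one' := Cl.ext (map_one (fockIncl m))
  map_mul' a b := Cl.ext (map_mul (fockIncl m) (Cl.op a) (Cl.op b))
  map_zero' := Cl.ext (map_zero (fockIncl m))
  map_add' a b := Cl.ext (map_add (fockIncl m) (Cl.op a) (Cl.op b))
  commutes' c := Cl.ext (AlgHomClass.commutes (fockIncl m) c)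
  map_star' a := Cl.ext (map_star (fockIncl m) (Cl.op a))

theorem op_clIncl (a : Cl m) : Cl.op (clIncl m a) = fockIncl m (Cl.op a) := rfl

theorem op_vec (v : EuclideanSpace ℝ (Fin m)) : Cl.op (vec v) = hat v := rfl

theorem clIncl_injective : Function.Injective (clIncl m) := fun _ _ h =>
  Cl.ext (fockIncl_injective (congrArg Cl.op h))

theorem norm_clIncl (a : Cl m) : ‖clIncl m a‖ = ‖a‖ :=
  NonUnitalStarAlgHom.norm_map (clIncl m) clIncl_injective a

/-- The last basis vector in `Cl(ℝ^{m+1})`. -/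
def clLast (m : ℕ) : Cl (m + 1) := vec (snocVec 0 1)

theorem vec_snocVec (v : EuclideanSpace ℝ (Fin m)) (t : ℝ) :
    vec (snocVec v t) = clIncl m (vec v) + (t : ℂ) • clLast m :=
  Cl.ext (hat_snocVec v t)

theorem vec_mul_self (v : EuclideanSpace ℝ (Fin m)) :
    vec v * vec v = ((‖v‖ ^ 2 : ℝ) : ℂ) • (1 : Cl m) := by
  apply Cl.ext
  rw [map_mul, map_smul, map_one, op_vec, ← matrixOp_hatMatrix, ← map_mul, hatMatrix_mul_self,
    map_smul, map_one]

theorem star_vec (v : EuclideanSpace ℝ (Fin m)) : star (vec v) = vec v := by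
  apply Cl.ext
  rw [map_star, op_vec, ← matrixOp_hatMatrix, ← map_star, star_hatMatrix]

theorem vec_eq_sum (v : EuclideanSpace ℝ (Fin m)) :
    vec v = ∑ i, (v i : ℂ) • vec (EuclideanSpace.single i 1) := by
  apply Cl.ext
  rw [map_sum]
  simp only [map_smul, op_vec, ← matrixOp_hatMatrix]
  rw [hatMatrix, map_sum]
  refine Finset.sum_congr rfl fun i _ => ?_
  rw [map_smul]
  congr 2
  rw [hatMatrix, Finset.sum_eq_single i]
  · simp
  · intro j _ hj
    simp [hj]
  · simp

theorem clLast_mul_self : clLast m * clLast m = 1 := by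
  rw [clLast, vec_mul_self, norm_snocVec_sq]
  simp

theorem star_clLast : star (clLast m) = clLast m := star_vec _

theorem op_cliffordGrading (a : Cl m) :
    Cl.op ((cliffordGrading m).aut a) = parity m * Cl.op a * parity m := rfl

theorem cliffordGrading_clIncl (a : Cl m) :
    (cliffordGrading (m + 1)).aut (clIncl m a) = clIncl m ((cliffordGrading m).aut a) := by
  apply Cl.ext
  rw [op_cliffordGrading, op_clIncl, op_clIncl, op_cliffordGrading,
    ← matrixOp_opMatrix (Cl.op a), ← matrixOp_parityMatrix, ← matrixOp_parityMatrix, ← map_mul,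
    ← map_mul, fockIncl_matrixOp, fockIncl_matrixOp, ← map_mul, ← map_mul,
    parityMatrix_mul_blockIncl]

theorem op_clLast : Cl.op (clLast m) = matrixOp (m + 1) (lastMatrix m) := by
  rw [clLast, op_vec, ← matrixOp_hatMatrix, snocVec, hatMatrix_snoc, hatMatrix_zero]
  simp

theorem clLast_mul_clIncl (a : Cl m) :
    clLast m * clIncl m a = clIncl m ((cliffordGrading m).aut a) * clLast m := by
  apply Cl.ext
  rw [map_mul, map_mul, op_clLast, op_clIncl, op_clIncl, op_cliffordGrading,
    ← matrixOp_opMatrix (Cl.op a), ← matrixOp_parityMatrix, ← map_mul, ← map_mul,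
    fockIncl_matrixOp, fockIncl_matrixOp, ← map_mul, ← map_mul, lastMatrix_mul_blockIncl]

instance (m : ℕ) : Nontrivial (Cl m) :=
  ⟨⟨0, 1, fun h => by
    have h1 := congrArg (opMatrix m) (congrArg Cl.op h)
    rw [map_zero, map_zero, map_one, map_one] at h1
    exact zero_ne_one h1⟩⟩

theorem norm_clLast : ‖clLast m‖ = 1 := by
  have h := CStarRing.norm_self_mul_star (x := clLast m)
  rw [star_clLast, clLast_mul_self, norm_one] at h
  nlinarith [norm_nonneg (clLast m)]

/-- The automorphism of `Cl(ℝ^{m+1})` that fixes `Cl(ℝ^m)` and changes the sign of the last basis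
vector. -/
def reflectLast (x : Cl (m + 1)) : Cl (m + 1) :=
  clLast m * (cliffordGrading (m + 1)).aut x * clLast m

theorem norm_reflectLast_le (x : Cl (m + 1)) : ‖reflectLast x‖ ≤ ‖x‖ := by
  refine (norm_mul_le _ _).trans ?_
  rw [norm_clLast, mul_one]
  refine (norm_mul_le _ _).trans ?_
  rw [norm_clLast, one_mul]
  exact NonUnitalStarAlgHom.norm_apply_le _ x

/-- The grading of `Cl(ℝ^{m+1})` negates `e` and grades `c` and `d`. Conjugation by `e` undoes the
grading of `c` and `d` but leaves the sign of `e`. -/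
theorem reflectLast_add (c d : Cl m) :
    reflectLast (clIncl m c + clLast m * clIncl m d) = clIncl m c - clLast m * clIncl m d := by
  have h1 : (cliffordGrading (m + 1)).aut (clLast m) = -clLast m := cliffordGrading_vec _
  have h2 : clIncl m ((cliffordGrading m).aut c) * clLast m = clLast m * clIncl m c :=
    (clLast_mul_clIncl c).symm
  have h3 : clIncl m ((cliffordGrading m).aut d) * clLast m = clLast m * clIncl m d :=
    (clLast_mul_clIncl d).symm
  rw [reflectLast, map_add, map_mul, h1, cliffordGrading_clIncl, cliffordGrading_clIncl, mul_assoc,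
    add_mul, h2, mul_assoc, h3, neg_mul, mul_add, mul_neg, ← mul_assoc, ← mul_assoc,
    clLast_mul_self, one_mul, one_mul, sub_eq_add_neg]

/-- The summand `c` is the average of `c + e d` and its reflection `c - e d`, and the reflection is
contractive. The difference gives `d` in the same way, as `e² = 1`. -/
theorem norm_left_le (c d : Cl m) : ‖c‖ ≤ ‖clIncl m c + clLast m * clIncl m d‖ := by
  set x := clIncl m c + clLast m * clIncl m d with hx
  have h : (2 : ℂ) • clIncl m c = x + reflectLast x := by
    rw [hx, reflectLast_add]; module
  have h1 := congrArg norm h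
  rw [norm_smul, norm_clIncl, Complex.norm_ofNat] at h1
  linarith [norm_add_le x (reflectLast x), norm_reflectLast_le x]

theorem norm_right_le (c d : Cl m) : ‖d‖ ≤ ‖clIncl m c + clLast m * clIncl m d‖ := by
  set x := clIncl m c + clLast m * clIncl m d with hx
  have h : (2 : ℂ) • clIncl m d = clLast m * (x - reflectLast x) := by
    have h0 : x - reflectLast x = (2 : ℂ) • (clLast m * clIncl m d) := by
      rw [hx, reflectLast_add]; module
    rw [h0, mul_smul_comm, ← mul_assoc, clLast_mul_self, one_mul]
  have h1 := congrArg norm h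
  rw [norm_smul, norm_clIncl, Complex.norm_ofNat] at h1
  have h2 := norm_mul_le (clLast m) (x - reflectLast x)
  rw [norm_clLast, one_mul] at h2
  linarith [norm_sub_le x (reflectLast x), norm_reflectLast_le x]

instance (m : ℕ) : FiniteDimensional ℂ (Cl m) := by
  refine FiniteDimensional.of_injective
    (((opMatrix m).comp Cl.op : Cl m →⋆ₐ[ℂ] _).toAlgHom.toLinearMap) ?_
  intro a b h
  have h1 := congrArg (matrixOp m) (show opMatrix m (Cl.op a) = opMatrix m (Cl.op b) from h)
  rw [matrixOp_opMatrix, matrixOp_opMatrix] at h1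
  exact Cl.ext h1

/-- Functional calculus at a fixed vector is a `*`-homomorphism. -/
def funcCalcHom (v : EuclideanSpace ℝ (Fin m)) : C₀(ℝ, ℂ) →⋆ₙₐ[ℂ] Cl m where
  toFun f := funcCalc f v
  map_smul' c f := by
    have he : evPart (c • f) ‖v‖ = c * evPart f ‖v‖ := by
      change (c * f ‖v‖ + c * f (-‖v‖)) / 2 = c * ((f ‖v‖ + f (-‖v‖)) / 2); ring
    have ho : oddPart (c • f) ‖v‖ = c * oddPart f ‖v‖ := by
      change (c * f ‖v‖ - c * f (-‖v‖)) / 2 = c * ((f ‖v‖ - f (-‖v‖)) / 2); ring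
    simp only [funcCalc, he, ho, MonoidHom.id_apply]
    split_ifs <;> module
  map_zero' := by
    have he : evPart (0 : C₀(ℝ, ℂ)) ‖v‖ = 0 := by simp [evPart]
    have ho : oddPart (0 : C₀(ℝ, ℂ)) ‖v‖ = 0 := by simp [oddPart]
    simp [funcCalc, he, ho]
  map_add' f g := by
    have he : evPart (f + g) ‖v‖ = evPart f ‖v‖ + evPart g ‖v‖ := by
      simp only [evPart, ZeroAtInftyContinuousMap.add_apply]; ring
    have ho : oddPart (f + g) ‖v‖ = oddPart f ‖v‖ + oddPart g ‖v‖ := by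
      simp only [oddPart, ZeroAtInftyContinuousMap.add_apply]; ring
    simp only [funcCalc, he, ho]
    split_ifs <;> module
  map_mul' f g := by
    have he : evPart (f * g) ‖v‖ =
        evPart f ‖v‖ * evPart g ‖v‖ + oddPart f ‖v‖ * oddPart g ‖v‖ := by
      simp only [evPart, oddPart, ZeroAtInftyContinuousMap.mul_apply]; ring
    have ho : oddPart (f * g) ‖v‖ =
        evPart f ‖v‖ * oddPart g ‖v‖ + oddPart f ‖v‖ * evPart g ‖v‖ := by
      simp only [evPart, oddPart, ZeroAtInftyContinuousMap.mul_apply]; ring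
    simp only [funcCalc, he, ho]
    split_ifs with hv
    · have h0 : oddPart f ‖v‖ = 0 := by simp [oddPart, hv]
      rw [h0, add_zero, add_zero, add_zero, zero_mul, add_zero, smul_mul_smul_comm, mul_one]
    · have hn : ‖v‖ ≠ 0 := norm_ne_zero_iff.mpr hv
      -- The unit vector squares to `1`, so `f(v)` multiplies like an element of the group algebra
      -- of `ℤ/2`, just as even and odd parts of functions do.
      have hsq : (((‖v‖⁻¹ : ℝ) : ℂ) • vec v) * (((‖v‖⁻¹ : ℝ) : ℂ) • vec v) = 1 := by
        rw [smul_mul_smul_comm, vec_mul_self, smul_smul, ← Complex.ofReal_mul,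
          ← Complex.ofReal_mul]
        have : ‖v‖⁻¹ * ‖v‖⁻¹ * ‖v‖ ^ 2 = 1 := by field_simp
        rw [this, Complex.ofReal_one, one_smul]
      generalize (((‖v‖⁻¹ : ℝ) : ℂ) • vec v) = s at hsq
      rw [add_mul, mul_add, mul_add, smul_mul_smul_comm, smul_mul_smul_comm, smul_mul_smul_comm,
        smul_mul_smul_comm, hsq]
      simp only [one_mul, mul_one]
      module
  map_star' f := by
    have he : evPart (star f) ‖v‖ = star (evPart f ‖v‖) := by
      simp [evPart]
    have ho : oddPart (star f) ‖v‖ = star (oddPart f ‖v‖) := by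
      simp [oddPart]
    simp only [funcCalc, he, ho]
    split_ifs
    · simp
    · rw [star_add, star_smul, star_smul, star_smul, star_one, star_vec, Complex.star_def,
        Complex.conj_ofReal]

/-- The formula needs no exception at `t = 0`, where the odd part vanishes. -/
theorem funcCalc_last (f : C₀(ℝ, ℂ)) {t : ℝ} (ht : 0 ≤ t) :
    funcCalc f (snocVec (0 : EuclideanSpace ℝ (Fin m)) t) =
      evPart f t • (1 : Cl (m + 1)) + oddPart f t • clLast m := by
  have hn : ‖snocVec (0 : EuclideanSpace ℝ (Fin m)) t‖ = t := by
    have h := norm_snocVec_sq (0 : EuclideanSpace ℝ (Fin m)) t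
    rw [norm_zero, zero_pow two_ne_zero, zero_add] at h
    exact (sq_eq_sq₀ (norm_nonneg _) ht).mp h
  have hvec : vec (snocVec (0 : EuclideanSpace ℝ (Fin m)) t) = (t : ℂ) • clLast m := by
    rw [vec_snocVec, add_eq_right]
    have : vec (0 : EuclideanSpace ℝ (Fin m)) = 0 := by
      apply Cl.ext
      rw [op_vec, ← matrixOp_hatMatrix, hatMatrix_zero, map_zero, map_zero]
    rw [this, map_zero]
  rw [funcCalc, hn, hvec]
  congr 1
  split_ifs with h
  · have h0 : t = 0 := by rw [← hn, h, norm_zero]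
    simp [h0, oddPart]
  · have h0 : t ≠ 0 := by
      rintro rfl
      exact h (norm_eq_zero.mp hn)
    rw [smul_smul ((t⁻¹ : ℝ) : ℂ), ← Complex.ofReal_mul, inv_mul_cancel₀ h0, Complex.ofReal_one,
      one_smul]

end CliffordInclusion

/-! ### Comparison of C*-algebras through a common target. -/

/-- Two injective `*`-homomorphisms with the same range have isomorphic domains. -/
theorem exists_starAlgEquiv {A B L : Type*} [NonUnitalCStarAlgebra A] [NonUnitalCStarAlgebra B]
    [NonUnitalCStarAlgebra L] (i : A →⋆ₙₐ[ℂ] L) (j : B →⋆ₙₐ[ℂ] L) (hi : Function.Injective i)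
    (hj : Function.Injective j) (hij : ∀ a, ∃ b, j b = i a) (hji : ∀ b, ∃ a, i a = j b) :
    ∃ Φ : A ≃⋆ₐ[ℂ] B, ∀ a, j (Φ a) = i a := by
  choose f hf using hij
  choose g hg using hji
  exact ⟨{ toFun := f
           invFun := g
           left_inv := fun a => hi (by rw [hg, hf])
           right_inv := fun b => hj (by rw [hf, hg])
           map_mul' := fun a b => hj (by rw [map_mul, hf, hf, hf, map_mul])
           map_add' := fun a b => hj (by rw [map_add, hf, hf, hf, map_add])
           map_star' := fun a => hj (by rw [map_star, hf, hf, map_star])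
           map_smul' := fun c a => hj (by rw [map_smul, hf, hf, map_smul]) }, hf⟩

/-- The range of an injective `*`-homomorphism of C*-algebras is closed. -/
theorem isClosed_setOf_mem_range {A B L : Type*} [NonUnitalCStarAlgebra A]
    [NonUnitalCStarAlgebra B] [NonUnitalCStarAlgebra L] (i : A →⋆ₙₐ[ℂ] L) (j : B →⋆ₙₐ[ℂ] L)
    (hi : Function.Injective i) : IsClosed {b | ∃ a, i a = j b} :=
  (NonUnitalStarAlgHom.isometry i hi).isClosedEmbedding.isClosed_range.preimage (map_continuous j)

/-- The preimage of the range of a `*`-homomorphism. -/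
def preimageRange {A B L : Type*} [NonUnitalCStarAlgebra A] [NonUnitalCStarAlgebra B]
    [NonUnitalCStarAlgebra L] (i : A →⋆ₙₐ[ℂ] L) (j : B →⋆ₙₐ[ℂ] L) :
    NonUnitalStarSubalgebra ℂ B where
  carrier := {b | ∃ a, i a = j b}
  add_mem' := by
    rintro b b' ⟨a, ha⟩ ⟨a', ha'⟩
    exact ⟨a + a', by rw [map_add, map_add, ha, ha']⟩
  zero_mem' := ⟨0, by rw [map_zero, map_zero]⟩
  mul_mem' := by
    rintro b b' ⟨a, ha⟩ ⟨a', ha'⟩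
    exact ⟨a * a', by rw [map_mul, map_mul, ha, ha']⟩
  smul_mem' := by
    rintro c b ⟨a, ha⟩
    exact ⟨c • a, by rw [map_smul, map_smul, ha]⟩
  star_mem' := by
    rintro b ⟨a, ha⟩
    exact ⟨star a, by rw [map_star, map_star, ha]⟩

/-! ### Even and odd parts in a graded C*-algebra. -/

namespace CStarGrading

variable {A : Type*} [NonUnitalCStarAlgebra A] (γ : CStarGrading A)

/-- The even part of an element of a graded C*-algebra. -/
def even (a : A) : A := (2⁻¹ : ℂ) • (a + γ.aut a)

/-- The odd part of an element of a graded C*-algebra. -/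
def odd (a : A) : A := (2⁻¹ : ℂ) • (a - γ.aut a)

theorem even_add_odd (a : A) : γ.even a + γ.odd a = a := by
  rw [even, odd]; module

theorem even_sub_odd (a : A) : γ.even a - γ.odd a = γ.aut a := by
  rw [even, odd]; module

theorem aut_even (a : A) : γ.aut (γ.even a) = γ.even a := by
  rw [even, map_smul, map_add, γ.aut_aut, add_comm]

theorem aut_odd (a : A) : γ.aut (γ.odd a) = -γ.odd a := by
  rw [odd, map_smul, map_sub, γ.aut_aut, ← smul_neg, neg_sub]

theorem isHomogeneous_even (a : A) : γ.IsHomogeneous 0 (γ.even a) := by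
  rw [IsHomogeneous, aut_even, pow_zero, one_smul]

theorem isHomogeneous_odd (a : A) : γ.IsHomogeneous 1 (γ.odd a) := by
  rw [IsHomogeneous, aut_odd, pow_one, neg_one_smul]

end CStarGrading

/-! ### Calculus of elementary tensors. -/

section ElementaryTensors

variable {A B : Type u} [NonUnitalCStarAlgebra A] [NonUnitalCStarAlgebra B]
  {α : CStarGrading A} {β : CStarGrading B}

theorem GradedCommPair.right_mul_left_of_even (r : GradedCommPair α β) {a : A} (ha : α.aut a = a)
    (b : B) : r.right b * r.left a = r.left a * r.right b := by
  have ha' : α.IsHomogeneous 0 a := by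
    rw [CStarGrading.IsHomogeneous, ha, pow_zero, one_smul]
  have h0 := r.comm 0 0 a _ ha' (β.isHomogeneous_even b)
  have h1 := r.comm 0 1 a _ ha' (β.isHomogeneous_odd b)
  rw [zero_mul, pow_zero, one_smul] at h0 h1
  rw [← β.even_add_odd b, map_add, mul_add, add_mul, h0, h1]

theorem GradedCommPair.right_mul_left_of_odd (r : GradedCommPair α β) {a : A} (ha : α.aut a = -a)
    (b : B) : r.right b * r.left a = r.left a * r.right (β.aut b) := by
  have ha' : α.IsHomogeneous 1 a := by
    rw [CStarGrading.IsHomogeneous, ha, pow_one, neg_one_smul]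
  have h0 := r.comm 1 0 a _ ha' (β.isHomogeneous_even b)
  have h1 := r.comm 1 1 a _ ha' (β.isHomogeneous_odd b)
  rw [mul_zero, pow_zero, one_smul] at h0
  rw [mul_one, pow_one, neg_one_smul] at h1
  rw [← β.even_sub_odd b, map_sub, mul_sub, h0, h1, sub_neg_eq_add, ← add_mul, ← map_add,
    β.even_add_odd]

/-- Normal ordering: an even `a` passes `b` unchanged, while an odd one applies the grading to `b`.
This lets products and adjoints of elementary tensors be rewritten as sums of elementary tensors. -/
theorem GradedCommPair.right_mul_left (r : GradedCommPair α β) (a : A) (b : B) :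
    r.right b * r.left a =
      r.left (α.even a) * r.right b + r.left (α.odd a) * r.right (β.aut b) := by
  rw [← r.right_mul_left_of_even (α.aut_even a), ← r.right_mul_left_of_odd (α.aut_odd a),
    ← mul_add, ← map_add, α.even_add_odd]

theorem PairAlg.ext {x y : PairAlg α β} (h : ∀ r, x.1 r = y.1 r) : x = y :=
  Subtype.ext (funext h)

theorem elemTensor_mul (a a' : A) (b b' : B) :
    elemTensor α β a b * elemTensor α β a' b' =
      elemTensor α β (a * α.even a') (b * b') +
        elemTensor α β (a * α.odd a') (β.aut b * b') := by
  refine PairAlg.ext fun r => ?_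
  change r.left a * r.right b * (r.left a' * r.right b') =
    r.left (a * α.even a') * r.right (b * b') + r.left (a * α.odd a') * r.right (β.aut b * b')
  rw [mul_assoc (r.left a), ← mul_assoc (r.right b), r.right_mul_left, map_mul, map_mul, map_mul,
    map_mul, add_mul, mul_add]
  simp only [mul_assoc]

theorem star_elemTensor (a : A) (b : B) :
    star (elemTensor α β a b) = elemTensor α β (α.even (star a)) (star b) +
        elemTensor α β (α.odd (star a)) (β.aut (star b)) := by
  refine PairAlg.ext fun r => ?_
  change star (r.left a * r.right b) = r.left (α.even (star a)) * r.right (star b) +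
    r.left (α.odd (star a)) * r.right (β.aut (star b))
  rw [← r.right_mul_left, star_mul, map_star, map_star]

theorem smul_elemTensor (c : ℂ) (a : A) (b : B) :
    c • elemTensor α β a b = elemTensor α β (c • a) b := by
  refine PairAlg.ext fun r => ?_
  change c • (r.left a * r.right b) = r.left (c • a) * r.right b
  rw [map_smul, smul_mul_assoc]

variable (α β) in
/-- The set of elementary tensors. -/
def elemTensors : Set (PairAlg α β) := {x | ∃ (a : A) (b : B), x = elemTensor α β a b}

/-- By normal ordering the linear span is already closed under products and adjoints, so finite sums
of elementary tensors are dense in the graded tensor product. -/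
theorem adjoin_elemTensors_le {x : PairAlg α β}
    (hx : x ∈ NonUnitalStarAlgebra.adjoin ℂ (elemTensors α β)) :
    x ∈ Submodule.span ℂ (elemTensors α β) := by
  have hmem : ∀ a b, elemTensor α β a b ∈ Submodule.span ℂ (elemTensors α β) := fun a b =>
    Submodule.subset_span ⟨a, b, rfl⟩
  induction hx using NonUnitalStarAlgebra.adjoin_induction with
  | mem x hx => exact Submodule.subset_span hx
  | add x y _ _ hx hy => exact add_mem hx hy
  | zero => exact zero_mem _
  | mul x y hx' hy' hx hy =>
    clear hx' hy'
    induction hx using Submodule.span_induction with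
    | mem x hx =>
      obtain ⟨a, b, rfl⟩ := hx
      induction hy using Submodule.span_induction with
      | mem y hy =>
        obtain ⟨a', b', rfl⟩ := hy
        rw [elemTensor_mul]
        exact add_mem (hmem _ _) (hmem _ _)
      | zero => rw [mul_zero]; exact zero_mem _
      | add y z _ _ hy hz => rw [mul_add]; exact add_mem hy hz
      | smul c y _ hy => rw [mul_smul_comm]; exact Submodule.smul_mem _ c hy
    | zero => rw [zero_mul]; exact zero_mem _
    | add x z _ _ hx hz => rw [add_mul]; exact add_mem hx hz
    | smul c x _ hx => rw [smul_mul_assoc]; exact Submodule.smul_mem _ c hx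
  | smul c x _ hx => exact Submodule.smul_mem _ c hx
  | star x hx' hx =>
    clear hx'
    induction hx using Submodule.span_induction with
    | mem x hx =>
      obtain ⟨a, b, rfl⟩ := hx
      rw [star_elemTensor]
      exact add_mem (hmem _ _) (hmem _ _)
    | zero => rw [star_zero]; exact zero_mem _
    | add x z _ _ hx hz => rw [star_add]; exact add_mem hx hz
    | smul c x _ hx => rw [star_smul]; exact Submodule.smul_mem _ _ hx

theorem exists_eq_sum_elemTensor {x : PairAlg α β}
    (hx : x ∈ NonUnitalStarAlgebra.adjoin ℂ (elemTensors α β)) :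
    ∃ (k : ℕ) (a : Fin k → A) (b : Fin k → B), x = ∑ i, elemTensor α β (a i) (b i) := by
  obtain ⟨k, c, g, rfl⟩ := Submodule.mem_span_set'.mp (adjoin_elemTensors_le hx)
  choose a b hab using fun i => (g i).2
  exact ⟨k, fun i => c i • a i, b, Finset.sum_congr rfl fun i _ => by
    rw [hab, smul_elemTensor]⟩

/-- Evaluation of a family of operators at a pair of representations. -/
def PairAlg.eval (r : GradedCommPair α β) : PairAlg α β →⋆ₙₐ[ℂ] (r.H →L[ℂ] r.H) where
  toFun x := x.1 r
  map_smul' _ _ := rfl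
  map_zero' := rfl
  map_add' _ _ := rfl
  map_mul' _ _ := rfl
  map_star' _ := rfl

theorem PairAlg.norm_le {x : PairAlg α β} {M : ℝ} (hM : 0 ≤ M)
    (h : ∀ r, ‖PairAlg.eval r x‖ ≤ M) : ‖x‖ ≤ M :=
  lp.norm_le_of_forall_le (E := fun r : GradedCommPair α β => r.H →L[ℂ] r.H) hM h

end ElementaryTensors

/-! ### Bounded families, the common target of both algebras. -/

section BoundedFamilies

variable (Z A : Type*) [NonUnitalCStarAlgebra A]

/-- The C*-algebra of bounded families of elements of a C*-algebra. -/
def BddFamily : Type _ := lp (fun _ : Z => A) ∞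

instance : NonUnitalCStarAlgebra (BddFamily Z A) :=
  inferInstanceAs (NonUnitalCStarAlgebra (lp (fun _ : Z => A) ∞))

variable {Z A}

/-- The value of a family at an index. -/
def BddFamily.eval (z : Z) : BddFamily Z A →⋆ₙₐ[ℂ] A where
  toFun x := x.1 z
  map_smul' _ _ := rfl
  map_zero' := rfl
  map_add' _ _ := rfl
  map_mul' _ _ := rfl
  map_star' _ := rfl

theorem BddFamily.ext {x y : BddFamily Z A}
    (h : ∀ z, BddFamily.eval z x = BddFamily.eval z y) : x = y :=
  Subtype.ext (funext h)

/-- A family of `*`-homomorphisms, as a `*`-homomorphism to the algebra of bounded families. -/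
def BddFamily.ofHoms {D : Type*} [NonUnitalCStarAlgebra D] (f : Z → D →⋆ₙₐ[ℂ] A) :
    D →⋆ₙₐ[ℂ] BddFamily Z A where
  toFun d := ⟨fun z => f z d, memℓp_infty ⟨‖d‖, by
    rintro _ ⟨z, rfl⟩
    exact NonUnitalStarAlgHom.norm_apply_le (f z) d⟩⟩
  map_smul' c d := BddFamily.ext fun z => map_smul (f z) c d
  map_zero' := BddFamily.ext fun z => map_zero (f z)
  map_add' c d := BddFamily.ext fun z => map_add (f z) c d
  map_mul' c d := BddFamily.ext fun z => map_mul (f z) c d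
  map_star' d := BddFamily.ext fun z => map_star (f z) d

/-- The value at a point of bounded continuous functions. -/
def bcfEval {X : Type*} [TopologicalSpace X] (x : X) : (X →ᵇ A) →⋆ₙₐ[ℂ] A where
  toFun F := F x
  map_smul' _ _ := rfl
  map_zero' := rfl
  map_add' _ _ := rfl
  map_mul' _ _ := rfl
  map_star' _ := rfl

end BoundedFamilies

/-! ### The representations at points of `B_n × ℝ₊`, and why they detect the norm. -/

section PointPairs

variable (p : ℝ≥0∞) [Fact (1 ≤ p)] {n : ℕ}

/-- The inclusion of `Cl(ℝ^m)` into the operators on the Fock space, as a `*`-homomorphism of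
nonunital algebras. -/
def opHom (m : ℕ) : Cl m →⋆ₙₐ[ℂ] (Fock m →L[ℂ] Fock m) where
  toFun a := Cl.op a
  map_smul' c a := map_smul Cl.op c a
  map_zero' := map_zero Cl.op
  map_add' a b := map_add Cl.op a b
  map_mul' a b := map_mul Cl.op a b
  map_star' a := map_star Cl.op a

/-- The inclusion `Cl(ℝ^m) ⊆ Cl(ℝ^{m+1})`, as a `*`-homomorphism of nonunital algebras. -/
def clInclHom (m : ℕ) : Cl m →⋆ₙₐ[ℂ] Cl (m + 1) where
  toFun a := clIncl m a
  map_smul' c a := map_smul (clIncl m) c a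
  map_zero' := map_zero (clIncl m)
  map_add' a b := map_add (clIncl m) a b
  map_mul' a b := map_mul (clIncl m) a b
  map_star' a := map_star (clIncl m) a

/-- Evaluation at a point of functions vanishing at infinity. -/
def evalHom {X N : Type*} [TopologicalSpace X] [NonUnitalCStarAlgebra N] (x : X) :
    C₀(X, N) →⋆ₙₐ[ℂ] N where
  toFun f := f x
  map_smul' _ _ := rfl
  map_zero' := rfl
  map_add' _ _ := rfl
  map_mul' _ _ := rfl
  map_star' _ := rfl

theorem evPart_of_odd {f : C₀(ℝ, ℂ)} (hf : lineGrading.aut f = -f) (t : ℝ) : evPart f t = 0 := by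
  have h : f (-t) = -f t := DFunLike.congr_fun hf t
  rw [evPart, h, add_neg_cancel, zero_div]

theorem oddPart_of_even {f : C₀(ℝ, ℂ)} (hf : lineGrading.aut f = f) (t : ℝ) : oddPart f t = 0 := by
  have h : f (-t) = f t := DFunLike.congr_fun hf t
  rw [oddPart, h, sub_self, zero_div]

/-- At `(0, t)` an even function gives a scalar and an odd one a multiple of `e`, and `e` commutes
with `Cl(ℝ^m)` up to the grading. -/
theorem funcCalc_mul_clIncl {m : ℕ} {i j : ℕ} {a : C₀(ℝ, ℂ)} {b : Cl m}
    (ha : lineGrading.IsHomogeneous i a) (hb : (cliffordGrading m).IsHomogeneous j b) {t : ℝ}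
    (ht : 0 ≤ t) :
    funcCalc a (snocVec 0 t) * clIncl m b =
      (-1 : ℂ) ^ (i * j) • (clIncl m b * funcCalc a (snocVec 0 t)) := by
  rw [funcCalc_last a ht]
  rw [CStarGrading.IsHomogeneous] at ha hb
  rcases Nat.even_or_odd i with hi | hi
  · rw [hi.neg_one_pow, one_smul] at ha
    rw [oddPart_of_even ha, (hi.mul_right j).neg_one_pow, zero_smul, add_zero, one_smul,
      smul_one_mul, mul_smul_one]
  · rw [hi.neg_one_pow, neg_one_smul] at ha
    rw [evPart_of_odd ha, zero_smul, zero_add, smul_mul_assoc, clLast_mul_clIncl, hb, map_smul,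
      pow_mul, hi.neg_one_pow, smul_mul_assoc, mul_smul_comm, smul_comm]

theorem funcCalc_mul_clIncl_eq {m : ℕ} (a : C₀(ℝ, ℂ)) (b : Cl m) {t : ℝ} (ht : 0 ≤ t) :
    funcCalc a (snocVec 0 t) * clIncl m b =
      clIncl m (evPart a t • b) + clLast m * clIncl m (oddPart a t • b) := by
  rw [funcCalc_last a ht, add_mul, map_smul, map_smul, smul_one_mul, smul_mul_assoc,
    mul_smul_comm]

/-- The pair of representations at a point of `B_n × ℝ₊`. -/
def pointPair (z : Bn p n × ℝ≥0) : GradedCommPair lineGrading (algCGrading p n) where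
  H := Fock (n + 2)
  left := (opHom (n + 2)).comp (funcCalcHom (snocVec (0 : Hn n) z.2))
  right := (opHom (n + 2)).comp ((clInclHom (n + 1)).comp (evalHom z.1))
  comm := by
    intro i j a b ha hb
    have hb' : (cliffordGrading (n + 1)).IsHomogeneous j (b z.1) := DFunLike.congr_fun hb z.1
    have h := congrArg (opHom (n + 2)) (funcCalc_mul_clIncl ha hb' z.2.2)
    rw [map_mul, map_smul, map_mul] at h
    exact h

theorem pointPair_left_mul_right (z : Bn p n × ℝ≥0) (a : C₀(ℝ, ℂ)) (b : C₀(Bn p n, Cl (n + 1))) :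
    PairAlg.eval (pointPair p z) (elemTensor _ _ a b) =
      Cl.op (clIncl (n + 1) (evPart a z.2 • b z.1) +
        clLast (n + 1) * clIncl (n + 1) (oddPart a z.2 • b z.1)) := by
  have h := congrArg (opHom (n + 2)) (funcCalc_mul_clIncl_eq a (b z.1) z.2.2)
  rw [map_mul] at h
  exact h

theorem GradedCommPair.left_mul_right_of_even {A B : Type u} [NonUnitalCStarAlgebra A]
    [NonUnitalCStarAlgebra B] {α : CStarGrading A} {β : CStarGrading B} (r : GradedCommPair α β)
    (a : A) {b : B} (hb : β.aut b = b) : r.left a * r.right b = r.right b * r.left a := by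
  rw [r.right_mul_left, hb, ← add_mul, ← map_add, α.even_add_odd]

/-- Scalar functions are even, so they commute with `𝓢` in every pair. This is the only commutation
that the norm estimate requires. -/
theorem GradedCommPair.left_mul_scalar (r : GradedCommPair lineGrading (algCGrading p n))
    (a : C₀(ℝ, ℂ)) (g : C₀(Bn p n, ℂ)) :
    r.left a * r.right (constSMul g 1) = r.right (constSMul g 1) * r.left a := by
  have h : (algCGrading p n).aut (constSMul g 1) = constSMul g 1 := by
    refine ZeroAtInftyContinuousMap.ext fun x => ?_
    have h1 : (cliffordGrading (n + 1)).aut (g x • 1) = g x • 1 := by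
      rw [map_smul, cliffordGrading_one]
    exact h1
  exact r.left_mul_right_of_even a h

theorem evPart_add_oddPart (f : C₀(ℝ, ℂ)) (t : ℝ) : evPart f t + oddPart f t = f t := by
  rw [evPart, oddPart]; ring

theorem evPart_sub_oddPart (f : C₀(ℝ, ℂ)) (t : ℝ) : evPart f t - oddPart f t = f (-t) := by
  rw [evPart, oddPart]; ring

/-- The families of operators on the Fock space, indexed by `B_n × ℝ₊`. -/
abbrev OpFamily (n : ℕ) : Type :=
  BddFamily (Bn p n × ℝ≥0) (Fock (n + 2) →L[ℂ] Fock (n + 2))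

/-- The value of a family of operators at the pair of a point of `B_n × ℝ₊`. -/
def evalPoint (z : Bn p n × ℝ≥0) : PairAlg lineGrading (algCGrading p n) →⋆ₙₐ[ℂ]
    (Fock (n + 2) →L[ℂ] Fock (n + 2)) := PairAlg.eval (pointPair p z)

theorem evalPoint_elemTensor (z : Bn p n × ℝ≥0) (a : C₀(ℝ, ℂ)) (b : C₀(Bn p n, Cl (n + 1))) :
    evalPoint p z (elemTensor _ _ a b) =
      Cl.op (clIncl (n + 1) (evPart a z.2 • b z.1) +
        clLast (n + 1) * clIncl (n + 1) (oddPart a z.2 • b z.1)) :=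
  pointPair_left_mul_right p z a b

/-- The restriction of families of operators to the pairs at the points of `B_n × ℝ₊`. -/
def restrictPoints (n : ℕ) : PairAlg lineGrading (algCGrading p n) →⋆ₙₐ[ℂ] OpFamily p n :=
  BddFamily.ofHoms (evalPoint p)

/-- Bounded continuous Clifford algebra valued functions, as families of operators. -/
def functionFamily (n : ℕ) : ((Bn p n × ℝ≥0) →ᵇ Cl (n + 2)) →⋆ₙₐ[ℂ] OpFamily p n :=
  BddFamily.ofHoms fun z => (opHom (n + 2)).comp (bcfEval z)

theorem functionFamily_apply (F : (Bn p n × ℝ≥0) →ᵇ Cl (n + 2)) (z : Bn p n × ℝ≥0) :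
    BddFamily.eval z (functionFamily p n F) = Cl.op (F z) := rfl

theorem functionFamily_injective : Function.Injective (functionFamily p n) := by
  intro F G h
  refine BoundedContinuousFunction.ext fun z => Cl.ext ?_
  rw [← functionFamily_apply, h, functionFamily_apply]

/-- The operator at `(x, |s|)` has the form `c + e d`, where `c` and `d` collect the even and the
odd parts of the `aᵢ`. The value at `(s, x)` is `c + d` or `c - d` according to the sign of `s`,
whence the factor `2`. -/
theorem norm_sum_smul_le {k : ℕ} (a : Fin k → C₀(ℝ, ℂ)) (b : Fin k → C₀(Bn p n, Cl (n + 1)))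
    {M : ℝ} (h : ∀ z : Bn p n × ℝ≥0, ‖evalPoint p z (∑ i, elemTensor _ _ (a i) (b i))‖ ≤ M)
    (s : ℝ) (x : Bn p n) : ‖∑ i, a i s • b i x‖ ≤ 2 * M := by
  have key : ∀ t : ℝ≥0, ‖∑ i, evPart (a i) t • b i x‖ ≤ M ∧ ‖∑ i, oddPart (a i) t • b i x‖ ≤ M := by
    intro t
    have h1 := h (x, t)
    have h2 : evalPoint p (x, t) (∑ i, elemTensor _ _ (a i) (b i)) =
        Cl.op (clIncl (n + 1) (∑ i, evPart (a i) t • b i x) +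
        clLast (n + 1) * clIncl (n + 1) (∑ i, oddPart (a i) t • b i x)) := by
      rw [map_sum, map_sum, map_sum, Finset.mul_sum, ← Finset.sum_add_distrib, map_sum]
      exact Finset.sum_congr rfl fun i _ => evalPoint_elemTensor p (x, t) (a i) (b i)
    rw [h2, ← Cl.norm_eq] at h1
    exact ⟨(norm_left_le _ _).trans h1, (norm_right_le _ _).trans h1⟩
  rcases le_total 0 s with hs | hs
  · obtain ⟨h1, h2⟩ := key ⟨s, hs⟩
    have h3 : ∑ i, a i s • b i x =
        ∑ i, evPart (a i) s • b i x + ∑ i, oddPart (a i) s • b i x := by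
      rw [← Finset.sum_add_distrib]
      exact Finset.sum_congr rfl fun i _ => by rw [← add_smul, evPart_add_oddPart]
    rw [h3]
    exact (norm_add_le _ _).trans (by rw [two_mul]; exact add_le_add h1 h2)
  · obtain ⟨h1, h2⟩ := key ⟨-s, neg_nonneg.mpr hs⟩
    have h3 : ∑ i, a i s • b i x =
        ∑ i, evPart (a i) (-s) • b i x - ∑ i, oddPart (a i) (-s) • b i x := by
      rw [← Finset.sum_sub_distrib]
      exact Finset.sum_congr rfl fun i _ => by rw [← sub_smul, evPart_sub_oddPart, neg_neg]
    rw [h3]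
    exact (norm_sub_le _ _).trans (by rw [two_mul]; exact add_le_add h1 h2)

variable (n) in
/-- On the graded tensor product, the norm is detected, up to a constant, by the pairs at the
points of `B_n × ℝ₊`. -/
theorem exists_norm_le_restrictPoints :
    ∃ C : ℝ, ∀ y ∈ gradedTensorSub lineGrading (algCGrading p n),
      ‖y‖ ≤ C * ‖restrictPoints p n y‖ := by
  obtain ⟨C, hC, hbound⟩ := exists_norm_sum_mul_le ℝ (Bn p n) (Cl (n + 1))
  -- `C` comes from the unitary basis and `2` from the even and odd parts. The inequality is a
  -- closed condition, so finite sums of elementary tensors suffice.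
  refine ⟨C * 2, fun y hy => ?_⟩
  have hcl : IsClosed {y : PairAlg lineGrading (algCGrading p n) |
      ‖y‖ ≤ C * 2 * ‖restrictPoints p n y‖} :=
    isClosed_le continuous_norm
      (continuous_const.mul (map_continuous (restrictPoints p n)).norm)
  have hy' : y ∈ closure (NonUnitalStarAlgebra.adjoin ℂ
    (elemTensors lineGrading (algCGrading p n)) : Set (PairAlg lineGrading (algCGrading p n))) := hy
  refine closure_minimal (fun x hx => ?_) hcl hy'
  obtain ⟨k, a, b, rfl⟩ := exists_eq_sum_elemTensor hx
  have hz : ∀ z : Bn p n × ℝ≥0, ‖evalPoint p z (∑ i, elemTensor _ _ (a i) (b i))‖ ≤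
      ‖restrictPoints p n (∑ i, elemTensor _ _ (a i) (b i))‖ := fun z =>
    NonUnitalStarAlgHom.norm_apply_le (BddFamily.eval z)
      (restrictPoints p n (∑ i, elemTensor _ _ (a i) (b i)))
  refine PairAlg.norm_le (by positivity) fun r => ?_
  rw [map_sum]
  have := hbound (r.H →L[ℂ] r.H) r.left r.right (r.left_mul_scalar p) (Fin k) Finset.univ a b
    _ (by positivity) (fun s x => norm_sum_smul_le p a b hz s x)
  rw [mul_assoc]
  exact this

end PointPairs

/-! ### Functions of the form `k(y) c`, and subalgebras containing them. -/

section ScalarMultiples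

open Filter Topology

variable {X Y : Type*} [TopologicalSpace X] [TopologicalSpace Y]

/-- The function `(x, y) ↦ f(x) g(y)`. -/
def prodC0 (f : C₀(X, ℂ)) (g : C₀(Y, ℂ)) : C₀(X × Y, ℂ) where
  toFun z := f z.1 * g z.2
  continuous_toFun := ((map_continuous f).comp continuous_fst).mul
    ((map_continuous g).comp continuous_snd)
  zero_at_infty' := by
    have h1 : Tendsto (fun z : X × Y => f z.1 * g z.2) (Filter.comap Prod.fst (cocompact X))
        (𝓝 0) := by
      have h : Tendsto (fun z : X × Y => ‖f z.1‖ * ‖g‖) (Filter.comap Prod.fst (cocompact X))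
          (𝓝 0) := by
        have := (f.zero_at_infty'.comp (tendsto_comap (f := (Prod.fst : X × Y → X)))).norm.mul_const ‖g‖
        simpa using this
      refine squeeze_zero_norm (fun z => ?_) h
      rw [norm_mul]
      exact mul_le_mul_of_nonneg_left (norm_apply_le_norm g _) (norm_nonneg _)
    have h2 : Tendsto (fun z : X × Y => f z.1 * g z.2) (Filter.comap Prod.snd (cocompact Y))
        (𝓝 0) := by
      have h : Tendsto (fun z : X × Y => ‖f‖ * ‖g z.2‖) (Filter.comap Prod.snd (cocompact Y))
          (𝓝 0) := by
        have := (g.zero_at_infty'.comp (tendsto_comap (f := (Prod.snd : X × Y → Y)))).norm.const_mul ‖f‖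
        simpa using this
      refine squeeze_zero_norm (fun z => ?_) h
      rw [norm_mul]
      exact mul_le_mul_of_nonneg_right (norm_apply_le_norm f _) (norm_nonneg _)
    rw [← Filter.coprod_cocompact]
    exact h1.sup h2

theorem prodC0_apply (f : C₀(X, ℂ)) (g : C₀(Y, ℂ)) (z : X × Y) :
    prodC0 f g z = f z.1 * g z.2 := rfl

variable {N : Type*} [CStarAlgebra N]

/-- The function `y ↦ k(y) c`, as a bounded continuous function. -/
def constMul (k : C₀(Y, ℂ)) (c : N) : Y →ᵇ N := (constSMul k c).toBCF

theorem constMul_apply (k : C₀(Y, ℂ)) (c : N) (y : Y) : constMul k c y = k y • c := rfl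

theorem constMul_mul (k k' : C₀(Y, ℂ)) (c c' : N) :
    constMul k c * constMul k' c' = constMul (k * k') (c * c') := by
  refine BoundedContinuousFunction.ext fun y => ?_
  exact smul_mul_smul_comm _ _ _ _

theorem star_constMul (k : C₀(Y, ℂ)) (c : N) : star (constMul k c) = constMul (star k) (star c) := by
  refine BoundedContinuousFunction.ext fun y => ?_
  exact star_smul _ _

theorem constMul_add_left (k k' : C₀(Y, ℂ)) (c : N) :
    constMul (k + k') c = constMul k c + constMul k' c :=
  BoundedContinuousFunction.ext fun y => add_smul (k y) (k' y) c

theorem constMul_smul_left (a : ℂ) (k : C₀(Y, ℂ)) (c : N) :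
    constMul (a • k) c = a • constMul k c :=
  BoundedContinuousFunction.ext fun y => smul_assoc a (k y) c

theorem norm_constMul_le (k : C₀(Y, ℂ)) (c : N) : ‖constMul k c‖ ≤ ‖k‖ * ‖c‖ := by
  refine (BoundedContinuousFunction.norm_le (by positivity)).mpr fun y => ?_
  rw [constMul_apply, norm_smul]
  exact mul_le_mul_of_nonneg_right (norm_apply_le_norm k y) (norm_nonneg _)

theorem continuous_constMul_left (c : N) :
    Continuous fun k : C₀(Y, ℂ) => (constMul k c : Y →ᵇ N) := by
  let L : C₀(Y, ℂ) →ₗ[ℂ] (Y →ᵇ N) :=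
    { toFun := fun k => constMul k c
      map_add' := fun k k' => constMul_add_left k k' c
      map_smul' := fun a k => constMul_smul_left a k c }
  exact (L.mkContinuous ‖c‖ fun k => (norm_constMul_le k c).trans_eq (mul_comm _ _)).continuous

theorem continuous_constMul_right (k : C₀(Y, ℂ)) :
    Continuous fun c : N => (constMul k c : Y →ᵇ N) := by
  let L : N →ₗ[ℂ] (Y →ᵇ N) :=
    { toFun := fun c => constMul k c
      map_add' := fun c c' => BoundedContinuousFunction.ext fun y => smul_add (k y) c c'
      map_smul' := fun a c => BoundedContinuousFunction.ext fun y => smul_comm (k y) a c }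
  exact (L.mkContinuous ‖k‖ fun c => norm_constMul_le k c).continuous

variable [T2Space Y] (T : NonUnitalStarSubalgebra ℂ (Y →ᵇ N))

theorem constMul_one_mem [LocallyCompactSpace Y] (hT : IsClosed (T : Set (Y →ᵇ N))) {G : Set C₀(Y, ℂ)}
    (hG : ∀ g ∈ G, constMul g (1 : N) ∈ T) (h0 : ∀ x, ∃ f ∈ G, f x ≠ 0)
    (hs : ∀ x y, x ≠ y → ∃ f ∈ G, f x ≠ f y) (k : C₀(Y, ℂ)) : constMul k (1 : N) ∈ T := by
  let A : NonUnitalStarSubalgebra ℂ C₀(Y, ℂ) :=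
    { carrier := {k | constMul k (1 : N) ∈ T}
      mul_mem' := fun {a b} ha hb => by
        have : constMul (a * b) (1 : N) = constMul a 1 * constMul b 1 := by
          rw [constMul_mul, mul_one]
        exact (congrArg (· ∈ T) this).mpr (mul_mem ha hb)
      add_mem' := fun {a b} ha hb =>
        (congrArg (· ∈ T) (constMul_add_left a b (1 : N))).mpr (add_mem ha hb)
      zero_mem' := by
        have : constMul (0 : C₀(Y, ℂ)) (1 : N) = 0 :=
          BoundedContinuousFunction.ext fun y => zero_smul ℂ (1 : N)
        exact (congrArg (· ∈ T) this).mpr (zero_mem T)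
      smul_mem' := fun c a ha =>
        (congrArg (· ∈ T) (constMul_smul_left c a (1 : N))).mpr (SMulMemClass.smul_mem c ha)
      star_mem' := fun {a} ha => by
        have : constMul (star a) (1 : N) = star (constMul a 1) := by
          rw [star_constMul, star_one]
        exact (congrArg (· ∈ T) this).mpr (star_mem ha) }
  refine mem_of_separatesPoints A (hT.preimage (continuous_constMul_left 1)) (fun x => ?_)
    (fun x y hxy => ?_) k
  · obtain ⟨f, hf, hfx⟩ := h0 x
    exact ⟨f, hG f hf, hfx⟩
  · obtain ⟨f, hf, hfx⟩ := hs x y hxy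
    exact ⟨f, hG f hf, hfx⟩

/-- Once `T` contains all scalar functions, the coefficients of `c` form a closed ideal, so only the
zeros of the known coefficient `g` matter. -/
theorem constMul_mem_of_vanishing (hT : IsClosed (T : Set (Y →ᵇ N)))
    (h1 : ∀ k, constMul k (1 : N) ∈ T) {g : C₀(Y, ℂ)} {c : N}
    (hg : constMul g c ∈ T) {f : C₀(Y, ℂ)} (hf : ∀ x, g x = 0 → f x = 0) : constMul f c ∈ T := by
  refine mem_of_forall_mul_mem {k | constMul k c ∈ T} (hT.preimage (continuous_constMul_left c)) g
    (fun k => ?_) f hf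
  have : constMul (k * g) c = constMul k (1 : N) * constMul g c := by rw [constMul_mul, one_mul]
  exact (congrArg (· ∈ T) this).mpr (mul_mem (h1 k) hg)

end ScalarMultiples

/-! ### Gaussians as generators of `C₀(ℝ)`. -/

section Gaussians

open Filter Topology

theorem abs_mul_exp_neg_sq_le (s : ℝ) : |s| * Real.exp (-s ^ 2) ≤ Real.exp (-(s ^ 2 / 2)) := by
  have h1 : |s| ≤ Real.exp (s ^ 2 / 2) := by
    refine le_trans ?_ (Real.add_one_le_exp _)
    nlinarith [sq_nonneg (|s| - 1), sq_abs s]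
  calc |s| * Real.exp (-s ^ 2) ≤ Real.exp (s ^ 2 / 2) * Real.exp (-s ^ 2) :=
        mul_le_mul_of_nonneg_right h1 (Real.exp_nonneg _)
    _ = _ := by rw [← Real.exp_add]; congr 1; ring

theorem tendsto_exp_neg_mul_sq {ι : Type*} {ψ : ι → ℝ} {l : Filter ι} (hψ : Tendsto ψ l atTop) {c : ℝ}
    (hc : 0 < c) : Tendsto (fun x => Real.exp (-(ψ x ^ 2 * c))) l (𝓝 0) := by
  refine Real.tendsto_exp_neg_atTop_nhds_zero.comp ?_
  exact ((tendsto_pow_atTop two_ne_zero).comp hψ).atTop_mul_const hc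

variable {X : Type*} [TopologicalSpace X]

/-- The function `x ↦ l(x) exp(-ψ(x)²)`. -/
def gaussMul (ψ l : X → ℝ) (hψ : Continuous ψ) (hl : Continuous l) (h : Tendsto ψ (cocompact X) atTop)
    (hle : ∀ x, |l x| ≤ |ψ x|) : C₀(X, ℂ) where
  toFun x := ((l x * Real.exp (-ψ x ^ 2) : ℝ) : ℂ)
  continuous_toFun := by fun_prop
  zero_at_infty' := by
    refine squeeze_zero_norm (fun x => ?_) (tendsto_exp_neg_mul_sq h (c := 2⁻¹) (by norm_num))
    rw [Complex.norm_real, Real.norm_eq_abs, abs_mul, Real.abs_exp]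
    refine (mul_le_mul_of_nonneg_right (hle x) (Real.exp_nonneg _)).trans ?_
    refine (abs_mul_exp_neg_sq_le (ψ x)).trans_eq ?_
    rw [div_eq_mul_inv]

/-- The function `x ↦ exp(-ψ(x)²)`. -/
def gauss (ψ : X → ℝ) (hψ : Continuous ψ) (h : Tendsto ψ (cocompact X) atTop) : C₀(X, ℂ) where
  toFun x := ((Real.exp (-ψ x ^ 2) : ℝ) : ℂ)
  continuous_toFun := by fun_prop
  zero_at_infty' := by
    refine squeeze_zero_norm (fun x => ?_) (tendsto_exp_neg_mul_sq h (c := 1) one_pos)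
    rw [Complex.norm_real, Real.norm_eq_abs, Real.abs_exp, mul_one]

/-- The function `t ↦ exp(-t²)` on the line. -/
def gaussLine : C₀(ℝ, ℂ) := gauss (fun t => ‖t‖) continuous_norm (tendsto_norm_cocompact_atTop)

/-- The function `t ↦ t exp(-t²)` on the line. -/
def gaussLineOdd : C₀(ℝ, ℂ) := gaussMul (fun t => ‖t‖) (fun t => t) continuous_norm continuous_id
  (tendsto_norm_cocompact_atTop) (fun t => by simp)

theorem gaussLine_apply (t : ℝ) : gaussLine t = ((Real.exp (-t ^ 2) : ℝ) : ℂ) := by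
  change ((Real.exp (-‖t‖ ^ 2) : ℝ) : ℂ) = _
  rw [Real.norm_eq_abs, sq_abs]

theorem gaussLineOdd_apply (t : ℝ) : gaussLineOdd t = ((t * Real.exp (-t ^ 2) : ℝ) : ℂ) := by
  change ((t * Real.exp (-‖t‖ ^ 2) : ℝ) : ℂ) = _
  rw [Real.norm_eq_abs, sq_abs]

theorem evPart_gaussLine (t : ℝ) : evPart gaussLine t = ((Real.exp (-t ^ 2) : ℝ) : ℂ) := by
  rw [evPart, gaussLine_apply, gaussLine_apply, neg_sq]; ring

theorem oddPart_gaussLine (t : ℝ) : oddPart gaussLine t = 0 := by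
  rw [oddPart, gaussLine_apply, gaussLine_apply, neg_sq]; ring

theorem evPart_gaussLineOdd (t : ℝ) : evPart gaussLineOdd t = 0 := by
  rw [evPart, gaussLineOdd_apply, gaussLineOdd_apply, neg_sq]; push_cast; ring

theorem oddPart_gaussLineOdd (t : ℝ) :
    oddPart gaussLineOdd t = ((t * Real.exp (-t ^ 2) : ℝ) : ℂ) := by
  rw [oddPart, gaussLineOdd_apply, gaussLineOdd_apply, neg_sq]; push_cast; ring

theorem funcCalc_gaussLine {m : ℕ} (v : EuclideanSpace ℝ (Fin m)) :
    funcCalc gaussLine v = ((Real.exp (-‖v‖ ^ 2) : ℝ) : ℂ) • (1 : Cl m) := by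
  rw [funcCalc, evPart_gaussLine, oddPart_gaussLine]
  simp

/-- The factor `t` in `t exp(-t²)` cancels the normalisation `1 / ‖v‖`, leaving an expression linear
in `v` up to the Gaussian. -/
theorem funcCalc_gaussLineOdd {m : ℕ} (v : EuclideanSpace ℝ (Fin m)) :
    funcCalc gaussLineOdd v = ((Real.exp (-‖v‖ ^ 2) : ℝ) : ℂ) • vec v := by
  rw [funcCalc, evPart_gaussLineOdd, oddPart_gaussLineOdd, zero_smul, zero_add]
  split_ifs with h
  · have h0 : vec v = 0 := by
      rw [h, vec_eq_sum]
      simp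
    rw [h0, smul_zero]
  · rw [smul_smul, ← Complex.ofReal_mul]
    have h0 : ‖v‖ ≠ 0 := norm_ne_zero_iff.mpr h
    congr 2
    field_simp

/-- The functions `exp(-t²)` and `t exp(-t²)` generate `C₀(ℝ)`. -/
theorem mem_of_gaussLine_mem (A : NonUnitalStarSubalgebra ℂ C₀(ℝ, ℂ))
    (hA : IsClosed (A : Set C₀(ℝ, ℂ))) (h0 : gaussLine ∈ A) (h1 : gaussLineOdd ∈ A)
    (f : C₀(ℝ, ℂ)) : f ∈ A := by
  have hne : ∀ x, gaussLine x ≠ 0 := fun x => by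
    rw [gaussLine_apply]
    exact Complex.ofReal_ne_zero.mpr (Real.exp_ne_zero _)
  refine mem_of_separatesPoints A hA (fun x => ⟨_, h0, hne x⟩) (fun x y hxy => ?_) f
  by_contra hcon
  push Not at hcon
  have e0 := hcon _ h0
  have e1 := hcon _ h1
  rw [gaussLine_apply, gaussLine_apply, Complex.ofReal_inj] at e0
  rw [gaussLineOdd_apply, gaussLineOdd_apply, Complex.ofReal_inj, e0] at e1
  exact hxy (mul_right_cancel₀ (Real.exp_ne_zero _) e1)

/-- The restriction of the even part of a function on the line to `ℝ₊`. -/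
def evHalf (f : C₀(ℝ, ℂ)) : C₀(ℝ≥0, ℂ) where
  toFun t := evPart f t
  continuous_toFun := (continuous_evPart f).comp NNReal.continuous_coe
  zero_at_infty' := by
    have h0 : Tendsto (fun t : ℝ≥0 => (t : ℝ)) (cocompact ℝ≥0) (cocompact ℝ) :=
      NNReal.isClosedEmbedding_coe.tendsto_cocompact
    have h1 := f.zero_at_infty'.comp h0
    have h2 := (lineGrading.aut f).zero_at_infty'.comp h0
    have h3 := (h1.add h2).div_const 2
    rw [add_zero, zero_div] at h3
    exact h3

/-- The restriction of the odd part of a function on the line to `ℝ₊`. -/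
def oddHalf (f : C₀(ℝ, ℂ)) : C₀(ℝ≥0, ℂ) where
  toFun t := oddPart f t
  continuous_toFun := (continuous_oddPart f).comp NNReal.continuous_coe
  zero_at_infty' := by
    have h0 : Tendsto (fun t : ℝ≥0 => (t : ℝ)) (cocompact ℝ≥0) (cocompact ℝ) :=
      NNReal.isClosedEmbedding_coe.tendsto_cocompact
    have h1 := f.zero_at_infty'.comp h0
    have h2 := (lineGrading.aut f).zero_at_infty'.comp h0
    have h3 := (h1.sub h2).div_const 2
    rw [sub_zero, zero_div] at h3
    exact h3

end Gaussians

/-! ### Norm, properness and coordinates of the extended Mazur map. -/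

section MazurMap

open Filter Topology

variable (p : ℝ≥0∞) [Fact (1 ≤ p)] {n : ℕ}

theorem toReal_pos_of_ne_top {p : ℝ≥0∞} [Fact (1 ≤ p)] (hp : p ≠ ∞) : 0 < p.toReal :=
  ENNReal.toReal_pos (zero_lt_one.trans_le Fact.out).ne' hp

theorem abs_sign_mul_rpow {q : ℝ} (hq : 0 < q) (s : ℝ) : |Real.sign s * |s| ^ q| = |s| ^ q := by
  rw [abs_mul, abs_of_nonneg (Real.rpow_nonneg (abs_nonneg s) q)]
  rcases lt_trichotomy s 0 with h | rfl | h
  · rw [Real.sign_of_neg h]; simp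
  · simp [Real.zero_rpow hq.ne']
  · rw [Real.sign_of_pos h]; simp

/-- The coordinates have absolute value `|xᵢ|^{p/2}`, so their squares sum to `∑ |xᵢ|^p`. Hence the
map is proper, and its Gaussians depend only on the distance to the centre. -/
theorem norm_mazurExt_sq (hp : p ≠ ∞) (x : Bn p n) : ‖mazurExt p x‖ ^ 2 = ‖x‖ ^ p.toReal := by
  have hP := toReal_pos_of_ne_top hp
  rw [EuclideanSpace.real_norm_sq_eq, PiLp.norm_eq_sum hP, ← Real.rpow_mul (by positivity),
    one_div, inv_mul_cancel₀ hP.ne', Real.rpow_one]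
  refine Finset.sum_congr rfl fun i _ => ?_
  rw [mazurExt_apply, ← sq_abs, abs_sign_mul_rpow (half_pos hP), ← Real.rpow_natCast,
    ← Real.rpow_mul (abs_nonneg _), Real.norm_eq_abs]
  congr 1
  push_cast
  ring

theorem tendsto_norm_mazurExt (hp : p ≠ ∞) (x₀ : Bn p n) :
    Tendsto (fun x : Bn p n => ‖mazurExt p (x - x₀)‖) (cocompact (Bn p n)) atTop := by
  have hP := toReal_pos_of_ne_top hp
  have h0 : ∀ x : Bn p n, ‖mazurExt p (x - x₀)‖ = ‖x - x₀‖ ^ (p.toReal / 2) := fun x => by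
    have h := norm_mazurExt_sq p hp (x - x₀)
    rw [← sq_eq_sq₀ (norm_nonneg _) (by positivity), h, ← Real.rpow_natCast,
      ← Real.rpow_mul (norm_nonneg _)]
    congr 1
    push_cast
    ring
  simp only [h0]
  refine (tendsto_rpow_atTop (half_pos hP)).comp ?_
  exact tendsto_norm_cocompact_atTop.comp
    (Homeomorph.subRight x₀).isClosedEmbedding.tendsto_cocompact

theorem continuous_mazurExt_sub (hp : p ≠ ∞) (x₀ : Bn p n) :
    Continuous fun x : Bn p n => mazurExt p (x - x₀) :=
  (continuous_mazurExt p hp).comp (continuous_id.sub continuous_const)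

/-- Signed powers separate points at distance one. -/
theorem signedPow_ne {q : ℝ} (hq : 0 < q) (s : ℝ) :
    Real.sign s * |s| ^ q ≠ Real.sign (s - 1) * |s - 1| ^ q := by
  intro h
  have h1 := congrArg abs h
  rw [abs_sign_mul_rpow hq, abs_sign_mul_rpow hq] at h1
  have h2 := (Real.rpow_left_inj (abs_nonneg _) (abs_nonneg _) hq.ne').mp h1
  -- Equal absolute values of `s` and `s - 1` leave only the midpoint, where the signs differ.
  have h3 : s = 1 / 2 := by
    rcases abs_eq_abs.mp h2 with h3 | h3 <;> linarith
  rw [h3, Real.sign_of_pos (by norm_num), Real.sign_of_neg (by norm_num)] at h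
  have h4 : 0 < |(1 / 2 : ℝ)| ^ q := by positivity
  have h5 : 0 < |(1 / 2 - 1 : ℝ)| ^ q := Real.rpow_pos_of_pos (by norm_num) q
  linarith

end MazurMap

/-! ### Which functions `𝒜(B_n)` contains. -/

section BottGenerators

variable {p : ℝ≥0∞} [Fact (1 ≤ p)] (hp : p ≠ ∞) {n : ℕ}

/-- The function `x ↦ exp(-‖φ(x - x₀)‖²)`. -/
def gaussB (x₀ : Bn p n) : C₀(Bn p n, ℂ) :=
  gauss (fun x => ‖mazurExt p (x - x₀)‖) (continuous_mazurExt_sub p hp x₀).norm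
    (tendsto_norm_mazurExt p hp x₀)

/-- The function `x ↦ φ(x - x₀)ᵢ exp(-‖φ(x - x₀)‖²)`. -/
def gaussCoord (x₀ : Bn p n) (i : Fin (n + 1)) : C₀(Bn p n, ℂ) :=
  gaussMul (fun x => ‖mazurExt p (x - x₀)‖) (fun x => mazurExt p (x - x₀) i)
    (continuous_mazurExt_sub p hp x₀).norm
    (by have := continuous_mazurExt_sub p hp x₀; fun_prop) (tendsto_norm_mazurExt p hp x₀)
    (fun x => by
      rw [abs_norm]
      exact PiLp.norm_apply_le (mazurExt p (x - x₀)) i)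

/-- The function `(x, t) ↦ exp(-‖φ(x - x₀)‖²) exp(-t²)`. -/
def bump (x₀ : Bn p n) : C₀(Bn p n × ℝ≥0, ℂ) := prodC0 (gaussB hp x₀) (evHalf gaussLine)

/-- The function `(x, t) ↦ φ(x - x₀)ᵢ exp(-‖φ(x - x₀)‖²) exp(-t²)`. -/
def bumpCoord (x₀ : Bn p n) (i : Fin (n + 1)) : C₀(Bn p n × ℝ≥0, ℂ) :=
  prodC0 (gaussCoord hp x₀ i) (evHalf gaussLine)

/-- The function `(x, t) ↦ t exp(-‖φ(x - x₀)‖²) exp(-t²)`. -/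
def bumpLast (x₀ : Bn p n) : C₀(Bn p n × ℝ≥0, ℂ) :=
  prodC0 (gaussB hp x₀) (oddHalf gaussLineOdd)

theorem bump_apply (x₀ : Bn p n) (z : Bn p n × ℝ≥0) :
    bump hp x₀ z = ((Real.exp (-(‖mazurExt p (z.1 - x₀)‖ ^ 2 + (z.2 : ℝ) ^ 2)) : ℝ) : ℂ) := by
  change ((Real.exp (-‖mazurExt p (z.1 - x₀)‖ ^ 2) : ℝ) : ℂ) * evPart gaussLine z.2 = _
  rw [evPart_gaussLine, ← Complex.ofReal_mul, ← Real.exp_add, neg_add]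

theorem bumpCoord_apply (x₀ : Bn p n) (i : Fin (n + 1)) (z : Bn p n × ℝ≥0) :
    bumpCoord hp x₀ i z = bump hp x₀ z * (mazurExt p (z.1 - x₀) i : ℂ) := by
  change ((mazurExt p (z.1 - x₀) i * Real.exp (-‖mazurExt p (z.1 - x₀)‖ ^ 2) : ℝ) : ℂ) *
    evPart gaussLine z.2 = ((Real.exp (-‖mazurExt p (z.1 - x₀)‖ ^ 2) : ℝ) : ℂ) *
    evPart gaussLine z.2 * (mazurExt p (z.1 - x₀) i : ℂ)
  rw [Complex.ofReal_mul]
  ring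

theorem bumpLast_apply (x₀ : Bn p n) (z : Bn p n × ℝ≥0) :
    bumpLast hp x₀ z = bump hp x₀ z * ((z.2 : ℝ) : ℂ) := by
  change ((Real.exp (-‖mazurExt p (z.1 - x₀)‖ ^ 2) : ℝ) : ℂ) * oddPart gaussLineOdd z.2 =
    ((Real.exp (-‖mazurExt p (z.1 - x₀)‖ ^ 2) : ℝ) : ℂ) *
    evPart gaussLine z.2 * ((z.2 : ℝ) : ℂ)
  rw [oddPart_gaussLineOdd, evPart_gaussLine, Complex.ofReal_mul]
  ring

theorem bump_ne_zero (x₀ : Bn p n) (z : Bn p n × ℝ≥0) : bump hp x₀ z ≠ 0 := by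
  rw [bump_apply]
  exact Complex.ofReal_ne_zero.mpr (Real.exp_ne_zero _)

theorem norm_cliffordOp_sq (x₀ : Bn p n) (z : Bn p n × ℝ≥0) :
    ‖cliffordOp p x₀ z‖ ^ 2 = ‖mazurExt p (z.1 - x₀)‖ ^ 2 + (z.2 : ℝ) ^ 2 :=
  norm_snocVec_sq (mazurExt p (z.1 - x₀)) z.2

/-- The `i`-th basis vector of `H_n` in `Cl(H_n ⊕ ℝ)`. -/
def basisVec (i : Fin (n + 1)) : Cl (n + 2) := clIncl (n + 1) (vec (EuclideanSpace.single i 1))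

/-- The last basis vector in `Cl(H_n ⊕ ℝ)`. -/
def lastVec (n : ℕ) : Cl (n + 2) := clLast (n + 1)

theorem clIncl_vec (v : Hn n) : clIncl (n + 1) (vec v) = ∑ i, (v i : ℂ) • basisVec i := by
  rw [vec_eq_sum, map_sum]
  exact Finset.sum_congr rfl fun i _ => map_smul _ _ _

theorem vec_cliffordOp (x₀ : Bn p n) (z : Bn p n × ℝ≥0) : vec (cliffordOp p x₀ z) =
    ∑ i, (mazurExt p (z.1 - x₀) i : ℂ) • basisVec i + ((z.2 : ℝ) : ℂ) • lastVec n := by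
  rw [← clIncl_vec]
  exact vec_snocVec (mazurExt p (z.1 - x₀)) (z.2 : ℝ)

theorem bott_apply (x₀ : Bn p n) (f : C₀(ℝ, ℂ)) (z : Bn p n × ℝ≥0) :
    bott p hp x₀ f z = funcCalc f (cliffordOp p x₀ z) := rfl

theorem bott_gaussLine_apply (x₀ : Bn p n) (z : Bn p n × ℝ≥0) :
    bott p hp x₀ gaussLine z = bump hp x₀ z • (1 : Cl (n + 2)) := by
  rw [bott_apply, funcCalc_gaussLine, norm_cliffordOp_sq, bump_apply]

theorem bott_gaussLine (x₀ : Bn p n) :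
    bott p hp x₀ gaussLine = constMul (bump hp x₀) (1 : Cl (n + 2)) :=
  BoundedContinuousFunction.ext fun z => bott_gaussLine_apply hp x₀ z

theorem bott_gaussLineOdd_apply (x₀ : Bn p n) (z : Bn p n × ℝ≥0) :
    bott p hp x₀ gaussLineOdd z = bump hp x₀ z •
      (∑ i, (mazurExt p (z.1 - x₀) i : ℂ) • basisVec i + ((z.2 : ℝ) : ℂ) • lastVec n) := by
  rw [bott_apply, funcCalc_gaussLineOdd, norm_cliffordOp_sq, bump_apply, vec_cliffordOp]

theorem bott_gaussLineOdd (x₀ : Bn p n) :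
    bott p hp x₀ gaussLineOdd = ∑ i, constMul (bumpCoord hp x₀ i) (basisVec i) +
      constMul (bumpLast hp x₀) (lastVec n) := by
  refine BoundedContinuousFunction.ext fun z => ?_
  rw [bott_gaussLineOdd_apply, BoundedContinuousFunction.add_apply,
    BoundedContinuousFunction.sum_apply, smul_add, Finset.smul_sum, constMul_apply,
    bumpLast_apply, mul_smul]
  congr 1
  refine Finset.sum_congr rfl fun i _ => ?_
  rw [constMul_apply, bumpCoord_apply, mul_smul]

theorem isClosed_algASub (n : ℕ) :
    IsClosed (algASub p hp n : Set ((Bn p n × ℝ≥0) →ᵇ Cl (n + 2))) := inferInstance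

theorem bott_mem (x₀ : Bn p n) (f : C₀(ℝ, ℂ)) : bott p hp x₀ f ∈ algASub p hp n :=
  NonUnitalStarSubalgebra.le_topologicalClosure _
    (NonUnitalStarAlgebra.subset_adjoin ℂ _ ⟨x₀, f, rfl⟩)

/-- The algebra `𝒜(B_n)` contains the scalar functions vanishing at infinity. -/
theorem scalar_mem (k : C₀(Bn p n × ℝ≥0, ℂ)) :
    constMul k (1 : Cl (n + 2)) ∈ algASub p hp n := by
  have hP := toReal_pos_of_ne_top hp
  refine constMul_one_mem (algASub p hp n) (isClosed_algASub hp n) (G := Set.range (bump hp))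
    ?_ (fun z => ⟨_, ⟨0, rfl⟩, bump_ne_zero hp 0 z⟩) ?_ k
  · rintro _ ⟨x₀, rfl⟩
    rw [← bott_gaussLine]
    exact bott_mem hp x₀ _
  · rintro ⟨x, t⟩ ⟨y, u⟩ hne
    by_contra hcon
    push Not at hcon
    -- The centres `x₀ = x` and `x₀ = y` give two equations whose sum is `2 ‖y - x‖^p = 0`.
    have h : ∀ x₀ : Bn p n, ‖x - x₀‖ ^ p.toReal + (t : ℝ) ^ 2 =
        ‖y - x₀‖ ^ p.toReal + (u : ℝ) ^ 2 := fun x₀ => by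
      have h1 := hcon _ ⟨x₀, rfl⟩
      rw [bump_apply, bump_apply, Complex.ofReal_inj] at h1
      have h2 := neg_injective (Real.exp_injective h1)
      rwa [norm_mazurExt_sq p hp, norm_mazurExt_sq p hp] at h2
    have hx := h x
    have hy := h y
    rw [sub_self, norm_zero, Real.zero_rpow hP.ne', zero_add] at hx hy
    rw [norm_sub_rev] at hy
    have h3 : 0 ≤ ‖y - x‖ ^ p.toReal := by positivity
    have h4 : ‖y - x‖ ^ p.toReal = 0 := by linarith
    have h5' : (t : ℝ) ^ 2 = (u : ℝ) ^ 2 := by linarith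
    have h5 : (t : ℝ) = u := (sq_eq_sq₀ t.coe_nonneg u.coe_nonneg).mp h5'
    have h6 : y = x := by
      rw [← sub_eq_zero, ← norm_eq_zero]
      exact ((Real.rpow_eq_zero (norm_nonneg _) hP.ne').mp h4)
    exact hne (Prod.ext h6.symm (NNReal.coe_injective h5))

theorem mem_of_vanishing {g : C₀(Bn p n × ℝ≥0, ℂ)} {c : Cl (n + 2)}
    (hg : constMul g c ∈ algASub p hp n) {f : C₀(Bn p n × ℝ≥0, ℂ)}
    (hf : ∀ z, g z = 0 → f z = 0) : constMul f c ∈ algASub p hp n :=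
  constMul_mem_of_vanishing _ (isClosed_algASub hp n) (scalar_mem hp) hg hf

theorem mazurExt_sub_single (x : Bn p n) (i j : Fin (n + 1)) (hj : j ≠ i) :
    mazurExt p (x - WithLp.toLp p (Pi.single i 1)) j = mazurExt p (x - 0) j := by
  rw [mazurExt_apply, mazurExt_apply]
  simp [hj]

theorem mazurExt_sub_single_ne (hp : p ≠ ∞) (x : Bn p n) (i : Fin (n + 1)) :
    mazurExt p (x - 0) i ≠ mazurExt p (x - WithLp.toLp p (Pi.single i 1)) i := by
  rw [mazurExt_apply, mazurExt_apply]
  have h := signedPow_ne (half_pos (toReal_pos_of_ne_top hp)) (x i)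
  simpa using h

/-- Compare the odd Gaussian at the centres `0` and `x₁`, the `i`-th unit vector, each multiplied by
the even Gaussian at the other centre to equalise the coefficients. The Mazur map acts
coordinatewise, so every term but the `i`-th cancels, including that of `ℝ`. The remaining
coefficient never vanishes, hence can be replaced by any `k`. -/
theorem basisVec_mem (i : Fin (n + 1)) (k : C₀(Bn p n × ℝ≥0, ℂ)) :
    constMul k (basisVec i) ∈ algASub p hp n := by
  set x₁ : Bn p n := WithLp.toLp p (Pi.single i 1) with hx₁
  have hD : constMul (bump hp x₁ * bumpCoord hp 0 i - bump hp 0 * bumpCoord hp x₁ i)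
      (basisVec i) = bott p hp x₁ gaussLine * bott p hp 0 gaussLineOdd -
        bott p hp 0 gaussLine * bott p hp x₁ gaussLineOdd := by
    refine BoundedContinuousFunction.ext fun z => ?_
    have h1 : ∑ j, (mazurExt p (z.1 - 0) j : ℂ) • basisVec j =
        ∑ j, (mazurExt p (z.1 - x₁) j : ℂ) • basisVec j +
        ((mazurExt p (z.1 - 0) i : ℂ) - (mazurExt p (z.1 - x₁) i : ℂ)) • basisVec i := by
      rw [← Finset.add_sum_erase _ _ (Finset.mem_univ i),
        ← Finset.add_sum_erase _ (fun j => (mazurExt p (z.1 - x₁) j : ℂ) • basisVec j)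
          (Finset.mem_univ i),
        Finset.sum_congr rfl (g := fun j => (mazurExt p (z.1 - x₁) j : ℂ) • basisVec j)
          fun j hj => by rw [hx₁, mazurExt_sub_single _ i j (Finset.ne_of_mem_erase hj)]]
      module
    change (bump hp x₁ z * bumpCoord hp 0 i z - bump hp 0 z * bumpCoord hp x₁ i z) • basisVec i =
      bott p hp x₁ gaussLine z * bott p hp 0 gaussLineOdd z -
        bott p hp 0 gaussLine z * bott p hp x₁ gaussLineOdd z
    rw [bott_gaussLine_apply, bott_gaussLine_apply, bott_gaussLineOdd_apply,
      bott_gaussLineOdd_apply, bumpCoord_apply, bumpCoord_apply, h1, smul_one_mul, smul_one_mul]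
    module
  refine mem_of_vanishing hp (hD ▸ sub_mem (mul_mem (bott_mem hp _ _) (bott_mem hp _ _))
    (mul_mem (bott_mem hp _ _) (bott_mem hp _ _))) fun z hz => ?_
  exfalso
  change bump hp x₁ z * bumpCoord hp 0 i z - bump hp 0 z * bumpCoord hp x₁ i z = 0 at hz
  rw [bumpCoord_apply, bumpCoord_apply] at hz
  have h2 : bump hp x₁ z * bump hp 0 z *
      ((mazurExt p (z.1 - 0) i : ℂ) - (mazurExt p (z.1 - x₁) i : ℂ)) = 0 := by
    linear_combination hz
  rcases mul_eq_zero.mp h2 with h3 | h3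
  · exact mul_ne_zero (bump_ne_zero hp _ z) (bump_ne_zero hp _ z) h3
  · exact mazurExt_sub_single_ne hp z.1 i (Complex.ofReal_injective (sub_eq_zero.mp h3))

/-- It is what is left of the odd Gaussian Bott element after its `H_n` components are removed. -/
theorem bumpLast_mem : constMul (bumpLast hp 0) (lastVec n) ∈ algASub p hp n := by
  have h := eq_sub_of_add_eq' (bott_gaussLineOdd hp (0 : Bn p n)).symm
  rw [h]
  exact sub_mem (bott_mem hp _ _) (sum_mem fun i _ => basisVec_mem hp i _)

theorem mul_basisVec_mem {c : Cl (n + 2)} (hc : ∀ k, constMul k c ∈ algASub p hp n)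
    {d : Cl (n + 2)} (hd : ∀ k, constMul k d ∈ algASub p hp n) (k : C₀(Bn p n × ℝ≥0, ℂ)) :
    constMul k (c * d) ∈ algASub p hp n := by
  have h := mul_mem (hc (bump hp 0)) (hd (bump hp 0))
  rw [constMul_mul] at h
  exact mem_of_vanishing hp h fun z hz =>
    absurd hz (mul_ne_zero (bump_ne_zero hp 0 z) (bump_ne_zero hp 0 z))

theorem clIncl_mem (c : Cl (n + 1)) (k : C₀(Bn p n × ℝ≥0, ℂ)) :
    constMul k (clIncl (n + 1) c) ∈ algASub p hp n := by
  let U : StarSubalgebra ℂ (Cl (n + 1)) :=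
    { carrier := {c | ∀ k, constMul k (clIncl (n + 1) c) ∈ algASub p hp n}
      mul_mem' := fun {c d} hc hd k => by
        have h := mul_basisVec_mem hp hc hd k
        rwa [← map_mul] at h
      add_mem' := fun {c d} hc hd k => by
        have h : constMul k (clIncl (n + 1) (c + d)) =
            constMul k (clIncl (n + 1) c) + constMul k (clIncl (n + 1) d) :=
          BoundedContinuousFunction.ext fun z => by
            rw [map_add]; exact smul_add (k z) _ _
        rw [h]
        exact add_mem (hc k) (hd k)
      algebraMap_mem' := fun a k => by
        have h : constMul k (clIncl (n + 1) (algebraMap ℂ (Cl (n + 1)) a)) =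
            a • constMul k (1 : Cl (n + 2)) :=
          BoundedContinuousFunction.ext fun z => by
            rw [AlgHomClass.commutes, Algebra.algebraMap_eq_smul_one]
            exact smul_comm (k z) a _
        rw [h]
        exact SMulMemClass.smul_mem a (scalar_mem hp k)
      star_mem' := fun {c} hc k => by
        have h := star_mem (hc (star k))
        rwa [star_constMul, star_star, ← map_star] at h }
  have hU : IsClosed (U : Set (Cl (n + 1))) := by
    have : (U : Set (Cl (n + 1))) = ⋂ k : C₀(Bn p n × ℝ≥0, ℂ),
        (fun c => (constMul k (clIncl (n + 1) c) : (Bn p n × ℝ≥0) →ᵇ Cl (n + 2))) ⁻¹'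
          (algASub p hp n : Set ((Bn p n × ℝ≥0) →ᵇ Cl (n + 2))) := by
      ext c
      rw [Set.mem_iInter]
      rfl
    rw [this]
    exact isClosed_iInter fun k => (isClosed_algASub hp n).preimage
      ((continuous_constMul_right k).comp (map_continuous (clIncl (n + 1))))
  have hvec : ∀ v : Hn n, vec v ∈ U := fun v k => by
    have h : constMul k (clIncl (n + 1) (vec v)) =
        ∑ i, (v i : ℂ) • constMul k (basisVec i) :=
      BoundedContinuousFunction.ext fun z => by
        rw [clIncl_vec, BoundedContinuousFunction.sum_apply, constMul_apply, Finset.smul_sum]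
        exact Finset.sum_congr rfl fun i _ => smul_comm (k z) _ _
    rw [h]
    exact sum_mem fun i _ => SMulMemClass.smul_mem _ (basisVec_mem hp i k)
  have htop : ∀ c, c ∈ U := by
    rintro ⟨T, hT⟩
    -- The Clifford algebra is defined by closure among the operators, so `U` is transported there
    -- by the isometric inclusion, which keeps it closed.
    have hle : cliffordSub (⊤ : Submodule ℝ (EuclideanSpace ℝ (Fin (n + 1)))) ≤
        U.map (Cl.op : Cl (n + 1) →⋆ₐ[ℂ] _) := by
      refine StarSubalgebra.topologicalClosure_minimal (StarAlgebra.adjoin_le ?_) ?_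
      · rintro _ ⟨v, -, rfl⟩
        exact ⟨vec v, hvec v, rfl⟩
      · have hiso : Isometry (Cl.op : Cl (n + 1) →⋆ₐ[ℂ] _) :=
          AddMonoidHomClass.isometry_of_norm _ fun a => (Cl.norm_eq a).symm
        exact hiso.isClosedEmbedding.isClosedMap _ hU
    obtain ⟨c, hc, hcT⟩ := hle hT
    have : c = ⟨T, hT⟩ := Cl.ext hcT
    exact this ▸ hc
  exact htop c k

/-- The available coefficient of `e c` is `t` times a nowhere vanishing function, so its zero set is
exactly `t = 0`. This matches the boundary condition of `C_{b,0}`. -/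
theorem lastVec_mul_mem (c : Cl (n + 1)) {k : C₀(Bn p n × ℝ≥0, ℂ)} (hk : ∀ x, k (x, 0) = 0) :
    constMul k (lastVec n * clIncl (n + 1) c) ∈ algASub p hp n := by
  have h := mul_mem (bumpLast_mem hp) (clIncl_mem hp c (bump hp 0))
  rw [constMul_mul] at h
  refine mem_of_vanishing hp h fun z hz => ?_
  change bumpLast hp 0 z * bump hp 0 z = 0 at hz
  rw [bumpLast_apply] at hz
  have h0 : ((z.2 : ℝ) : ℂ) = 0 := by
    rcases mul_eq_zero.mp hz with h1 | h1
    · exact (mul_eq_zero.mp h1).resolve_left (bump_ne_zero hp 0 z)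
    · exact absurd h1 (bump_ne_zero hp 0 z)
  have h1 : z.2 = 0 := NNReal.coe_injective (Complex.ofReal_injective h0)
  have h2 : z = (z.1, 0) := Prod.ext rfl h1
  rw [h2]
  exact hk z.1

end BottGenerators

/-! ### The two algebras inside the families of operators. -/

section Inclusions

/-- The inclusion of `A ⊗̂ B` into the algebra of all families of operators. -/
def GradedTensor.incl {A B : Type u} [NonUnitalCStarAlgebra A] [NonUnitalCStarAlgebra B]
    (α : CStarGrading A) (β : CStarGrading B) : GradedTensor α β →⋆ₙₐ[ℂ] PairAlg α β where
  toFun y := y.1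
  map_smul' _ _ := rfl
  map_zero' := rfl
  map_add' _ _ := rfl
  map_mul' _ _ := rfl
  map_star' _ := rfl

variable (p : ℝ≥0∞) [Fact (1 ≤ p)] (hp : p ≠ ∞) (n : ℕ)

/-- The inclusion of `𝒜(B_n)` into the bounded continuous functions. -/
def AlgA.incl : AlgA p hp n →⋆ₙₐ[ℂ] ((Bn p n × ℝ≥0) →ᵇ Cl (n + 2)) where
  toFun y := y.1
  map_smul' _ _ := rfl
  map_zero' := rfl
  map_add' _ _ := rfl
  map_mul' _ _ := rfl
  map_star' _ := rfl

/-- The elements of `𝓢𝒞(B_n)`, as families of operators indexed by `B_n × ℝ₊`. -/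
def familySC : AlgSC p n →⋆ₙₐ[ℂ] OpFamily p n :=
  (restrictPoints p n).comp (GradedTensor.incl _ _)

/-- The elements of `𝒜(B_n)`, as families of operators indexed by `B_n × ℝ₊`. -/
def familyA : AlgA p hp n →⋆ₙₐ[ℂ] OpFamily p n :=
  (functionFamily p n).comp (AlgA.incl p hp n)

theorem familyA_injective : Function.Injective (familyA p hp n) := fun _ _ h =>
  Subtype.ext (functionFamily_injective p h)

theorem familySC_injective : Function.Injective (familySC p n) := by
  obtain ⟨C, hC⟩ := exists_norm_le_restrictPoints p n
  refine (injective_iff_map_eq_zero (familySC p n)).mpr fun y hy => Subtype.ext ?_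
  have h1 : restrictPoints p n y.1 = 0 := hy
  have h2 := hC y.1 y.2
  rw [h1, norm_zero, mul_zero] at h2
  exact norm_le_zero_iff.mp h2

end Inclusions

/-! ### Equality of the two ranges. -/

section Ranges

variable (p : ℝ≥0∞) [Fact (1 ≤ p)] (hp : p ≠ ∞) {n : ℕ}

/-- The values of an elementary tensor, as a bounded continuous function. -/
theorem restrictPoints_eq_functionFamily {y : PairAlg lineGrading (algCGrading p n)}
    {F : (Bn p n × ℝ≥0) →ᵇ Cl (n + 2)} (h : ∀ z, evalPoint p z y = Cl.op (F z)) :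
    restrictPoints p n y = functionFamily p n F :=
  BddFamily.ext h

theorem oddHalf_zero (a : C₀(ℝ, ℂ)) : oddHalf a 0 = 0 := by
  change (a ((0 : ℝ≥0) : ℝ) - a (-((0 : ℝ≥0) : ℝ))) / 2 = 0
  simp

theorem restrictPoints_elemTensor_constSMul (a : C₀(ℝ, ℂ)) (g : C₀(Bn p n, ℂ)) (c : Cl (n + 1)) :
    restrictPoints p n (elemTensor lineGrading (algCGrading p n) a (constSMul g c)) =
      functionFamily p n (constMul (prodC0 g (evHalf a)) (clIncl (n + 1) c) +
        constMul (prodC0 g (oddHalf a)) (lastVec n * clIncl (n + 1) c)) := by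
  refine restrictPoints_eq_functionFamily p fun z => ?_
  rw [evalPoint_elemTensor]
  congr 1
  change clIncl (n + 1) (evPart a z.2 • g z.1 • c) +
    clLast (n + 1) * clIncl (n + 1) (oddPart a z.2 • g z.1 • c) =
    (g z.1 * evPart a z.2) • clIncl (n + 1) c +
    (g z.1 * oddPart a z.2) • (clLast (n + 1) * clIncl (n + 1) c)
  rw [smul_smul, smul_smul, map_smul, map_smul, mul_smul_comm, mul_comm (evPart a z.2),
    mul_comm (oddPart a z.2)]

theorem elemTensor_sum {A B : Type u} [NonUnitalCStarAlgebra A] [NonUnitalCStarAlgebra B]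
    {α : CStarGrading A} {β : CStarGrading B} (a : A) {ι : Type*} (s : Finset ι) (b : ι → B) :
    elemTensor α β a (∑ i ∈ s, b i) = ∑ i ∈ s, elemTensor α β a (b i) := by
  let L : B →+ PairAlg α β :=
    { toFun := elemTensor α β a
      map_zero' := PairAlg.ext fun r => by
        change r.left a * r.right 0 = 0
        rw [map_zero, mul_zero]
      map_add' := fun b b' => PairAlg.ext fun r => by
        change r.left a * r.right (b + b') = r.left a * r.right b + r.left a * r.right b'
        rw [map_add, mul_add] }
  exact map_sum L b s

/-- Expanding `b` in a basis of `Cl(H_n)` leaves terms in `c` and in `e c`. The latter have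
coefficients with the factor `a_odd(t)`, which vanishes at `t = 0` as required. -/
theorem exists_functionFamily_eq_elemTensor (a : C₀(ℝ, ℂ)) (b : C₀(Bn p n, Cl (n + 1))) :
    ∃ F, familyA p hp n F =
      restrictPoints p n (elemTensor lineGrading (algCGrading p n) a b) := by
  obtain ⟨K, u, -⟩ := exists_unitary_basis (Cl (n + 1))
  set g : Fin K → C₀(Bn p n, ℂ) := fun k =>
    compFunctional (LinearMap.toContinuousLinearMap (u.coord k)) b
  refine ⟨⟨∑ k, (constMul (prodC0 (g k) (evHalf a)) (clIncl (n + 1) (u k)) +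
    constMul (prodC0 (g k) (oddHalf a)) (lastVec n * clIncl (n + 1) (u k))),
    sum_mem fun k _ => add_mem (clIncl_mem hp _ _) (lastVec_mul_mem hp _ fun x => ?_)⟩, ?_⟩
  · rw [prodC0_apply, oddHalf_zero, mul_zero]
  · change functionFamily p n (∑ k, _) = _
    rw [map_sum]
    conv_rhs => rw [sum_constSMul_coord u b, elemTensor_sum, map_sum]
    exact Finset.sum_congr rfl fun k _ => (restrictPoints_elemTensor_constSMul p a (g k) (u k)).symm

/-- The values of `𝓢𝒞(B_n)` on `B_n × ℝ₊` belong to `𝒜(B_n)`. -/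
theorem exists_familyA_eq (y : AlgSC p n) : ∃ F, familyA p hp n F = familySC p n y := by
  have hle : gradedTensorSub lineGrading (algCGrading p n) ≤
      preimageRange (familyA p hp n) (restrictPoints p n) := by
    refine NonUnitalStarSubalgebra.topologicalClosure_minimal _
      (NonUnitalStarAlgebra.adjoin_le ?_)
      (isClosed_setOf_mem_range _ (restrictPoints p n) (familyA_injective p hp n))
    rintro _ ⟨a, b, rfl⟩
    exact exists_functionFamily_eq_elemTensor p hp a b
  exact hle y.2

variable {p}

/-- The Bott map at `x₀`, as a `*`-homomorphism. -/
def bottHom (x₀ : Bn p n) : C₀(ℝ, ℂ) →⋆ₙₐ[ℂ] ((Bn p n × ℝ≥0) →ᵇ Cl (n + 2)) where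
  toFun f := bott p hp x₀ f
  map_smul' c f := BoundedContinuousFunction.ext fun z =>
    map_smul (funcCalcHom (cliffordOp p x₀ z)) c f
  map_zero' := BoundedContinuousFunction.ext fun z => map_zero (funcCalcHom (cliffordOp p x₀ z))
  map_add' f g := BoundedContinuousFunction.ext fun z =>
    map_add (funcCalcHom (cliffordOp p x₀ z)) f g
  map_mul' f g := BoundedContinuousFunction.ext fun z =>
    map_mul (funcCalcHom (cliffordOp p x₀ z)) f g
  map_star' f := BoundedContinuousFunction.ext fun z =>
    map_star (funcCalcHom (cliffordOp p x₀ z)) f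

theorem evHalf_gaussLineOdd : evHalf gaussLineOdd = 0 :=
  ZeroAtInftyContinuousMap.ext fun t => evPart_gaussLineOdd t

theorem oddHalf_gaussLine : oddHalf gaussLine = 0 :=
  ZeroAtInftyContinuousMap.ext fun t => oddPart_gaussLine t

theorem prodC0_zero {X Y : Type*} [TopologicalSpace X] [TopologicalSpace Y] (f : C₀(X, ℂ)) :
    prodC0 f (0 : C₀(Y, ℂ)) = 0 :=
  ZeroAtInftyContinuousMap.ext fun z => mul_zero (f z.1)

theorem constMul_zero_left {Y N : Type*} [TopologicalSpace Y] [CStarAlgebra N] (c : N) :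
    constMul (0 : C₀(Y, ℂ)) c = 0 :=
  BoundedContinuousFunction.ext fun _ => zero_smul ℂ c

theorem functionFamily_bott_gaussLine (x₀ : Bn p n) :
    functionFamily p n (bott p hp x₀ gaussLine) =
      restrictPoints p n (elemTensor _ _ gaussLine (constSMul (gaussB hp x₀) 1)) := by
  rw [restrictPoints_elemTensor_constSMul, oddHalf_gaussLine, prodC0_zero, constMul_zero_left,
    add_zero, map_one, bott_gaussLine]
  rfl

/-- Since `‖(v, t)‖² = ‖v‖² + t²`, the Gaussian factors. The `H_n` components pair with `exp(-t²)`,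
and the last one with `t exp(-t²)`. -/
theorem functionFamily_bott_gaussLineOdd (x₀ : Bn p n) :
    functionFamily p n (bott p hp x₀ gaussLineOdd) =
      restrictPoints p n (∑ i, elemTensor _ _ gaussLine
          (constSMul (gaussCoord hp x₀ i) (vec (EuclideanSpace.single i 1))) +
        elemTensor _ _ gaussLineOdd (constSMul (gaussB hp x₀) 1)) := by
  rw [map_add, map_sum, restrictPoints_elemTensor_constSMul, evHalf_gaussLineOdd, prodC0_zero,
    constMul_zero_left, zero_add, map_one, mul_one, bott_gaussLineOdd, map_add, map_sum]
  congr 1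
  refine Finset.sum_congr rfl fun i _ => ?_
  rw [restrictPoints_elemTensor_constSMul, oddHalf_gaussLine, prodC0_zero, constMul_zero_left,
    add_zero]
  rfl

/-- The functions `f` with this property form a closed `*`-subalgebra of `C₀(ℝ)`, because the range
of `familySC` is closed. So the two Gaussians suffice. -/
theorem exists_familySC_eq_bott (x₀ : Bn p n) (f : C₀(ℝ, ℂ)) :
    ∃ y, familySC p n y = functionFamily p n (bott p hp x₀ f) := by
  refine mem_of_gaussLine_mem
    (preimageRange (familySC p n) ((functionFamily p n).comp (bottHom hp x₀)))
    (isClosed_setOf_mem_range _ _ (familySC_injective p n)) ?_ ?_ f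
  · exact ⟨tmul _ _ gaussLine (constSMul (gaussB hp x₀) 1),
      (functionFamily_bott_gaussLine hp x₀).symm⟩
  · refine ⟨∑ i, tmul _ _ gaussLine
          (constSMul (gaussCoord hp x₀ i) (vec (EuclideanSpace.single i 1))) +
        tmul _ _ gaussLineOdd (constSMul (gaussB hp x₀) 1), ?_⟩
    refine Eq.trans ?_ (functionFamily_bott_gaussLineOdd hp x₀).symm
    rw [map_add, map_sum, map_add, map_sum]
    rfl

/-- The functions in `𝒜(B_n)` are the values of elements of `𝓢𝒞(B_n)`. -/
theorem exists_familySC_eq (F : AlgA p hp n) : ∃ y, familySC p n y = familyA p hp n F := by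
  have hle : algASub p hp n ≤ preimageRange (familySC p n) (functionFamily p n) := by
    refine NonUnitalStarSubalgebra.topologicalClosure_minimal _
      (NonUnitalStarAlgebra.adjoin_le ?_)
      (isClosed_setOf_mem_range _ (functionFamily p n) (familySC_injective p n))
    rintro _ ⟨x₀, f, rfl⟩
    exact exists_familySC_eq_bott hp x₀ f
  exact hle F.2

end Ranges

/-! ### Compatibility of the point evaluations with the gradings. -/

section Grading

variable (p : ℝ≥0∞) [Fact (1 ≤ p)] {n : ℕ}

theorem cliffordGrading_clLast (m : ℕ) : (cliffordGrading (m + 1)).aut (clLast m) = -clLast m :=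
  cliffordGrading_vec _

theorem cliffordGrading_clIncl_add {m : ℕ} (e o : ℂ) (b : Cl m) :
    (cliffordGrading (m + 1)).aut (clIncl m (e • b) + clLast m * clIncl m (o • b)) =
      clIncl m (e • (cliffordGrading m).aut b) +
        clLast m * clIncl m ((-o) • (cliffordGrading m).aut b) := by
  rw [map_add, map_mul, cliffordGrading_clIncl, cliffordGrading_clIncl, cliffordGrading_clLast,
    map_smul (cliffordGrading m).aut e, map_smul (cliffordGrading m).aut o, neg_smul, map_neg,
    mul_neg, neg_mul]

theorem evPart_lineGrading (a : C₀(ℝ, ℂ)) (t : ℝ) : evPart (lineGrading.aut a) t = evPart a t := by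
  change (a (-t) + a (- -t)) / 2 = (a t + a (-t)) / 2
  rw [neg_neg, add_comm]

theorem oddPart_lineGrading (a : C₀(ℝ, ℂ)) (t : ℝ) :
    oddPart (lineGrading.aut a) t = -oddPart a t := by
  change (a (-t) - a (- -t)) / 2 = -((a t - a (-t)) / 2)
  rw [neg_neg]; ring

theorem evalPoint_aut_elemTensor (z : Bn p n × ℝ≥0) (a : C₀(ℝ, ℂ)) (b : C₀(Bn p n, Cl (n + 1))) :
    evalPoint p z ((pairGrading _ _).aut (elemTensor lineGrading (algCGrading p n) a b)) =
      (fockGrading (n + 2)).aut (evalPoint p z (elemTensor _ _ a b)) := by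
  rw [pairGrading_elemTensor, evalPoint_elemTensor, evalPoint_elemTensor, evPart_lineGrading,
    oddPart_lineGrading]
  exact congrArg Cl.op (cliffordGrading_clIncl_add (evPart a z.2) (oddPart a z.2) (b z.1)).symm

theorem evalPoint_aut (z : Bn p n × ℝ≥0) {y : PairAlg lineGrading (algCGrading p n)}
    (hy : y ∈ gradedTensorSub lineGrading (algCGrading p n)) :
    evalPoint p z ((pairGrading _ _).aut y) = (fockGrading (n + 2)).aut (evalPoint p z y) := by
  have hle : gradedTensorSub lineGrading (algCGrading p n) ≤ NonUnitalStarAlgHom.equalizer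
      ((evalPoint p z).comp (pairGrading _ _).aut)
      ((fockGrading (n + 2)).aut.comp (evalPoint p z)) := by
    refine NonUnitalStarSubalgebra.topologicalClosure_minimal _
      (NonUnitalStarAlgebra.adjoin_le ?_)
      (isClosed_eq (map_continuous ((evalPoint p z).comp (pairGrading _ _).aut))
        (map_continuous ((fockGrading (n + 2)).aut.comp (evalPoint p z))))
    rintro _ ⟨a, b, rfl⟩
    exact evalPoint_aut_elemTensor p z a b
  exact hle hy

end Grading

end

end LpBott

/-! ### The isomorphism and its values. -/

theorem mainTheorem10 (p : ℝ≥0∞) [Fact (1 ≤ p)] (hp : p ≠ ∞) (n : ℕ) :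
    ∃ Φ : LpBott.AlgSC p n ≃⋆ₐ[ℂ] LpBott.AlgA p hp n,
      (∀ a, Φ ((LpBott.algSCGrading p n).aut a) = (LpBott.algAGrading p hp n).aut (Φ a)) ∧
      (∀ (f : C₀(ℝ, ℂ)) (h : C₀(LpBott.Bn p n, LpBott.Cl (n + 1))) (h₀ : LpBott.Bn p n → ℂ),
        (∀ t, f (-t) = f t) → (∀ x, h x = h₀ x • (1 : LpBott.Cl (n + 1))) →
        ∀ (x : LpBott.Bn p n) (t : ℝ≥0),
          (Φ (LpBott.tmul LpBott.lineGrading (LpBott.algCGrading p n) f h)).eval (x, t) =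
            (f t * h₀ x) • (1 : LpBott.Cl (n + 2))) := by
  obtain ⟨Φ, hΦ⟩ := LpBott.exists_starAlgEquiv (LpBott.familySC p n) (LpBott.familyA p hp n)
    (LpBott.familySC_injective p n) (LpBott.familyA_injective p hp n)
    (LpBott.exists_familyA_eq p hp) (LpBott.exists_familySC_eq hp)
  -- The value of `Φ a` at `z` is `a` evaluated in the pair at `z`; both remaining claims follow
  -- from this formula.
  have hval : ∀ a z, LpBott.Cl.op ((Φ a).eval z) = LpBott.evalPoint p z a.1 := fun a z =>
    congrArg (LpBott.BddFamily.eval z) (hΦ a)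
  refine ⟨Φ, fun a => ?_, fun f h h₀ hf hh x t => LpBott.Cl.ext ?_⟩
  · refine Subtype.ext (BoundedContinuousFunction.ext fun z => LpBott.Cl.ext ?_)
    refine (hval ((LpBott.algSCGrading p n).aut a) z).trans ?_
    refine (LpBott.evalPoint_aut p z a.2).trans ?_
    exact congrArg (LpBott.fockGrading (n + 2)).aut (hval a z).symm
  · rw [hval]
    refine (LpBott.evalPoint_elemTensor p (x, t) f h).trans ?_
    have ho : LpBott.oddPart f t = 0 := by rw [LpBott.oddPart, hf, sub_self, zero_div]
    have he : LpBott.evPart f t = f t := by rw [LpBott.evPart, hf, add_self_div_two]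
    have h1 : LpBott.clIncl (n + 1) (LpBott.evPart f t • h x) +
        LpBott.clLast (n + 1) * LpBott.clIncl (n + 1) (LpBott.oddPart f t • h x) =
        (f t * h₀ x) • (1 : LpBott.Cl (n + 1 + 1)) := by
      rw [ho, he, zero_smul, map_zero, mul_zero, add_zero, hh, smul_smul, map_smul, map_one]
    exact congrArg LpBott.Cl.op h1
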